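/- Conventions. Fix finite alphabets $\mathcal N$ (node-vertex labels), $\mathcal W$ (wire-vertex labels), $\mathcal X$ (nonterminals), $\mathcal E$ (encoding symbols) and $\mathcal F$ (other edge labels), pairwise disjoint, and put $\Sigma=\mathcal N\cup\mathcal W\cup\mathcal X$, $\Gamma=\mathcal E\cup\mathcal F$. A graph is a finite directed graph without self-loops, with vertices labelled in $\Sigma$ and edge set a set of triples $(v,\gamma,w)$, $\gamma\in\Gamma$. A string graph is a graph with vertex labels in $\mathcal N\cup\mathcal W$ and edge labels in $\mathcal F$ in which no edge connects two node-vertices (vertices labelled in $\mathcal N$) and every wire-vertex (labelled in $\mathcal W$) has in-degree at most one and out-degree at most one. Its inputs (outputs) are the wire-vertices without incoming (outgoing) edges, and its boundary consists of the inputs and outputs. String graphs $G,G'$ are wire-homeomorphic, $G\sim G'$, if up to isomorphism one is obtained from the other by finitely many times merging two adjacent equally labelled wire-vertices into one or splitting a wire-vertex into two adjacent ones, all graphs on the way being string graphs. A matching of $K$ onto a string graph $H$ is an injective label-preserving graph homomorphism $m:K\to\widetilde H$ for some $\widetilde H\sim H$ such that every edge of $\widetilde H$ between a vertex $m(x)$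 in the image and a vertex outside the image has $x$ in the boundary of $K$. Grammars. A B-ESG grammar $B$ consists of an initial nonterminal $S$, a finite set of productions $X\to(D,C)$ ($X\in\mathcal X$, $D$ a graph, $C\subseteq\Sigma\times\Gamma\times\Gamma\times V_D\times\{in,out\}$ with elements written $(\sigma,\beta/\gamma,x,d)$), and a decoding system $T$, such that for all productions $X\to(D,C)$: no two nonterminal vertices of $D$ are adjacent and no $(\sigma,\beta/\gamma,x,d)\in C$ has $\sigma\in\mathcal X$; and N1: an edge of $D$ has a label in $\mathcal E$ if and only if it connects two node-vertices; N2: if $(N,\alpha/\beta,x,d)\in C$ with $N\in\mathcal N$ and $x$ a node-vertex, then $\beta\in\mathcal E$; W1: wire-vertices of $D$ have in-degree and out-degree at most one; W2: no $(\sigma,\alpha/\beta,x,d)\in C$ has $x$ a wire-vertex; W3: for each $W\in\mathcal W$, $\gamma$, $d$ there is at most one $(W,\gamma/\delta,x,d)\in C$, and then $\delta\notin\mathcal E$; W4: if a nonterminal vertex $y$ of $D$ with label $Y$ is adjacent to a wire-vertex labelled $W$ by an edge labelled $\beta$ of direction $d$ (seen from $y$), or some $(W,\alpha/\beta,y,d)\in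 C$, then every production for $Y$ has a connection instruction of the form $(W,\beta/\gamma,z,d)$. The decoding system has one rule for every $(\alpha,N_1,N_2)\in\mathcal E\times\mathcal N\times\mathcal N$; it replaces an $\alpha$-labelled edge from an $N_1$-vertex to an $N_2$-vertex by a connected string graph without inputs and outputs that contains these two (distinct) vertices and is glued in along them. Derivations. A derivation step replaces a nonterminal vertex $v$ labelled $X$ in a graph $H$ by a fresh copy of $D$, for a production $X\to(D,C)$; besides the edges of $D$ and those of $H$ not incident to $v$, the result has an edge $(w,\gamma,x)$ for every edge $(w,\beta,v)$ of $H$ and every $(\lambda_H(w),\beta/\gamma,x,in)\in C$, and an edge $(x,\gamma,w)$ for every edge $(v,\beta,w)$ of $H$ and every $(\lambda_H(w),\beta/\gamma,x,out)\in C$. A concrete derivation $S\Rightarrow_*^B K$ is a sequence of derivation steps from the graph with a single vertex labelled $S$ to a graph without nonterminals, followed by a sequence of applications of decoding rules leading to a graph $K$ without edges labelled in $\mathcal E$. The names of the vertices of the copies are chosen in a canonical way, so that derivations that differ only by renaming new vertices are identified. A B-ESG grammar is match-exhaustive if (1) for every production whose body $D$ contains a bare wire (a chain of at least two wire-vertices,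 connected to no other vertex of $D$, that is not a directed cycle) there is a finite bound on the number of times it is used in a derivation from $S$, (2) no production body contains an isolated wire-vertex, (3) no production body is empty, and (4) no production body consists of a single vertex that is nonterminal. Theorem. There is an algorithm (a computable function) that, given a match-exhaustive B-ESG grammar $B$ and a string graph $H$ over these alphabets, outputs a finite list consisting of exactly the concrete derivations $S\Rightarrow_*^B K$ (together with their results $K$) such that there is a matching $m:K\to\widetilde H$ for some $\widetilde H\sim H$. In particular, the set of these derivations is finite. -/

import Mathlib

namespace BESG

/-! Alphabets: `N` node-vertex labels, `W` wire-vertex labels, `X` nonterminal labels,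
`E` encoding symbols, `F` the remaining edge labels. The vertex alphabet is `N ⊔ W ⊔ X`,
with terminal part `N ⊔ W`, and the edge alphabet is `E ⊔ F`, all edge labels being final. -/

/-- Vertex labels. -/
inductive VLabel (N W X : Type*) where
  | node (n : N)
  | wire (w : W)
  | nonterminal (x : X)
deriving DecidableEq

/-- Edge labels. -/
inductive ELabel (E F : Type*) where
  | enc (e : E)
  | plain (f : F)
deriving DecidableEq

/-- Direction of an edge, seen from the nonterminal: into it or out of it. -/
inductive Dir where
  | inward
  | outward
deriving DecidableEq

/-- A finite directed graph with labelled vertices and labelled edges. Vertices are named by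
natural numbers, `(x, σ) ∈ verts` means that `x` is a vertex with label `σ`, and
`(x, γ, y) ∈ edges` means that there is an edge labelled `γ` from `x` to `y`. Only membership in
the two lists matters. -/
structure LGraph (N W X E F : Type*) where
  verts : List (ℕ × VLabel N W X)
  edges : List (ℕ × ELabel E F × ℕ)

/-- The connection instruction `(label, old / new, vertex, dir)`. -/
structure ConnInstr (N W X E F : Type*) where
  label : VLabel N W X
  old : ELabel E F
  new : ELabel E F
  vertex : ℕ
  dir : Dir

/-- The production `lhs → (body, conn)`. -/
structure Production (N W X E F : Type*) where
  lhs : X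
  body : LGraph N W X E F
  conn : List (ConnInstr N W X E F)

/-- A decoding rule: an edge labelled `symbol` from a node-vertex labelled `srcLabel` to a
node-vertex labelled `tgtLabel` is replaced by `rhs`, whose vertices `src` and `tgt` are
the two node-vertices shared with the left-hand side. -/
structure DecodingRule (N W X E F : Type*) where
  symbol : E
  srcLabel : N
  tgtLabel : N
  rhs : LGraph N W X E F
  src : ℕ
  tgt : ℕ

/-- The data of a grammar together with a decoding system. -/
structure Grammar (N W X E F : Type*) where
  start : X
  productions : List (Production N W X E F)
  decoding : List (DecodingRule N W X E F)

/-! ### Coding by natural numbers -/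

section Coding

variable {N W X E F : Type*}

/-- Coding of vertex labels. -/
def VLabel.equiv : VLabel N W X ≃ N ⊕ W ⊕ X where
  toFun
    | .node n => .inl n
    | .wire w => .inr (.inl w)
    | .nonterminal x => .inr (.inr x)
  invFun
    | .inl n => .node n
    | .inr (.inl w) => .wire w
    | .inr (.inr x) => .nonterminal x
  left_inv a := by cases a <;> rfl
  right_inv a := by rcases a with _ | _ | _ <;> rfl

/-- Coding of edge labels. -/
def ELabel.equiv : ELabel E F ≃ E ⊕ F where
  toFun
    | .enc e => .inl e
    | .plain f => .inr f
  invFun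
    | .inl e => .enc e
    | .inr f => .plain f
  left_inv a := by cases a <;> rfl
  right_inv a := by rcases a with _ | _ <;> rfl

/-- Coding of directions. -/
def Dir.equiv : Dir ≃ Bool where
  toFun
    | .inward => true
    | .outward => false
  invFun
    | true => .inward
    | false => .outward
  left_inv a := by cases a <;> rfl
  right_inv a := by cases a <;> rfl

/-- Coding of graphs. -/
def LGraph.equiv :
    LGraph N W X E F ≃ List (ℕ × VLabel N W X) × List (ℕ × ELabel E F × ℕ) where
  toFun G := (G.verts, G.edges)
  invFun t := ⟨t.1, t.2⟩
  left_inv _ := rfl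
  right_inv _ := rfl

/-- Coding of connection instructions. -/
def ConnInstr.equiv :
    ConnInstr N W X E F ≃ VLabel N W X × ELabel E F × ELabel E F × ℕ × Dir where
  toFun c := (c.label, c.old, c.new, c.vertex, c.dir)
  invFun t := ⟨t.1, t.2.1, t.2.2.1, t.2.2.2.1, t.2.2.2.2⟩
  left_inv _ := rfl
  right_inv _ := rfl

/-- Coding of productions. -/
def Production.equiv :
    Production N W X E F ≃ X × LGraph N W X E F × List (ConnInstr N W X E F) where
  toFun p := (p.lhs, p.body, p.conn)
  invFun t := ⟨t.1, t.2.1, t.2.2⟩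
  left_inv _ := rfl
  right_inv _ := rfl

/-- Coding of decoding rules. -/
def DecodingRule.equiv :
    DecodingRule N W X E F ≃ E × N × N × LGraph N W X E F × ℕ × ℕ where
  toFun r := (r.symbol, r.srcLabel, r.tgtLabel, r.rhs, r.src, r.tgt)
  invFun t := ⟨t.1, t.2.1, t.2.2.1, t.2.2.2.1, t.2.2.2.2.1, t.2.2.2.2.2⟩
  left_inv _ := rfl
  right_inv _ := rfl

/-- Coding of grammars. -/
def Grammar.equiv :
    Grammar N W X E F ≃
      X × List (Production N W X E F) × List (DecodingRule N W X E F) where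
  toFun B := (B.start, B.productions, B.decoding)
  invFun t := ⟨t.1, t.2.1, t.2.2⟩
  left_inv _ := rfl
  right_inv _ := rfl

variable [Primcodable N] [Primcodable W] [Primcodable X] [Primcodable E] [Primcodable F]

instance : Primcodable (VLabel N W X) := Primcodable.ofEquiv _ VLabel.equiv
instance : Primcodable (ELabel E F) := Primcodable.ofEquiv _ ELabel.equiv
instance : Primcodable Dir := Primcodable.ofEquiv _ Dir.equiv
instance : Primcodable (LGraph N W X E F) := Primcodable.ofEquiv _ LGraph.equiv
instance : Primcodable (ConnInstr N W X E F) := Primcodable.ofEquiv _ ConnInstr.equiv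
instance : Primcodable (Production N W X E F) := Primcodable.ofEquiv _ Production.equiv
instance : Primcodable (DecodingRule N W X E F) := Primcodable.ofEquiv _ DecodingRule.equiv
instance : Primcodable (Grammar N W X E F) := Primcodable.ofEquiv _ Grammar.equiv

end Coding

/-! ### Graphs and string graphs -/

namespace LGraph

variable {N W X E F : Type*}

/-- `x` is a vertex of `G`. -/
def IsVertex (G : LGraph N W X E F) (x : ℕ) : Prop := ∃ σ, (x, σ) ∈ G.verts

/-- `x` is a node-vertex of `G`. -/
def IsNode (G : LGraph N W X E F) (x : ℕ) : Prop := ∃ n, (x, VLabel.node n) ∈ G.verts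

/-- `x` is a wire-vertex of `G`. -/
def IsWire (G : LGraph N W X E F) (x : ℕ) : Prop := ∃ w, (x, VLabel.wire w) ∈ G.verts

/-- `x` is a nonterminal vertex of `G`. -/
def IsNonterminal (G : LGraph N W X E F) (x : ℕ) : Prop :=
  ∃ Y, (x, VLabel.nonterminal Y) ∈ G.verts

/-- `G` is a graph: every vertex has one label, and edges connect distinct vertices of `G`. -/
def WellFormed (G : LGraph N W X E F) : Prop :=
  (G.verts.map Prod.fst).Nodup ∧
    ∀ x γ y, (x, γ, y) ∈ G.edges → G.IsVertex x ∧ G.IsVertex y ∧ x ≠ y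

/-- Every wire-vertex has in-degree at most one and out-degree at most one. -/
def WireDegreesLeOne (G : LGraph N W X E F) : Prop :=
  ∀ w, G.IsWire w →
    (∀ x γ x' γ', (x, γ, w) ∈ G.edges → (x', γ', w) ∈ G.edges → x = x' ∧ γ = γ') ∧
    (∀ y γ y' γ', (w, γ, y) ∈ G.edges → (w, γ', y') ∈ G.edges → y = y' ∧ γ = γ')

/-- `G` is a string graph. -/
structure IsStringGraph (G : LGraph N W X E F) : Prop where
  wellFormed : G.WellFormed
  no_nonterminal : ∀ x, ¬ G.IsNonterminal x
  no_enc : ∀ x α y, (x, ELabel.enc α, y) ∉ G.edges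
  no_node_node : ∀ x γ y, (x, γ, y) ∈ G.edges → ¬ (G.IsNode x ∧ G.IsNode y)
  wire_degrees : G.WireDegreesLeOne

/-- `x` is an input: a wire-vertex without incoming edges. -/
def IsInput (G : LGraph N W X E F) (x : ℕ) : Prop :=
  G.IsWire x ∧ ∀ y γ, (y, γ, x) ∉ G.edges

/-- `x` is an output: a wire-vertex without outgoing edges. -/
def IsOutput (G : LGraph N W X E F) (x : ℕ) : Prop :=
  G.IsWire x ∧ ∀ γ y, (x, γ, y) ∉ G.edges

/-- `x` lies in the boundary of `G`. -/
def IsBoundary (G : LGraph N W X E F) (x : ℕ) : Prop := G.IsInput x ∨ G.IsOutput x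

/-- There is an edge from `x` to `y`. -/
def Arrow (G : LGraph N W X E F) (x y : ℕ) : Prop := ∃ γ, (x, γ, y) ∈ G.edges

/-- `G` is connected, directions of edges being disregarded. -/
def Connected (G : LGraph N W X E F) : Prop :=
  (∃ x, G.IsVertex x) ∧
    ∀ x y, G.IsVertex x → G.IsVertex y → Relation.EqvGen G.Arrow x y

/-- `G` contains a bare wire: a chain of at least two wire-vertices that leads from a vertex
without incoming edges to a vertex without outgoing edges. If wire-vertices have in- and
out-degree at most one, such a chain is not connected to any other vertex. -/
def HasBareWire (G : LGraph N W X E F) : Prop :=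
  ∃ a b, G.IsInput a ∧ G.IsOutput b ∧
    Relation.TransGen (fun x y => G.IsWire x ∧ G.IsWire y ∧ G.Arrow x y) a b

/-- `G` contains an isolated wire-vertex. -/
def HasIsolatedWireVertex (G : LGraph N W X E F) : Prop := ∃ x, G.IsInput x ∧ G.IsOutput x

/-- `G` and `G'` are isomorphic. -/
def Iso (G G' : LGraph N W X E F) : Prop :=
  ∃ φ : ℕ ≃ ℕ, (∀ x σ, (x, σ) ∈ G.verts ↔ (φ x, σ) ∈ G'.verts) ∧
    ∀ x γ y, (x, γ, y) ∈ G.edges ↔ (φ x, γ, φ y) ∈ G'.edges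

/-- `G'` is obtained from `G` by merging two adjacent wire-vertices `a → b` with the same label
into the single wire-vertex `a`. -/
def Merge (G G' : LGraph N W X E F) : Prop :=
  ∃ a b γ₀ w, (a, VLabel.wire w) ∈ G.verts ∧ (b, VLabel.wire w) ∈ G.verts ∧ a ≠ b ∧
    (a, γ₀, b) ∈ G.edges ∧
    (∀ x σ, (x, σ) ∈ G'.verts ↔ (x, σ) ∈ G.verts ∧ x ≠ b) ∧
    ∀ x γ y, (x, γ, y) ∈ G'.edges ↔
      ∃ x' y', (x', γ, y') ∈ G.edges ∧ ¬ (x' = a ∧ y' = b) ∧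
        x = (if x' = b then a else x') ∧ y = (if y' = b then a else y')

/-- Wire-homeomorphism: the equivalence relation on string graphs generated by isomorphisms and
by merging two adjacent wire-vertices (read backwards, splitting a wire-vertex). All graphs
that occur have to be string graphs; in particular a circle of two wire-vertices cannot be
merged further, as graphs have no self-loops. -/
def WireHomeomorphic : LGraph N W X E F → LGraph N W X E F → Prop :=
  Relation.EqvGen fun G G' =>
    G.IsStringGraph ∧ G'.IsStringGraph ∧ (G.Iso G' ∨ G.Merge G')

/-- `m` is an injective homomorphism from `L` to `H` such that every edge of `H` between a
vertex in the image of `L` and a vertex outside of it meets the image in the image of the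
boundary of `L`. -/
structure IsEmbedding (L H : LGraph N W X E F) (m : ℕ → ℕ) : Prop where
  map_vert : ∀ x σ, (x, σ) ∈ L.verts → (m x, σ) ∈ H.verts
  map_edge : ∀ x γ y, (x, γ, y) ∈ L.edges → (m x, γ, m y) ∈ H.edges
  injOn : Set.InjOn m {x | L.IsVertex x}
  dangling_out : ∀ x γ z, L.IsVertex x → (m x, γ, z) ∈ H.edges →
    z ∉ m '' {y | L.IsVertex y} → L.IsBoundary x
  dangling_in : ∀ x γ z, L.IsVertex x → (z, γ, m x) ∈ H.edges →
    z ∉ m '' {y | L.IsVertex y} → L.IsBoundary x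

/-- There is a matching of `L` onto `H`, that is, an embedding as above of `L` into some string
graph that is wire-homeomorphic to `H`. -/
def MatchesOnto (L H : LGraph N W X E F) : Prop :=
  ∃ H' : LGraph N W X E F, H.WireHomeomorphic H' ∧ ∃ m : ℕ → ℕ, L.IsEmbedding H' m

/-! ### Substitution and decoding -/

/-- A number larger than the names of all vertices of `G`. -/
def fresh (G : LGraph N W X E F) : ℕ := G.verts.foldr (fun q k => max (q.1 + 1) k) 0

/-- Substitution of the production `p` for the vertex `v` of `H`. The copy of the body of `p`
gets the new names `H.fresh + x`, for `x` a vertex of the body. Apart from the remaining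
edges of `H` and the copies of edges of the body, there is an edge labelled `γ` from `w` to the
copy of `x` for every edge `(w, β, v)` of `H` and every connection instruction
`(λ w, β / γ, x, inward)`, and symmetrically for edges out of `v`. -/
def subst [DecidableEq N] [DecidableEq W] [DecidableEq X] [DecidableEq E] [DecidableEq F]
    (H : LGraph N W X E F) (v : ℕ) (p : Production N W X E F) : LGraph N W X E F where
  verts := H.verts.filter (fun q => q.1 ≠ v) ++
    p.body.verts.map (fun q => (H.fresh + q.1, q.2))
  edges := H.edges.filter (fun e => e.1 ≠ v ∧ e.2.2 ≠ v) ++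
    p.body.edges.map (fun e => (H.fresh + e.1, e.2.1, H.fresh + e.2.2)) ++
    H.edges.flatMap (fun e => (p.conn.filter (fun c =>
        e.2.2 = v ∧ c.dir = Dir.inward ∧ c.old = e.2.1 ∧ (e.1, c.label) ∈ H.verts)).map
      (fun c => (e.1, c.new, H.fresh + c.vertex))) ++
    H.edges.flatMap (fun e => (p.conn.filter (fun c =>
        e.1 = v ∧ c.dir = Dir.outward ∧ c.old = e.2.1 ∧ (e.2.2, c.label) ∈ H.verts)).map
      (fun c => (H.fresh + c.vertex, c.new, e.2.2)))

/-- Application of the decoding rule `r` to an edge from `u` to `v`: the edge is removed, and a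
copy of the right-hand side is glued in along the two shared node-vertices. The other
vertices of the copy get the new names `H.fresh + x`. -/
def decode [DecidableEq E] [DecidableEq F] (H : LGraph N W X E F) (u v : ℕ)
    (r : DecodingRule N W X E F) : LGraph N W X E F :=
  let ren : ℕ → ℕ := fun x => if x = r.src then u else if x = r.tgt then v else H.fresh + x
  { verts := H.verts ++
      (r.rhs.verts.filter (fun q => q.1 ≠ r.src ∧ q.1 ≠ r.tgt)).map (fun q => (ren q.1, q.2))
    edges := H.edges.filter (fun e => e ≠ (u, ELabel.enc r.symbol, v)) ++
      r.rhs.edges.map (fun e => (ren e.1, e.2.1, ren e.2.2)) }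

end LGraph

/-- The conditions on a single decoding rule. -/
structure DecodingRule.IsValid {N W X E F : Type*} (r : DecodingRule N W X E F) : Prop where
  isStringGraph : r.rhs.IsStringGraph
  connected : r.rhs.Connected
  no_boundary : ∀ x, ¬ r.rhs.IsBoundary x
  src_mem : (r.src, VLabel.node r.srcLabel) ∈ r.rhs.verts
  tgt_mem : (r.tgt, VLabel.node r.tgtLabel) ∈ r.rhs.verts
  src_ne_tgt : r.src ≠ r.tgt

/-- The conditions on a decoding system: there is one rule for every triple `(α, N₁, N₂)`. -/
structure IsDecodingSystem {N W X E F : Type*} (T : List (DecodingRule N W X E F)) : Prop where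
  valid : ∀ r ∈ T, r.IsValid
  existsUnique : ∀ (α : E) (n₁ n₂ : N),
    ∃! r, r ∈ T ∧ r.symbol = α ∧ r.srcLabel = n₁ ∧ r.tgtLabel = n₂

namespace Grammar

variable {N W X E F : Type*}

/-- The grammar (without its decoding system) is a B-edNCE grammar. -/
structure IsBedNCE (B : Grammar N W X E F) : Prop where
  wellFormed : ∀ p ∈ B.productions, p.body.WellFormed
  conn_vertex : ∀ p ∈ B.productions, ∀ c ∈ p.conn, p.body.IsVertex c.vertex
  boundary_body : ∀ p ∈ B.productions, ∀ x γ y, (x, γ, y) ∈ p.body.edges →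
    ¬ (p.body.IsNonterminal x ∧ p.body.IsNonterminal y)
  boundary_conn : ∀ p ∈ B.productions, ∀ c ∈ p.conn, ∀ Y, c.label ≠ VLabel.nonterminal Y

/-- `B` is a B-ESG grammar. -/
structure IsBESG (B : Grammar N W X E F) : Prop where
  isDecodingSystem : IsDecodingSystem B.decoding
  isBedNCE : B.IsBedNCE
  N1 : ∀ p ∈ B.productions, ∀ x γ y, (x, γ, y) ∈ p.body.edges →
    ((∃ α, γ = ELabel.enc α) ↔ (p.body.IsNode x ∧ p.body.IsNode y))
  N2 : ∀ p ∈ B.productions, ∀ c ∈ p.conn, (∃ n, c.label = VLabel.node n) →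
    p.body.IsNode c.vertex → ∃ β, c.new = ELabel.enc β
  W1 : ∀ p ∈ B.productions, p.body.WireDegreesLeOne
  W2 : ∀ p ∈ B.productions, ∀ c ∈ p.conn, ¬ p.body.IsWire c.vertex
  W3_unique : ∀ p ∈ B.productions, ∀ c ∈ p.conn, ∀ c' ∈ p.conn,
    ∀ w, c.label = VLabel.wire w → c'.label = VLabel.wire w →
      c.old = c'.old → c.dir = c'.dir → c = c'
  W3_plain : ∀ p ∈ B.productions, ∀ c ∈ p.conn, (∃ w, c.label = VLabel.wire w) →
    ∀ α, c.new ≠ ELabel.enc α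
  W4 : ∀ p ∈ B.productions, ∀ y Y, (y, VLabel.nonterminal Y) ∈ p.body.verts →
    ∀ (w : W) (β : ELabel E F) (d : Dir),
      ((∃ x, (x, VLabel.wire w) ∈ p.body.verts ∧
          ((d = Dir.inward ∧ (x, β, y) ∈ p.body.edges) ∨
            (d = Dir.outward ∧ (y, β, x) ∈ p.body.edges))) ∨
        (∃ c ∈ p.conn, c.label = VLabel.wire w ∧ c.new = β ∧ c.vertex = y ∧ c.dir = d)) →
      ∀ q ∈ B.productions, q.lhs = Y →
        ∃ c ∈ q.conn, c.label = VLabel.wire w ∧ c.old = β ∧ c.dir = d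

/-- The graph with a single vertex, labelled by the initial nonterminal. -/
def startGraph (B : Grammar N W X E F) : LGraph N W X E F where
  verts := [(0, VLabel.nonterminal B.start)]
  edges := []

variable [DecidableEq N] [DecidableEq W] [DecidableEq X] [DecidableEq E] [DecidableEq F]

/-- `B.Derives H s H'`: the derivation from `H` with steps `s` ends in `H'`. The step `(v, i)`
replaces the nonterminal vertex `v` by means of the production with index `i`. -/
inductive Derives (B : Grammar N W X E F) :
    LGraph N W X E F → List (ℕ × ℕ) → LGraph N W X E F → Prop
  | nil (H : LGraph N W X E F) : Derives B H [] H
  | cons {H H' : LGraph N W X E F} {v i : ℕ} {p : Production N W X E F} {s : List (ℕ × ℕ)} :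
      B.productions[i]? = some p → (v, VLabel.nonterminal p.lhs) ∈ H.verts →
      Derives B (H.subst v p) s H' → Derives B H ((v, i) :: s) H'

/-- `B.Decodes H s H'`: the sequence of rewrite steps `s` of the decoding system leads from `H` to
`H'`. The step `(u, α, v)` decodes the edge labelled `α` from `u` to `v`. -/
inductive Decodes (B : Grammar N W X E F) :
    LGraph N W X E F → List (ℕ × E × ℕ) → LGraph N W X E F → Prop
  | nil (H : LGraph N W X E F) : Decodes B H [] H
  | cons {H H' : LGraph N W X E F} {u v : ℕ} {r : DecodingRule N W X E F}
      {s : List (ℕ × E × ℕ)} :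
      r ∈ B.decoding → (u, ELabel.enc r.symbol, v) ∈ H.edges →
      (u, VLabel.node r.srcLabel) ∈ H.verts → (v, VLabel.node r.tgtLabel) ∈ H.verts →
      Decodes B (H.decode u v r) s H' → Decodes B H ((u, r.symbol, v) :: s) H'

/-- `B.IsConcreteDerivation s t K`: the steps `s` form a derivation from the start graph to a graph
without nonterminals, and the steps `t` decode this graph completely, with result `K`. -/
def IsConcreteDerivation (B : Grammar N W X E F) (s : List (ℕ × ℕ)) (t : List (ℕ × E × ℕ))
    (K : LGraph N W X E F) : Prop :=
  ∃ H₁ : LGraph N W X E F, B.Derives B.startGraph s H₁ ∧ (∀ x, ¬ H₁.IsNonterminal x) ∧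
    B.Decodes H₁ t K ∧ ∀ x α y, (x, ELabel.enc α, y) ∉ K.edges

/-- The grammar is match-exhaustive. -/
structure IsMatchExhaustive (B : Grammar N W X E F) : Prop where
  bare_bounded : ∀ i p, B.productions[i]? = some p → p.body.HasBareWire →
    ∃ n : ℕ, ∀ s H, B.Derives B.startGraph s H → (s.map Prod.snd).count i ≤ n
  no_isolated : ∀ p ∈ B.productions, ¬ p.body.HasIsolatedWireVertex
  no_empty : ∀ p ∈ B.productions, p.body.verts ≠ []
  no_single_nonterminal : ∀ p ∈ B.productions, ∀ x Y,
    p.body.verts ≠ [(x, VLabel.nonterminal Y)]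

end Grammar

end BESG

/-!
The concrete derivations of a grammar can be listed by increasing length, so it suffices to bound
the length of a derivation `S ⇒ K` whose result matches onto `H`, and to decide matching; both
have to be done by primitive recursive functions of the grammar and of `H`.

*Bounding the derivations.* The obstacle is that the wire-homeomorphism class of `H` contains
graphs of every size, so the number of vertices of `K` is not bounded by `H`. What is bounded is
the size of a closed family in `K` (`IsClosedFamily`, `LGraph.HasFamily`): a family of disjoint
nonempty sets of node- and wire-vertices in each of which every wire-vertex is followed by a vertex
of the same set, or by a node-vertex. Embeddings and, in both directions, merging preserve the
existence of such a family (`LGraph.WireHomeomorphic.hasFamily_iff`), so that its size is at most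
the number of vertices of `H`; the same holds for the reversed graphs. Along a derivation, a body
without bare wires that has a terminal vertex contributes a new set to one of the two families
(`Grammar.exists_closed_body`), because `W4` guarantees that a wire leading to a nonterminal will
eventually be attached to a node-vertex. A body without terminal vertices raises the number of
nonterminals, which has to come down to zero. Every decoding step contributes a set as well. Hence
all steps are bounded, except for those with a bare wire in the body
(`Grammar.IsConcreteDerivation.length_le`).

*Bounding the bare wires.* For these steps a finite bound exists by assumption, but it has to be
computed. Derivations are abstracted to derivations of a context-free grammar (`Grammar.Forest`).
If the numbers of uses of a fixed production from a nonterminal are bounded, then the largest such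
number is bounded in terms of the next smaller one among all nonterminals (`Grammar.Forest.gap`),
so `(m + 1) ^ k`, with `m` a bound for the sizes of the bodies and `k` the number of nonterminals, is
a bound whenever there is a bound at all (`Grammar.Derives.count_le`,
`Grammar.Derives.bareSteps_le`).

*Deciding matching.* A segment is a maximal set of equally labelled wire-vertices connected by
edges; merging contracts segments, where a circle cannot become smaller than two vertices. Two
string graphs are wire-homeomorphic if and only if there is a bijection between their segments
that respects labels, edges between different segments, and whether a segment is a circle
(`LGraph.wireHomeomorphic_iff`); for the converse, both graphs are brought into a normal form with
the smallest possible segments, the labels of edges inside of segments being changed by splitting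
and merging. So wire-homeomorphism of given graphs is decidable. The target of a matching of `K`
can be made small by merging wire-vertices outside of the image
(`LGraph.MatchesOnto.exists_small`), which leaves finitely many candidates
(`LGraph.IsStringGraph.matchesOnto_iff`).
-/

namespace BESG

/-! ### Closed families of vertices -/

/-- A family of nonempty, pairwise disjoint sets, each of whose elements is an anchor (satisfies
`S`) or has an `R`-successor in the same set. -/
structure IsClosedFamily (S : ℕ → Prop) (R : ℕ → ℕ → Prop) {k : ℕ} (A : Fin k → Set ℕ) :
    Prop where
  nonempty : ∀ i, (A i).Nonempty
  disjoint : ∀ i j x, x ∈ A i → x ∈ A j → i = j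
  closed : ∀ i x, x ∈ A i → S x ∨ ∃ y ∈ A i, R x y

theorem IsClosedFamily.image {S S' : ℕ → Prop} {R R' : ℕ → ℕ → Prop} {k : ℕ}
    {A : Fin k → Set ℕ} (hA : IsClosedFamily S R A) (f : ℕ → ℕ)
    (hf : Set.InjOn f {x | S x ∨ ∃ y, R x y})
    (hS : ∀ x, S x → S' (f x)) (hR : ∀ x y, R x y → R' (f x) (f y)) :
    IsClosedFamily S' R' (fun i => f '' A i) where
  nonempty i := (hA.nonempty i).image f
  disjoint := by
    have key : ∀ i x, x ∈ A i → x ∈ {x | S x ∨ ∃ y, R x y} := fun i x hx =>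
      (hA.closed i x hx).imp_right fun ⟨y, _, h⟩ => ⟨y, h⟩
    rintro i j _ ⟨x, hx, rfl⟩ ⟨y, hy, hxy⟩
    obtain rfl := hf (key j y hy) (key i x hx) hxy
    exact hA.disjoint i j _ hx hy
  closed := by
    rintro i _ ⟨x, hx, rfl⟩
    rcases hA.closed i x hx with h | ⟨y, hy, h⟩
    · exact .inl (hS x h)
    · exact .inr ⟨f y, ⟨y, hy, rfl⟩, hR x y h⟩

theorem IsClosedFamily.mono {S S' : ℕ → Prop} {R R' : ℕ → ℕ → Prop} {k : ℕ}
    {A : Fin k → Set ℕ} (hA : IsClosedFamily S R A)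
    (hS : ∀ x, S x → S' x) (hR : ∀ x y, R x y → R' x y) : IsClosedFamily S' R' A where
  nonempty := hA.nonempty
  disjoint := hA.disjoint
  closed i x hx := (hA.closed i x hx).imp (hS x) fun ⟨y, hy, h⟩ => ⟨y, hy, hR x y h⟩

/-- A closed family can be extended by a closed set that is disjoint from the other members. -/
theorem IsClosedFamily.cons {S : ℕ → Prop} {R : ℕ → ℕ → Prop} {k : ℕ}
    {A : Fin k → Set ℕ} (hA : IsClosedFamily S R A) {C : Set ℕ} (hne : C.Nonempty)
    (hd : ∀ x ∈ C, ∀ i, x ∉ A i) (hC : ∀ x ∈ C, S x ∨ ∃ y ∈ C, R x y) :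
    IsClosedFamily S R (Fin.cons C A : Fin (k + 1) → Set ℕ) where
  nonempty i := by
    refine Fin.cases ?_ (fun i => ?_) i
    · simpa using hne
    · simpa using hA.nonempty i
  disjoint i j x := by
    refine Fin.cases ?_ (fun i => ?_) i <;> refine Fin.cases ?_ (fun j => ?_) j
    · simp
    · intro h1 h2
      exact absurd (by simpa using h2) (hd x (by simpa using h1) j)
    · intro h1 h2
      exact absurd (by simpa using h1) (hd x (by simpa using h2) i)
    · intro h1 h2
      rw [hA.disjoint i j x (by simpa using h1) (by simpa using h2)]
  closed i := by
    refine Fin.cases ?_ (fun i => ?_) i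
    · simpa using hC
    · simpa using hA.closed i

namespace LGraph

variable {N W X E F : Type*}

/-- The graph with all edges reversed. -/
def rev (G : LGraph N W X E F) : LGraph N W X E F where
  verts := G.verts
  edges := G.edges.map fun e => (e.2.2, e.2.1, e.1)

@[simp] theorem mem_rev_edges {G : LGraph N W X E F} {x y : ℕ} {γ : ELabel E F} :
    (x, γ, y) ∈ G.rev.edges ↔ (y, γ, x) ∈ G.edges := by
  simp only [rev, List.mem_map, Prod.mk.injEq, Prod.exists]
  exact ⟨by rintro ⟨a, b, c, h, rfl, rfl, rfl⟩; exact h, fun h => ⟨_, _, _, h, rfl, rfl, rfl⟩⟩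

theorem label_unique {G : LGraph N W X E F} (h : (G.verts.map Prod.fst).Nodup) {x : ℕ}
    {σ τ : VLabel N W X} (h₁ : (x, σ) ∈ G.verts) (h₂ : (x, τ) ∈ G.verts) : σ = τ := by
  have := List.inj_on_of_nodup_map h h₁ h₂ rfl
  simpa using this

theorem IsStringGraph.rev {G : LGraph N W X E F} (h : G.IsStringGraph) :
    G.rev.IsStringGraph where
  wellFormed := ⟨h.wellFormed.1, fun x γ y hxy => by
    obtain ⟨h1, h2, h3⟩ := h.wellFormed.2 y γ x (by simpa using hxy)
    exact ⟨h2, h1, h3.symm⟩⟩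
  no_nonterminal := h.no_nonterminal
  no_enc x α y hxy := h.no_enc y α x (by simpa using hxy)
  no_node_node x γ y hxy := fun ⟨h1, h2⟩ => h.no_node_node y γ x (by simpa using hxy) ⟨h2, h1⟩
  wire_degrees w hw := by
    have := h.wire_degrees w hw
    simpa using And.intro this.2 this.1

/-- `x` is an anchor: a node-vertex, or a wire-vertex with an edge to a node-vertex. -/
def Anchor (G : LGraph N W X E F) (x : ℕ) : Prop :=
  G.IsNode x ∨ G.IsWire x ∧ ∃ γ y, (x, γ, y) ∈ G.edges ∧ G.IsNode y

/-- There is an edge from the wire-vertex `x` to `y`. -/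
def WireStep (G : LGraph N W X E F) (x y : ℕ) : Prop := G.IsWire x ∧ ∃ γ, (x, γ, y) ∈ G.edges

/-- There are `k` disjoint nonempty sets of vertices such that each vertex in one of these sets is a
node-vertex, or a wire-vertex with an edge to a node-vertex or to a vertex in the same set. -/
def HasFamily (G : LGraph N W X E F) (k : ℕ) : Prop :=
  ∃ A : Fin k → Set ℕ, IsClosedFamily G.Anchor G.WireStep A

theorem Anchor.isVertex {G : LGraph N W X E F} {x : ℕ} (h : G.Anchor x) : G.IsVertex x := by
  rcases h with ⟨n, h⟩ | ⟨⟨w, h⟩, -⟩ <;> exact ⟨_, h⟩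

theorem WireStep.isVertex {G : LGraph N W X E F} {x y : ℕ} (h : G.WireStep x y) :
    G.IsVertex x := ⟨_, h.1.choose_spec⟩

theorem HasFamily.le_length {G : LGraph N W X E F} {k : ℕ} (h : G.HasFamily k) :
    k ≤ G.verts.length := by
  obtain ⟨A, hA⟩ := h
  choose f hf using hA.nonempty
  have hv : ∀ i, f i ∈ (G.verts.map Prod.fst).toFinset := fun i => by
    have : G.IsVertex (f i) := by
      rcases hA.closed i _ (hf i) with h | ⟨y, _, h⟩
      · exact h.isVertex
      · exact h.isVertex
    obtain ⟨σ, h⟩ := this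
    rw [List.mem_toFinset, List.mem_map]
    exact ⟨_, h, rfl⟩
  have hinj : Function.Injective f := fun i j hij =>
    hA.disjoint i j (f i) (hf i) (hij ▸ hf j)
  calc k = (Finset.univ : Finset (Fin k)).card := by simp
    _ ≤ (G.verts.map Prod.fst).toFinset.card :=
        Finset.card_le_card_of_injOn f (fun i _ => hv i) hinj.injOn
    _ ≤ (G.verts.map Prod.fst).length := List.toFinset_card_le _
    _ = G.verts.length := List.length_map ..

theorem HasFamily.map {G G' : LGraph N W X E F} {k : ℕ} (h : G.HasFamily k) (f : ℕ → ℕ)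
    (hf : Set.InjOn f {x | G.IsVertex x}) (hv : ∀ x σ, (x, σ) ∈ G.verts → (f x, σ) ∈ G'.verts)
    (he : ∀ x γ y, (x, γ, y) ∈ G.edges → (f x, γ, f y) ∈ G'.edges) : G'.HasFamily k := by
  obtain ⟨A, hA⟩ := h
  refine ⟨_, hA.image f (hf.mono ?_) ?_ ?_⟩
  · rintro x (h | ⟨y, h⟩)
    · exact h.isVertex
    · exact h.isVertex
  · rintro x (⟨n, h⟩ | ⟨⟨w, h⟩, γ, y, h1, n, h2⟩)
    · exact .inl ⟨n, hv _ _ h⟩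
    · exact .inr ⟨⟨w, hv _ _ h⟩, γ, f y, he _ _ _ h1, n, hv _ _ h2⟩
  · rintro x y ⟨⟨w, h⟩, γ, h1⟩
    exact ⟨⟨w, hv _ _ h⟩, γ, he _ _ _ h1⟩

theorem IsEmbedding.hasFamily {L H : LGraph N W X E F} {m : ℕ → ℕ} (h : L.IsEmbedding H m)
    {k : ℕ} (hL : L.HasFamily k) : H.HasFamily k :=
  hL.map m h.injOn h.map_vert h.map_edge

theorem IsEmbedding.hasFamily_rev {L H : LGraph N W X E F} {m : ℕ → ℕ} (h : L.IsEmbedding H m)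
    {k : ℕ} (hL : L.rev.HasFamily k) : H.rev.HasFamily k :=
  hL.map m h.injOn h.map_vert fun x γ y hxy => by
    simpa using h.map_edge y γ x (by simpa using hxy)

theorem Iso.symm {G G' : LGraph N W X E F} (h : G.Iso G') : G'.Iso G := by
  obtain ⟨φ, hv, he⟩ := h
  exact ⟨φ.symm, fun x σ => by simp [hv], fun x γ y => by simp [he]⟩

theorem Iso.rev {G G' : LGraph N W X E F} (h : G.Iso G') : G.rev.Iso G'.rev := by
  obtain ⟨φ, hv, he⟩ := h
  exact ⟨φ, hv, fun x γ y => by simp [he]⟩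

theorem Iso.hasFamily {G G' : LGraph N W X E F} (h : G.Iso G') {k : ℕ} (hG : G.HasFamily k) :
    G'.HasFamily k := by
  obtain ⟨φ, hv, he⟩ := h
  exact hG.map φ φ.injective.injOn (fun x σ => (hv x σ).1) (fun x γ y => (he x γ y).1)

/-- `q` maps `G` onto `G'` by contracting an edge between the equally labelled wire-vertices `c`
and `d`. In contrast to `Merge`, this notion is invariant under reversal of all edges. -/
structure Contracts (G G' : LGraph N W X E F) (c d : ℕ) (q : ℕ → ℕ) : Prop where
  wire : ∃ w, (c, VLabel.wire w) ∈ G.verts ∧ (d, VLabel.wire w) ∈ G.verts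
  ne : c ≠ d
  edge : ∃ γ, (c, γ, d) ∈ G.edges
  eq : q c = q d
  inj : ∀ x y, q x = q y → G.IsVertex x → G.IsVertex y →
    x = y ∨ (x = c ∧ y = d) ∨ (x = d ∧ y = c)
  map_vert : ∀ x σ, (x, σ) ∈ G.verts → (q x, σ) ∈ G'.verts
  exists_vert : ∀ y σ, (y, σ) ∈ G'.verts → ∃ x, (x, σ) ∈ G.verts ∧ q x = y
  mem_edges : ∀ y γ y', (y, γ, y') ∈ G'.edges ↔
    ∃ x x', (x, γ, x') ∈ G.edges ∧ ¬ (x = c ∧ x' = d) ∧ q x = y ∧ q x' = y'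

theorem Contracts.rev {G G' : LGraph N W X E F} {c d : ℕ} {q : ℕ → ℕ}
    (h : Contracts G G' c d q) : Contracts G.rev G'.rev d c q where
  wire := let ⟨w, h1, h2⟩ := h.wire; ⟨w, h2, h1⟩
  ne := h.ne.symm
  edge := let ⟨γ, h1⟩ := h.edge; ⟨γ, by simpa using h1⟩
  eq := h.eq.symm
  inj x y h1 h2 h3 := by
    have := h.inj x y h1 h2 h3
    tauto
  map_vert := h.map_vert
  exists_vert := h.exists_vert
  mem_edges y γ y' := by
    simp only [mem_rev_edges, h.mem_edges]
    constructor <;> rintro ⟨x, x', h1, h2, h3, h4⟩ <;>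
      exact ⟨x', x, h1, fun h => h2 ⟨h.2, h.1⟩, h4, h3⟩

theorem Merge.contracts {G G' : LGraph N W X E F} (h : G.Merge G') (hG : G.IsStringGraph) :
    ∃ a b, Contracts G G' a b fun x => if x = b then a else x := by
  obtain ⟨a, b, γ₀, w, ha, hb, hab, hedge, hv, he⟩ := h
  refine ⟨a, b, ⟨w, ha, hb⟩, hab, ⟨γ₀, hedge⟩, by simp, ?_, ?_, ?_, ?_⟩
  · intro x y hxy _ _
    grind
  · intro x σ hx
    rw [hv]
    by_cases hxb : x = b
    · subst hxb
      obtain rfl := label_unique hG.wellFormed.1 hx hb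
      simpa using ⟨ha, hab⟩
    · simpa [hxb] using hx
  · intro y σ hy
    rw [hv] at hy
    exact ⟨y, hy.1, by simp [hy.2]⟩
  · intro y γ y'
    rw [he]
    grind

/-- A closed family survives the contraction of `c` and `d`: a set that contains `c` contains `d` as
well, since `d` is the only successor of `c` and `c` is no anchor. So the images of the sets are
still disjoint. -/
theorem Contracts.hasFamily {G G' : LGraph N W X E F} {c d : ℕ} {q : ℕ → ℕ}
    (h : Contracts G G' c d q) (hG : G.IsStringGraph) {k : ℕ} (hk : G.HasFamily k) :
    G'.HasFamily k := by
  obtain ⟨A, hA⟩ := hk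
  obtain ⟨w, hcw, hdw⟩ := h.wire
  obtain ⟨γ₀, hcd⟩ := h.edge
  have hdeg : ∀ γ y, (c, γ, y) ∈ G.edges → y = d := fun γ y hy =>
    ((hG.wire_degrees c ⟨w, hcw⟩).2 _ _ _ _ hy hcd).1
  have hdn : ¬ G.IsNode d := fun ⟨n, hn⟩ => by
    simpa using label_unique hG.wellFormed.1 hn hdw
  have hcS : ¬ G.Anchor c := by
    rintro (⟨n, hn⟩ | ⟨-, γ, y, h1, h2⟩)
    · simpa using label_unique hG.wellFormed.1 hn hcw
    · exact hdn (hdeg γ y h1 ▸ h2)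
  have hcA : ∀ i, c ∈ A i → d ∈ A i := fun i hc => by
    rcases hA.closed i c hc with h1 | ⟨y, hy, -, γ, h1⟩
    · exact absurd h1 hcS
    · exact hdeg γ y h1 ▸ hy
  have hS : ∀ x, G.Anchor x → G'.Anchor (q x) := by
    rintro x (⟨n, hn⟩ | ⟨⟨v, hv⟩, γ, y, h1, n, h2⟩)
    · exact .inl ⟨n, h.map_vert _ _ hn⟩
    · refine .inr ⟨⟨v, h.map_vert _ _ hv⟩, γ, q y, ?_, n, h.map_vert _ _ h2⟩
      rw [h.mem_edges]
      exact ⟨x, y, h1, fun ⟨_, h4⟩ => hdn (h4 ▸ ⟨n, h2⟩), rfl, rfl⟩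
  have hR : ∀ x y, G.WireStep x y → ¬ (x = c ∧ y = d) → G'.WireStep (q x) (q y) := by
    rintro x y ⟨⟨v, hv⟩, γ, h1⟩ hne
    exact ⟨⟨v, h.map_vert _ _ hv⟩, γ, (h.mem_edges _ _ _).2 ⟨x, y, h1, hne, rfl, rfl⟩⟩
  have hvert : ∀ i x, x ∈ A i → G.IsVertex x := fun i x hx => by
    rcases hA.closed i _ hx with h | ⟨y, _, h⟩
    · exact h.isVertex
    · exact h.isVertex
  refine ⟨fun i => q '' A i, fun i => (hA.nonempty i).image q, ?_, ?_⟩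
  · rintro i j _ ⟨x, hx, rfl⟩ ⟨y, hy, hxy⟩
    rcases h.inj y x hxy (hvert _ _ hy) (hvert _ _ hx) with rfl | ⟨rfl, rfl⟩ | ⟨rfl, rfl⟩
    · exact hA.disjoint i j _ hx hy
    · exact hA.disjoint i j _ hx (hcA j hy)
    · exact hA.disjoint i j _ (hcA i hx) hy
  · have main : ∀ i x, x ∈ A i → x ≠ c → G'.Anchor (q x) ∨ ∃ y ∈ q '' A i, G'.WireStep (q x) y := by
      intro i x hx hxc
      rcases hA.closed i x hx with h1 | ⟨y, hy, h1⟩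
      · exact .inl (hS x h1)
      · exact .inr ⟨q y, ⟨y, hy, rfl⟩, hR x y h1 fun h => hxc h.1⟩
    rintro i _ ⟨x, hx, rfl⟩
    by_cases hxc : x = c
    · subst hxc
      rw [h.eq]
      exact main i d (hcA i hx) h.ne.symm
    · exact main i x hx hxc

/-- A closed family is pulled back along a contraction to the family of preimages. -/
theorem Contracts.hasFamily_of {G G' : LGraph N W X E F} {c d : ℕ} {q : ℕ → ℕ}
    (h : Contracts G G' c d q) (hG : G.IsStringGraph) (hG' : G'.IsStringGraph) {k : ℕ}
    (hk : G'.HasFamily k) : G.HasFamily k := by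
  obtain ⟨A, hA⟩ := hk
  obtain ⟨w, hcw, hdw⟩ := h.wire
  obtain ⟨γ₀, hcd⟩ := h.edge
  have hdeg : ∀ γ y, (c, γ, y) ∈ G.edges → y = d := fun γ y hy =>
    ((hG.wire_degrees c ⟨w, hcw⟩).2 _ _ _ _ hy hcd).1
  have hlab : ∀ x σ τ, (x, σ) ∈ G.verts → (q x, τ) ∈ G'.verts → (x, τ) ∈ G.verts := by
    intro x σ τ h1 h2
    rwa [← label_unique hG'.wellFormed.1 (h.map_vert _ _ h1) h2]
  -- An edge of `G'` at the image of `x ≠ c` comes from an edge of `G` at `x` itself.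
  have hlift : ∀ x γ y, x ≠ c → G.IsVertex x → (q x, γ, y) ∈ G'.edges →
      ∃ x', (x, γ, x') ∈ G.edges ∧ q x' = y := by
    intro x γ y hx hxv hy
    obtain ⟨x₀, x', h1, h2, h3, h4⟩ := (h.mem_edges _ _ _).1 hy
    rcases h.inj x₀ x h3 (hG.wellFormed.2 _ _ _ h1).1 hxv with rfl | ⟨rfl, rfl⟩ | ⟨rfl, rfl⟩
    · exact ⟨x', h1, h4⟩
    · exact absurd ⟨rfl, hdeg γ x' h1⟩ h2
    · exact absurd rfl hx
  refine ⟨fun i => {x | G.IsVertex x ∧ q x ∈ A i}, ?_, fun i j x hx hy =>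
    hA.disjoint i j _ hx.2 hy.2, ?_⟩
  · intro i
    obtain ⟨y, hy⟩ := hA.nonempty i
    have : G'.IsVertex y := by
      rcases hA.closed i y hy with h | ⟨z, _, h⟩
      · exact h.isVertex
      · exact h.isVertex
    obtain ⟨σ, hσ⟩ := this
    obtain ⟨x, hx, rfl⟩ := h.exists_vert y σ hσ
    exact ⟨x, ⟨σ, hx⟩, hy⟩
  · rintro i x ⟨⟨σ, hx⟩, hxA⟩
    by_cases hxc : x = c
    · subst hxc
      exact .inr ⟨d, ⟨⟨_, hdw⟩, h.eq ▸ hxA⟩, ⟨w, hcw⟩, γ₀, hcd⟩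
    · rcases hA.closed i _ hxA with (⟨n, hn⟩ | ⟨⟨v, hv⟩, γ, y, h1, n, h2⟩) | ⟨y, hy, ⟨v, hv⟩, γ, h1⟩
      · exact .inl (.inl ⟨n, hlab _ _ _ hx hn⟩)
      · obtain ⟨x', h3, rfl⟩ := hlift x γ y hxc ⟨σ, hx⟩ h1
        obtain ⟨τ, hτ⟩ := (hG.wellFormed.2 _ _ _ h3).2.1
        exact .inl (.inr ⟨⟨v, hlab _ _ _ hx hv⟩, γ, x', h3, n, hlab _ _ _ hτ h2⟩)
      · obtain ⟨x', h3, rfl⟩ := hlift x γ y hxc ⟨σ, hx⟩ h1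
        exact .inr ⟨x', ⟨(hG.wellFormed.2 _ _ _ h3).2.1, hy⟩, ⟨v, hlab _ _ _ hx hv⟩, γ, h3⟩

theorem WireHomeomorphic.hasFamily_iff {G G' : LGraph N W X E F} (h : G.WireHomeomorphic G')
    (k : ℕ) : (G.HasFamily k ↔ G'.HasFamily k) ∧ (G.rev.HasFamily k ↔ G'.rev.HasFamily k) := by
  induction h with
  | rel G G' h =>
    obtain ⟨hG, hG', h | h⟩ := h
    · exact ⟨⟨h.hasFamily, h.symm.hasFamily⟩, ⟨h.rev.hasFamily, h.symm.rev.hasFamily⟩⟩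
    · obtain ⟨a, b, h⟩ := h.contracts hG
      exact ⟨⟨h.hasFamily hG, h.hasFamily_of hG hG'⟩,
        ⟨h.rev.hasFamily hG.rev, h.rev.hasFamily_of hG.rev hG'.rev⟩⟩
  | refl G => exact ⟨Iff.rfl, Iff.rfl⟩
  | symm G G' _ ih => exact ⟨ih.1.symm, ih.2.symm⟩
  | trans G G' G'' _ _ ih₁ ih₂ => exact ⟨ih₁.1.trans ih₂.1, ih₁.2.trans ih₂.2⟩

/-- The size of a closed family of a graph that can be matched onto `H` is bounded by `H`. -/
theorem MatchesOnto.family_le {K H : LGraph N W X E F} (h : K.MatchesOnto H) {k : ℕ}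
    (hk : K.HasFamily k ∨ K.rev.HasFamily k) : k ≤ H.verts.length := by
  obtain ⟨H', hH, m, hm⟩ := h
  rcases hk with hk | hk
  · exact ((hH.hasFamily_iff k).1.2 (hm.hasFamily hk)).le_length
  · exact ((hH.hasFamily_iff k).2.2 (hm.hasFamily_rev hk)).le_length

end LGraph

/-! ### Families along a derivation -/

/-- Whether a vertex label is a nonterminal. -/
def VLabel.isNonterminal {N W X : Type*} : VLabel N W X → Bool
  | .nonterminal _ => true
  | _ => false

namespace LGraph

variable {N W X E F : Type*}

/-- There is an edge labelled `γ` between `x` and `y`, whose direction, seen from `y`, is `d`. -/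
def Edge (G : LGraph N W X E F) (d : Dir) (x : ℕ) (γ : ELabel E F) (y : ℕ) : Prop :=
  match d with
  | .inward => (x, γ, y) ∈ G.edges
  | .outward => (y, γ, x) ∈ G.edges

theorem lt_fresh {G : LGraph N W X E F} {x : ℕ} {σ : VLabel N W X} (h : (x, σ) ∈ G.verts) :
    x < G.fresh := by
  unfold fresh
  generalize G.verts = l at h
  induction l with
  | nil => simp at h
  | cons q l ih =>
    simp only [List.foldr_cons, lt_max_iff]
    rcases List.mem_cons.1 h with rfl | h
    · exact .inl (Nat.lt_succ_self _)
    · exact .inr (ih h)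

/-- The number of nonterminal vertices. -/
def ntCount (G : LGraph N W X E F) : ℕ :=
  G.verts.countP fun q => q.2.isNonterminal

theorem ntCount_eq_zero {G : LGraph N W X E F} (h : ∀ x, ¬ G.IsNonterminal x) :
    G.ntCount = 0 := by
  rw [ntCount, List.countP_eq_zero]
  rintro ⟨x, σ⟩ hx
  cases σ with
  | nonterminal Y => exact absurd ⟨Y, hx⟩ (h x)
  | _ => simp [VLabel.isNonterminal]

section Subst

variable [DecidableEq N] [DecidableEq W] [DecidableEq X] [DecidableEq E] [DecidableEq F]
variable {H : LGraph N W X E F} {v : ℕ} {p : Production N W X E F}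

theorem mem_subst_of_mem {x : ℕ} {σ : VLabel N W X} (h : (x, σ) ∈ H.verts) (hx : x ≠ v) :
    (x, σ) ∈ (H.subst v p).verts := by
  simp [subst, h, hx]

theorem mem_subst_body {x : ℕ} {σ : VLabel N W X} (h : (x, σ) ∈ p.body.verts) :
    (H.fresh + x, σ) ∈ (H.subst v p).verts := by
  simp [subst, h]

theorem Edge.subst_of_ne {d : Dir} {x y : ℕ} {γ : ELabel E F} (h : H.Edge d x γ y)
    (hx : x ≠ v) (hy : y ≠ v) : (H.subst v p).Edge d x γ y := by
  cases d <;> simp only [Edge] at h <;> simp [Edge, subst, h, hx, hy]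

theorem Edge.subst_body {d : Dir} {x y : ℕ} {γ : ELabel E F} (h : p.body.Edge d x γ y) :
    (H.subst v p).Edge d (H.fresh + x) γ (H.fresh + y) := by
  cases d <;> simp only [Edge] at h <;> simp [Edge, subst, h]

theorem Edge.subst_conn {d : Dir} {x : ℕ} {c : ConnInstr N W X E F} (h : H.Edge d x c.old v)
    (hc : c ∈ p.conn) (hd : c.dir = d) (hx : (x, c.label) ∈ H.verts) :
    (H.subst v p).Edge d x c.new (H.fresh + c.vertex) := by
  cases d with
  | inward =>
    simp only [Edge, subst, List.mem_append, List.mem_flatMap]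
    refine .inl (.inr ⟨_, h, ?_⟩)
    simp only [List.mem_map, List.mem_filter]
    exact ⟨c, ⟨hc, by simp [hd, hx]⟩, rfl⟩
  | outward =>
    simp only [Edge, subst, List.mem_append, List.mem_flatMap]
    refine .inr ⟨_, h, ?_⟩
    simp only [List.mem_map, List.mem_filter]
    exact ⟨c, ⟨hc, by simp [hd, hx]⟩, rfl⟩

theorem nodup_subst (hH : (H.verts.map Prod.fst).Nodup) (hp : (p.body.verts.map Prod.fst).Nodup) :
    ((H.subst v p).verts.map Prod.fst).Nodup := by
  simp only [subst, List.map_append, List.map_map]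
  refine List.nodup_append.2 ⟨hH.sublist (List.filter_sublist.map _), ?_, ?_⟩
  · have : (Prod.fst ∘ fun q : ℕ × VLabel N W X => (H.fresh + q.1, q.2)) =
      (fun x => H.fresh + x) ∘ Prod.fst := rfl
    rw [this, ← List.map_map]
    exact hp.map fun x y h => by simpa using h
  · intro x hx y hy
    simp only [List.mem_map, List.mem_filter] at hx hy
    obtain ⟨⟨x, σ⟩, ⟨hx, -⟩, rfl⟩ := hx
    obtain ⟨⟨y, τ⟩, -, rfl⟩ := hy
    have := lt_fresh hx
    simp only [Function.comp_apply]
    omega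

theorem ntCount_subst_ge (hH : (H.verts.map Prod.fst).Nodup) :
    H.ntCount + p.body.ntCount ≤ (H.subst v p).ntCount + 1 := by
  have h1 : H.ntCount ≤
      (H.verts.filter fun q => q.1 ≠ v).countP (fun q => q.2.isNonterminal) + 1 := by
    have h2 : H.verts.countP (fun q => decide (q.1 = v)) ≤ 1 := by
      have := List.nodup_iff_count_le_one.1 hH v
      rw [List.count, List.countP_map] at this
      refine le_trans (List.countP_mono_left ?_) this
      intro q _ h
      simpa using h
    refine le_trans ?_ (Nat.add_le_add_left h2 _)
    rw [ntCount, List.countP_filter]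
    generalize H.verts = l
    induction l with
    | nil => simp
    | cons q l ih =>
      simp only [List.countP_cons]
      by_cases hq : q.1 = v <;> cases q.2.isNonterminal <;> simp [hq] at ih ⊢ <;> omega
  have h3 : p.body.ntCount = (p.body.verts.map
      (fun q => (H.fresh + q.1, q.2))).countP (fun q => q.2.isNonterminal) := by
    rw [List.countP_map]; rfl
  have h4 : (H.subst v p).ntCount = _ := List.countP_append
  rw [h4, ← h3]
  omega

end Subst

end LGraph

open LGraph

namespace Grammar

variable {N W X E F : Type*}

/-- Every production for `Y` has an instruction that passes on an edge labelled `γ` between a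
`w`-labelled wire-vertex and a `Y`-labelled vertex. -/
def Absorbs (B : Grammar N W X E F) (d : Dir) (w : W) (γ : ELabel E F) (Y : X) : Prop :=
  ∀ q ∈ B.productions, q.lhs = Y →
    ∃ c ∈ q.conn, c.label = VLabel.wire w ∧ c.old = γ ∧ c.dir = d

/-- `x` is an anchor, or will become one once all nonterminals are replaced. -/
def PreAnchor (B : Grammar N W X E F) (d : Dir) (G : LGraph N W X E F) (x : ℕ) : Prop :=
  G.IsNode x ∨ ∃ w, (x, VLabel.wire w) ∈ G.verts ∧ ∃ γ y, G.Edge d x γ y ∧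
    (G.IsNode y ∨ ∃ Y, (y, VLabel.nonterminal Y) ∈ G.verts ∧ B.Absorbs d w γ Y)

/-- There is an edge between the wire-vertices `x` and `y`, of direction `d` seen from `y`. -/
def WireWire (d : Dir) (G : LGraph N W X E F) (x y : ℕ) : Prop :=
  G.IsWire x ∧ G.IsWire y ∧ ∃ γ, G.Edge d x γ y

/-- The analogue of `LGraph.HasFamily` for sentential forms, with `PreAnchor` for `Anchor`. -/
def HasPreFamily (B : Grammar N W X E F) (d : Dir) (G : LGraph N W X E F) (k : ℕ) : Prop :=
  ∃ A : Fin k → Set ℕ, IsClosedFamily (B.PreAnchor d G) (WireWire d G) A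

variable {B : Grammar N W X E F}

theorem PreAnchor.isVertex {d : Dir} {G : LGraph N W X E F} {x : ℕ} (h : B.PreAnchor d G x) :
    G.IsVertex x := by
  rcases h with ⟨n, h⟩ | ⟨w, h, -⟩ <;> exact ⟨_, h⟩

theorem isVertex_of_mem_family {d : Dir} {G : LGraph N W X E F} {k : ℕ} {A : Fin k → Set ℕ}
    (hA : IsClosedFamily (B.PreAnchor d G) (WireWire d G) A) {i : Fin k} {x : ℕ} (hx : x ∈ A i) :
    G.IsVertex x := by
  rcases hA.closed i x hx with h | ⟨y, -, ⟨w, h⟩, -⟩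
  · exact h.isVertex
  · exact ⟨_, h⟩

theorem HasPreFamily.hasFamily {G : LGraph N W X E F} {k : ℕ} (h : B.HasPreFamily .inward G k)
    (hG : ∀ x, ¬ G.IsNonterminal x) : G.HasFamily k := by
  obtain ⟨A, hA⟩ := h
  refine ⟨A, hA.mono ?_ ?_⟩
  · rintro x (h | ⟨w, hw, γ, y, h1, h2 | ⟨Y, h2, -⟩⟩)
    · exact .inl h
    · exact .inr ⟨⟨w, hw⟩, γ, y, h1, h2⟩
    · exact absurd ⟨Y, h2⟩ (hG y)
  · rintro x y ⟨h1, -, h2⟩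
    exact ⟨h1, h2⟩

theorem HasPreFamily.hasFamily_rev {G : LGraph N W X E F} {k : ℕ}
    (h : B.HasPreFamily .outward G k) (hG : ∀ x, ¬ G.IsNonterminal x) : G.rev.HasFamily k := by
  obtain ⟨A, hA⟩ := h
  refine ⟨A, hA.mono ?_ ?_⟩
  · rintro x (h | ⟨w, hw, γ, y, h1, h2 | ⟨Y, h2, -⟩⟩)
    · exact .inl h
    · exact .inr ⟨⟨w, hw⟩, γ, y, mem_rev_edges.2 h1, h2⟩
    · exact absurd ⟨Y, h2⟩ (hG y)
  · rintro x y ⟨h1, -, γ, h2⟩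
    exact ⟨h1, γ, mem_rev_edges.2 h2⟩

/-- A production body with a terminal vertex, but without bare wires and isolated wire-vertices,
contains a closed set for one of the two directions: unless there is a node-vertex, a wire can be
followed forwards for ever or up to a nonterminal, or else it ends in an output; then it can be
followed backwards for ever or up to a nonterminal. -/
theorem exists_closed_body (hB : B.IsBESG) {p : Production N W X E F} (hp : p ∈ B.productions)
    (hbare : ¬ p.body.HasBareWire) (hiso : ¬ p.body.HasIsolatedWireVertex)
    (hterm : ∃ x, p.body.IsNode x ∨ p.body.IsWire x) :
    ∃ (d : Dir) (C : Set ℕ), C.Nonempty ∧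
      ∀ x ∈ C, B.PreAnchor d p.body x ∨ ∃ y ∈ C, WireWire d p.body x y := by
  have hwf := hB.isBedNCE.wellFormed p hp
  by_cases hnode : ∃ n, p.body.IsNode n
  · obtain ⟨n, hn⟩ := hnode
    exact ⟨.inward, {n}, ⟨n, rfl⟩, by rintro x rfl; exact .inl (.inl hn)⟩
  obtain ⟨x, hx⟩ : ∃ x, p.body.IsWire x := by
    obtain ⟨x, h | h⟩ := hterm
    · exact absurd ⟨x, h⟩ hnode
    · exact ⟨x, h⟩
  set T : ℕ → ℕ → Prop := fun x y => p.body.IsWire x ∧ p.body.IsWire y ∧ p.body.Arrow x y with hT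
  -- A wire-vertex whose `d`-edge leads to a nonterminal is going to be anchored, by `W4`.
  have hnt : ∀ d r γ y, p.body.IsWire r → p.body.Edge d r γ y → p.body.IsVertex y →
      ¬ p.body.IsWire y → B.PreAnchor d p.body r := by
    rintro d r γ y ⟨w, hw⟩ he ⟨σ, hσ⟩ hy
    cases σ with
    | node n => exact absurd ⟨y, n, hσ⟩ hnode
    | wire w => exact absurd ⟨w, hσ⟩ hy
    | nonterminal Y =>
      refine .inr ⟨w, hw, γ, y, he, .inr ⟨Y, hσ, ?_⟩⟩
      intro q hq hqY
      refine hB.W4 p hp y Y hσ w γ d (.inl ⟨r, hw, ?_⟩) q hq hqY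
      cases d
      · exact .inl ⟨rfl, he⟩
      · exact .inr ⟨rfl, he⟩
  by_cases h1 : ∃ r, Relation.ReflTransGen T x r ∧ B.PreAnchor .inward p.body r
  · obtain ⟨r, -, hr⟩ := h1
    exact ⟨.inward, {r}, ⟨r, rfl⟩, by rintro x rfl; exact .inl hr⟩
  by_cases h2 : ∀ r, Relation.ReflTransGen T x r → ∃ y, T r y
  · refine ⟨.inward, {r | Relation.ReflTransGen T x r}, ⟨x, .refl⟩, fun r hr => .inr ?_⟩
    obtain ⟨y, hy⟩ := h2 r hr
    exact ⟨y, Relation.ReflTransGen.tail hr hy, hy.1, hy.2.1, hy.2.2⟩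
  push Not at h1 h2
  obtain ⟨b, hxb, hb⟩ := h2
  have hbw : p.body.IsWire b := by
    rcases hxb.cases_tail with rfl | ⟨c, -, hc⟩
    · exact hx
    · exact hc.2.1
  have hbout : p.body.IsOutput b := by
    refine ⟨hbw, fun γ y hy => ?_⟩
    by_cases hyw : p.body.IsWire y
    · exact hb y ⟨hbw, hyw, γ, hy⟩
    · exact h1 b hxb (hnt .inward b γ y hbw hy (hwf.2 _ _ _ hy).2.1 hyw)
  by_cases h3 : ∃ r, Relation.ReflTransGen T r b ∧ B.PreAnchor .outward p.body r
  · obtain ⟨r, -, hr⟩ := h3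
    exact ⟨.outward, {r}, ⟨r, rfl⟩, by rintro x rfl; exact .inl hr⟩
  by_cases h4 : ∀ r, Relation.ReflTransGen T r b → ∃ y, T y r
  · refine ⟨.outward, {r | Relation.ReflTransGen T r b}, ⟨b, .refl⟩, fun r hr => .inr ?_⟩
    obtain ⟨y, hy⟩ := h4 r hr
    exact ⟨y, Relation.ReflTransGen.head hy hr, hy.2.1, hy.1, hy.2.2⟩
  push Not at h3 h4
  obtain ⟨a, hab, ha⟩ := h4
  have haw : p.body.IsWire a := by
    rcases hab.cases_head with rfl | ⟨c, hc, -⟩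
    · exact hbw
    · exact hc.1
  have hain : p.body.IsInput a := by
    refine ⟨haw, fun y γ hy => ?_⟩
    by_cases hyw : p.body.IsWire y
    · exact ha y ⟨hyw, haw, γ, hy⟩
    · exact h3 a hab (hnt .outward a γ y haw hy (hwf.2 _ _ _ hy).1 hyw)
  rcases Relation.reflTransGen_iff_eq_or_transGen.1 hab with rfl | hab
  · exact absurd ⟨b, hain, hbout⟩ hiso
  · exact absurd ⟨a, b, hain, hbout, hab⟩ hbare

open scoped Classical in
/-- The number of steps of a derivation that use a production whose body has a bare wire. -/
noncomputable def bareSteps (B : Grammar N W X E F) (s : List (ℕ × ℕ)) : ℕ :=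
  s.countP fun q => ∃ p, B.productions[q.2]? = some p ∧ p.body.HasBareWire

variable [DecidableEq N] [DecidableEq W] [DecidableEq X] [DecidableEq E] [DecidableEq F]

/-- A production body without terminal vertices has at least two nonterminal ones. -/
theorem two_le_ntCount (hB : B.IsMatchExhaustive) {p : Production N W X E F}
    (hp : p ∈ B.productions) (h : ¬ ∃ x, p.body.IsNode x ∨ p.body.IsWire x) :
    2 ≤ p.body.ntCount := by
  have hall : ∀ q ∈ p.body.verts, ∃ Y, q.2 = VLabel.nonterminal Y := by
    rintro ⟨x, σ⟩ hx
    cases σ with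
    | node n => exact absurd ⟨x, .inl ⟨n, hx⟩⟩ h
    | wire w => exact absurd ⟨x, .inr ⟨w, hx⟩⟩ h
    | nonterminal Y => exact ⟨Y, rfl⟩
  have hlen : p.body.ntCount = p.body.verts.length := by
    rw [ntCount, List.countP_eq_length]
    intro q hq
    obtain ⟨Y, hY⟩ := hall q hq
    simp [hY, VLabel.isNonterminal]
  rw [hlen]
  rcases hl : p.body.verts with - | ⟨⟨x, σ⟩, - | ⟨q, l⟩⟩
  · exact absurd hl (hB.no_empty p hp)
  · obtain ⟨Y, rfl⟩ := hall (x, σ) (by simp [hl])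
    exact absurd hl (hB.no_single_nonterminal p hp x Y)
  · simp

section Subst

variable {H : LGraph N W X E F} {v : ℕ} {p : Production N W X E F}

/-- If the nonterminal next to `x` is replaced, an instruction of the production passes the edge on to
a node-vertex, or to a nonterminal that absorbs it by `W4`. -/
theorem PreAnchor.subst (hB : B.IsBESG) (hp : p ∈ B.productions)
    (hH : (H.verts.map Prod.fst).Nodup) (hv : (v, VLabel.nonterminal p.lhs) ∈ H.verts)
    {d : Dir} {x : ℕ} (h : B.PreAnchor d H x) : B.PreAnchor d (H.subst v p) x := by
  have hne : ∀ y σ, (y, σ) ∈ H.verts → σ ≠ VLabel.nonterminal p.lhs → y ≠ v := by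
    rintro y σ hy hσ rfl
    exact hσ (label_unique hH hy hv)
  rcases h with ⟨n, hn⟩ | ⟨w, hw, γ, y, he, hy⟩
  · exact .inl ⟨n, mem_subst_of_mem hn (hne x _ hn (by simp))⟩
  have hxv := hne x _ hw (by simp)
  refine .inr ⟨w, mem_subst_of_mem hw hxv, ?_⟩
  rcases hy with ⟨n, hn⟩ | ⟨Y, hY, habs⟩
  · have hyv := hne y _ hn (by simp)
    exact ⟨γ, y, he.subst_of_ne hxv hyv, .inl ⟨n, mem_subst_of_mem hn hyv⟩⟩
  by_cases hyv : y = v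
  · subst hyv
    obtain rfl : Y = p.lhs := by simpa using label_unique hH hY hv
    obtain ⟨c, hc, hl, rfl, hd⟩ := habs p hp rfl
    refine ⟨c.new, _, he.subst_conn hc hd (hl ▸ hw), ?_⟩
    obtain ⟨σ, hσ⟩ := hB.isBedNCE.conn_vertex p hp c hc
    cases σ with
    | node n => exact .inl ⟨n, mem_subst_body hσ⟩
    | wire w => exact absurd ⟨w, hσ⟩ (hB.W2 p hp c hc)
    | nonterminal Z =>
      exact .inr ⟨Z, mem_subst_body hσ, fun q hq hqZ =>
        hB.W4 p hp c.vertex Z hσ w c.new d (.inr ⟨c, hc, hl, rfl, rfl, hd⟩) q hq hqZ⟩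
  · exact ⟨γ, y, he.subst_of_ne hxv hyv, .inr ⟨Y, mem_subst_of_mem hY hyv, habs⟩⟩

theorem WireWire.subst (hH : (H.verts.map Prod.fst).Nodup)
    (hv : (v, VLabel.nonterminal p.lhs) ∈ H.verts)
    {d : Dir} {x y : ℕ} (h : WireWire d H x y) : WireWire d (H.subst v p) x y := by
  have hne : ∀ y w, (y, VLabel.wire w) ∈ H.verts → y ≠ v := by
    rintro y w hy rfl
    simpa using label_unique hH hy hv
  obtain ⟨⟨w, hw⟩, ⟨w', hw'⟩, γ, he⟩ := h
  have hx := hne x _ hw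
  have hy := hne y _ hw'
  exact ⟨⟨w, mem_subst_of_mem hw hx⟩, ⟨w', mem_subst_of_mem hw' hy⟩, γ, he.subst_of_ne hx hy⟩

theorem HasPreFamily.subst (hB : B.IsBESG) (hp : p ∈ B.productions)
    (hH : (H.verts.map Prod.fst).Nodup) (hv : (v, VLabel.nonterminal p.lhs) ∈ H.verts)
    {d : Dir} {k : ℕ} (h : B.HasPreFamily d H k) : B.HasPreFamily d (H.subst v p) k := by
  obtain ⟨A, hA⟩ := h
  exact ⟨A, hA.mono (fun x hx => hx.subst hB hp hH hv) (fun x y h => h.subst hH hv)⟩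

theorem PreAnchor.subst_body {d : Dir} {x : ℕ} (h : B.PreAnchor d p.body x) :
    B.PreAnchor d (H.subst v p) (H.fresh + x) := by
  rcases h with ⟨n, hn⟩ | ⟨w, hw, γ, y, he, hy⟩
  · exact .inl ⟨n, mem_subst_body hn⟩
  · refine .inr ⟨w, mem_subst_body hw, γ, H.fresh + y, he.subst_body, ?_⟩
    exact hy.imp (fun ⟨n, hn⟩ => ⟨n, mem_subst_body hn⟩)
      fun ⟨Y, hY, habs⟩ => ⟨Y, mem_subst_body hY, habs⟩

theorem HasPreFamily.subst_succ (hB : B.IsBESG) (hp : p ∈ B.productions)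
    (hH : (H.verts.map Prod.fst).Nodup) (hv : (v, VLabel.nonterminal p.lhs) ∈ H.verts)
    {d : Dir} {k : ℕ} (h : B.HasPreFamily d H k) {C : Set ℕ} (hne : C.Nonempty)
    (hC : ∀ x ∈ C, B.PreAnchor d p.body x ∨ ∃ y ∈ C, WireWire d p.body x y) :
    B.HasPreFamily d (H.subst v p) (k + 1) := by
  obtain ⟨A, hA⟩ := h
  refine ⟨_, (hA.mono (fun x hx => hx.subst hB hp hH hv) (fun x y h => h.subst hH hv)).cons
    (hne.image (fun x => H.fresh + x)) ?_ ?_⟩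
  · rintro _ ⟨x, -, rfl⟩ i hx
    obtain ⟨σ, hσ⟩ := isVertex_of_mem_family hA hx
    have : H.fresh + x < H.fresh := lt_fresh hσ
    omega
  · rintro _ ⟨x, hx, rfl⟩
    refine (hC x hx).imp (fun h => h.subst_body) ?_
    rintro ⟨y, hy, ⟨w, hw⟩, ⟨w', hw'⟩, γ, he⟩
    exact ⟨_, ⟨y, hy, rfl⟩, ⟨w, mem_subst_body hw⟩, ⟨w', mem_subst_body hw'⟩, γ, he.subst_body⟩

end Subst

open scoped Classical in
/-- A derivation step whose body has no bare wire raises the number of nonterminals, or it lowers it by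
at most one and enlarges one of the two families. -/
theorem Derives.families (hB : B.IsBESG) (hM : B.IsMatchExhaustive) {H H' : LGraph N W X E F}
    {s : List (ℕ × ℕ)} (hs : B.Derives H s H') : (H.verts.map Prod.fst).Nodup → ∀ {k l : ℕ},
      B.HasPreFamily .inward H k → B.HasPreFamily .outward H l →
      (H'.verts.map Prod.fst).Nodup ∧ ∃ k' l',
        B.HasPreFamily .inward H' k' ∧ B.HasPreFamily .outward H' l' ∧
        H.ntCount + s.length + 2 * (k + l) ≤ H'.ntCount + 2 * (k' + l' + B.bareSteps s) := by
  induction hs with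
  | nil H => exact fun hH k l hk hl => ⟨hH, k, l, hk, hl, by simp [bareSteps]⟩
  | @cons H H' v i p s hi hv hs ih =>
    intro hH k l hk hl
    have hp := List.mem_of_getElem? hi
    have hH1 : ((H.subst v p).verts.map Prod.fst).Nodup :=
      nodup_subst hH (hB.isBedNCE.wellFormed p hp).1
    have hnt := ntCount_subst_ge (v := v) (p := p) hH
    have hbs : B.bareSteps ((v, i) :: s) =
        B.bareSteps s + if p.body.HasBareWire then 1 else 0 := by
      simp [bareSteps, List.countP_cons, hi]
    have hk1 := hk.subst hB hp hH hv
    have hl1 := hl.subst hB hp hH hv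
    -- Either the body yields two nonterminals, or the step is charged to a bare wire or a new set.
    have key : ∃ k' l', B.HasPreFamily .inward (H.subst v p) k' ∧
        B.HasPreFamily .outward (H.subst v p) l' ∧ H.ntCount + 1 + 2 * (k + l) ≤
          (H.subst v p).ntCount + 2 * (k' + l' + if p.body.HasBareWire then 1 else 0) := by
      by_cases hterm : ∃ x, p.body.IsNode x ∨ p.body.IsWire x
      · by_cases hbare : p.body.HasBareWire
        · exact ⟨k, l, hk1, hl1, by simp only [hbare, if_true]; omega⟩
        · obtain ⟨d, C, hne, hC⟩ := exists_closed_body hB hp hbare (hM.no_isolated p hp) hterm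
          cases d
          · exact ⟨k + 1, l, hk.subst_succ hB hp hH hv hne hC, hl1, by omega⟩
          · exact ⟨k, l + 1, hk1, hl.subst_succ hB hp hH hv hne hC, by omega⟩
      · have := two_le_ntCount hM hp hterm
        exact ⟨k, l, hk1, hl1, by omega⟩
    obtain ⟨k1, l1, hk1, hl1, hle⟩ := key
    obtain ⟨hH', k', l', hk', hl', hle'⟩ := ih hH1 hk1 hl1
    refine ⟨hH', k', l', hk', hl', ?_⟩
    rw [hbs, List.length_cons]
    omega

theorem Derives.start_families (hB : B.IsBESG) (hM : B.IsMatchExhaustive) {H : LGraph N W X E F}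
    {s : List (ℕ × ℕ)} (hs : B.Derives B.startGraph s H) (hH : ∀ x, ¬ H.IsNonterminal x) :
    (H.verts.map Prod.fst).Nodup ∧ ∃ k l,
      B.HasPreFamily .inward H k ∧ B.HasPreFamily .outward H l ∧
      s.length ≤ 2 * (k + l + B.bareSteps s) := by
  have h0 : ∀ d, B.HasPreFamily d B.startGraph 0 := fun d =>
    ⟨Fin.elim0, fun i => i.elim0, fun i => i.elim0, fun i => i.elim0⟩
  obtain ⟨h1, k, l, hk, hl, hle⟩ := hs.families hB hM (by simp [startGraph]) (h0 _) (h0 _)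
  refine ⟨h1, k, l, hk, hl, ?_⟩
  rw [ntCount_eq_zero hH] at hle
  omega

/-! ### Families along a decoding -/

section Decode

omit [DecidableEq N] [DecidableEq W] [DecidableEq X]

variable {H : LGraph N W X E F} {u v : ℕ} {r : DecodingRule N W X E F}

/-- The renaming of the vertices of the right-hand side in a decoding step. -/
def decodeName (H : LGraph N W X E F) (u v : ℕ) (r : DecodingRule N W X E F) (x : ℕ) : ℕ :=
  if x = r.src then u else if x = r.tgt then v else H.fresh + x

omit [DecidableEq E] [DecidableEq F] in
theorem decodeName_of_ne {x : ℕ} (h1 : x ≠ r.src) (h2 : x ≠ r.tgt) :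
    decodeName H u v r x = H.fresh + x := by
  simp [decodeName, h1, h2]

theorem mem_decode_of_mem {x : ℕ} {σ : VLabel N W X} (h : (x, σ) ∈ H.verts) :
    (x, σ) ∈ (H.decode u v r).verts := by
  simp [decode, h]

theorem mem_decode_rhs {x : ℕ} {σ : VLabel N W X} (hr : r.IsValid)
    (hu : (u, VLabel.node r.srcLabel) ∈ H.verts) (hv : (v, VLabel.node r.tgtLabel) ∈ H.verts)
    (h : (x, σ) ∈ r.rhs.verts) : (decodeName H u v r x, σ) ∈ (H.decode u v r).verts := by
  by_cases h1 : x = r.src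
  · subst h1
    obtain rfl := label_unique hr.isStringGraph.wellFormed.1 h hr.src_mem
    simpa [decodeName] using mem_decode_of_mem hu
  by_cases h2 : x = r.tgt
  · subst h2
    obtain rfl := label_unique hr.isStringGraph.wellFormed.1 h hr.tgt_mem
    simpa [decodeName, h1] using mem_decode_of_mem hv
  simp only [decode, List.mem_append, List.mem_map, List.mem_filter]
  exact .inr ⟨(x, σ), ⟨h, by simp [h1, h2]⟩, rfl⟩

theorem Edge.decode_of_ne {d : Dir} {x y : ℕ} {γ : ELabel E F} (h : H.Edge d x γ y)
    (hx : x ≠ u) (hx' : x ≠ v) : (H.decode u v r).Edge d x γ y := by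
  cases d <;> simp only [Edge] at h <;> simp [Edge, decode, h, hx, hx']

theorem Edge.decode_rhs {d : Dir} {x y : ℕ} {γ : ELabel E F} (h : r.rhs.Edge d x γ y) :
    (H.decode u v r).Edge d (decodeName H u v r x) γ (decodeName H u v r y) := by
  cases d
  · simp only [Edge, decode, List.mem_append, List.mem_map]
    exact .inr ⟨_, h, rfl⟩
  · simp only [Edge, decode, List.mem_append, List.mem_map]
    exact .inr ⟨_, h, rfl⟩

theorem nodup_decode (hH : (H.verts.map Prod.fst).Nodup) (hr : r.IsValid) :
    ((H.decode u v r).verts.map Prod.fst).Nodup := by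
  have hmap : ((r.rhs.verts.filter (fun q => q.1 ≠ r.src ∧ q.1 ≠ r.tgt)).map
      (fun q => (decodeName H u v r q.1, q.2))).map Prod.fst =
      ((r.rhs.verts.filter (fun q => q.1 ≠ r.src ∧ q.1 ≠ r.tgt)).map Prod.fst).map
        (fun x => H.fresh + x) := by
    rw [List.map_map, List.map_map]
    refine List.map_congr_left fun q hq => ?_
    simp only [List.mem_filter, decide_eq_true_eq] at hq
    exact decodeName_of_ne hq.2.1 hq.2.2
  have hverts : (H.decode u v r).verts = H.verts ++
      (r.rhs.verts.filter (fun q => q.1 ≠ r.src ∧ q.1 ≠ r.tgt)).map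
        (fun q => (decodeName H u v r q.1, q.2)) := rfl
  rw [hverts, List.map_append, hmap]
  refine List.nodup_append.2 ⟨hH, ?_, ?_⟩
  · exact (hr.isStringGraph.wellFormed.1.sublist (List.filter_sublist.map _)).map
      fun x y h => by simpa using h
  · intro x hx y hy
    simp only [List.mem_map] at hx hy
    obtain ⟨⟨x, σ⟩, hx, rfl⟩ := hx
    obtain ⟨y, -, rfl⟩ := hy
    have := lt_fresh hx
    simp only
    omega

theorem not_isNonterminal_decode (hr : r.IsValid) (hH : ∀ x, ¬ H.IsNonterminal x) (x : ℕ) :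
    ¬ (H.decode u v r).IsNonterminal x := by
  rintro ⟨Y, hY⟩
  simp only [decode, List.mem_append, List.mem_map, List.mem_filter, Prod.mk.injEq] at hY
  rcases hY with hY | ⟨q, ⟨hq, -⟩, -, hqY⟩
  · exact hH x ⟨Y, hY⟩
  · exact hr.isStringGraph.no_nonterminal q.1 ⟨Y, by rw [← hqY]; exact hq⟩

omit [DecidableEq E] [DecidableEq F] in
/-- The right-hand side of a decoding rule has a vertex besides the two shared ones. -/
theorem _root_.BESG.DecodingRule.IsValid.exists_vertex {r : DecodingRule N W X E F}
    (hr : r.IsValid) : ∃ x, r.rhs.IsVertex x ∧ x ≠ r.src ∧ x ≠ r.tgt := by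
  by_contra! hcon
  have hno : ∀ x y, ¬ r.rhs.Arrow x y := by
    rintro x y ⟨γ, h⟩
    have hnode : ∀ z, r.rhs.IsVertex z → r.rhs.IsNode z := by
      intro z hz
      by_cases hzs : z = r.src
      · exact ⟨_, hzs ▸ hr.src_mem⟩
      · exact ⟨_, hcon z hz hzs ▸ hr.tgt_mem⟩
    obtain ⟨h1, h2, -⟩ := hr.isStringGraph.wellFormed.2 _ _ _ h
    exact hr.isStringGraph.no_node_node x γ y h ⟨hnode x h1, hnode y h2⟩
  have h := hr.connected.2 r.src r.tgt ⟨_, hr.src_mem⟩ ⟨_, hr.tgt_mem⟩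
  refine hr.src_ne_tgt ?_
  generalize r.src = a, r.tgt = b at h
  induction h with
  | rel x y h => exact absurd h (hno x y)
  | refl x => rfl
  | symm x y _ ih => exact ih.symm
  | trans x y z _ _ ih₁ ih₂ => exact ih₁.trans ih₂

theorem isClosedFamily_decode (hH : (H.verts.map Prod.fst).Nodup)
    (hu : (u, VLabel.node r.srcLabel) ∈ H.verts) (hv : (v, VLabel.node r.tgtLabel) ∈ H.verts)
    {d : Dir} {k : ℕ} {A : Fin k → Set ℕ}
    (hA : IsClosedFamily (B.PreAnchor d H) (WireWire d H) A) :
    IsClosedFamily (B.PreAnchor d (H.decode u v r)) (WireWire d (H.decode u v r)) A := by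
  have hne : ∀ x w, (x, VLabel.wire w) ∈ H.verts → x ≠ u ∧ x ≠ v := by
    intro x w hx
    constructor <;> rintro rfl
    · simpa using label_unique hH hx hu
    · simpa using label_unique hH hx hv
  refine hA.mono ?_ ?_
  · rintro x (⟨n, hn⟩ | ⟨w, hw, γ, y, he, hy⟩)
    · exact .inl ⟨n, mem_decode_of_mem hn⟩
    · refine .inr ⟨w, mem_decode_of_mem hw, γ, y,
        Edge.decode_of_ne he (hne x w hw).1 (hne x w hw).2, ?_⟩
      exact hy.imp (fun ⟨n, hn⟩ => ⟨n, mem_decode_of_mem hn⟩)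
        fun ⟨Y, hY, h⟩ => ⟨Y, mem_decode_of_mem hY, h⟩
  · rintro x y ⟨⟨w, hw⟩, ⟨w', hw'⟩, γ, he⟩
    exact ⟨⟨w, mem_decode_of_mem hw⟩, ⟨w', mem_decode_of_mem hw'⟩, γ,
      Edge.decode_of_ne he (hne x w hw).1 (hne x w hw).2⟩

/-- The new vertices of a decoding step form a closed set, as the right-hand side of a decoding
rule has no outputs. -/
theorem HasPreFamily.decode_succ (hr : r.IsValid) (hH : (H.verts.map Prod.fst).Nodup)
    (hu : (u, VLabel.node r.srcLabel) ∈ H.verts) (hv : (v, VLabel.node r.tgtLabel) ∈ H.verts)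
    {k : ℕ} (h : B.HasPreFamily .inward H k) :
    B.HasPreFamily .inward (H.decode u v r) (k + 1) := by
  obtain ⟨A, hA⟩ := h
  obtain ⟨x₀, hx₀, hx₀s, hx₀t⟩ := hr.exists_vertex
  refine ⟨_, (isClosedFamily_decode hH hu hv hA).cons
    (C := {z | ∃ x, r.rhs.IsVertex x ∧ x ≠ r.src ∧ x ≠ r.tgt ∧ z = H.fresh + x})
    ⟨_, x₀, hx₀, hx₀s, hx₀t, rfl⟩ ?_ ?_⟩
  · rintro _ ⟨x, -, -, -, rfl⟩ i hx
    obtain ⟨σ, hσ⟩ := isVertex_of_mem_family hA hx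
    have : H.fresh + x < H.fresh := lt_fresh hσ
    omega
  · rintro _ ⟨x, ⟨σ, hσ⟩, hxs, hxt, rfl⟩
    have hmem : (H.fresh + x, σ) ∈ (H.decode u v r).verts := by
      simpa [decodeName_of_ne hxs hxt] using mem_decode_rhs hr hu hv hσ
    cases σ with
    | nonterminal Y => exact absurd ⟨Y, hσ⟩ (hr.isStringGraph.no_nonterminal x)
    | node n => exact .inl (.inl ⟨n, hmem⟩)
    | wire w =>
      obtain ⟨γ, y, he⟩ : ∃ γ y, (x, γ, y) ∈ r.rhs.edges := by
        by_contra! hcon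
        exact hr.no_boundary x (.inr ⟨⟨w, hσ⟩, hcon⟩)
      have he' : (H.decode u v r).Edge .inward (H.fresh + x) γ (decodeName H u v r y) := by
        simpa [decodeName_of_ne hxs hxt] using
          Edge.decode_rhs (H := H) (u := u) (v := v) (d := .inward) (x := x) he
      obtain ⟨τ, hτ⟩ := (hr.isStringGraph.wellFormed.2 _ _ _ he).2.1
      have hτ' := mem_decode_rhs hr hu hv hτ
      cases τ with
      | nonterminal Y => exact absurd ⟨Y, hτ⟩ (hr.isStringGraph.no_nonterminal y)
      | node n => exact .inl (.inr ⟨w, hmem, γ, _, he', .inl ⟨n, hτ'⟩⟩)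
      | wire w' =>
        have hys : y ≠ r.src := by
          rintro rfl
          simpa using label_unique hr.isStringGraph.wellFormed.1 hτ hr.src_mem
        have hyt : y ≠ r.tgt := by
          rintro rfl
          simpa using label_unique hr.isStringGraph.wellFormed.1 hτ hr.tgt_mem
        exact .inr ⟨decodeName H u v r y, ⟨y, ⟨_, hτ⟩, hys, hyt, decodeName_of_ne hys hyt⟩,
          ⟨w, hmem⟩, ⟨w', hτ'⟩, γ, he'⟩

end Decode

omit [DecidableEq N] [DecidableEq W] [DecidableEq X] in
/-- Every decoding step extends the family for the inward direction. -/
theorem Decodes.families (hB : B.IsBESG) {H K : LGraph N W X E F} {t : List (ℕ × E × ℕ)}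
    (ht : B.Decodes H t K) : (H.verts.map Prod.fst).Nodup → (∀ x, ¬ H.IsNonterminal x) →
      ∀ {k l : ℕ}, B.HasPreFamily .inward H k → B.HasPreFamily .outward H l →
      (∀ x, ¬ K.IsNonterminal x) ∧
        B.HasPreFamily .inward K (k + t.length) ∧ B.HasPreFamily .outward K l := by
  induction ht with
  | nil H => exact fun _ hH k l hk hl => ⟨hH, hk, hl⟩
  | @cons H K u v r t hr he hu hv ht ih =>
    intro hH hnt k l hk hl
    have hval := hB.isDecodingSystem.valid r hr
    obtain ⟨A, hA⟩ := hl
    have := ih (nodup_decode hH hval) (not_isNonterminal_decode hval hnt)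
      (hk.decode_succ hval hH hu hv) ⟨A, isClosedFamily_decode hH hu hv hA⟩
    rwa [List.length_cons, add_comm t.length 1, ← add_assoc]

/-- The lengths of the two parts of a derivation whose result can be matched onto `H`. -/
theorem IsConcreteDerivation.length_le (hB : B.IsBESG) (hM : B.IsMatchExhaustive)
    {s : List (ℕ × ℕ)} {t : List (ℕ × E × ℕ)} {K H : LGraph N W X E F}
    (h : B.IsConcreteDerivation s t K) (hK : K.MatchesOnto H) :
    s.length ≤ 4 * H.verts.length + 2 * B.bareSteps s ∧ t.length ≤ H.verts.length := by
  obtain ⟨H₁, hs, hnt, ht, -⟩ := h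
  obtain ⟨hnd, k, l, hk, hl, hle⟩ := hs.start_families hB hM hnt
  obtain ⟨hnt', hk', hl'⟩ := ht.families hB hnd hnt hk hl
  have h1 := hK.family_le (.inl (hk'.hasFamily hnt'))
  have h2 := hK.family_le (.inr (hl'.hasFamily_rev hnt'))
  omega

end Grammar

/-! ### Pumping -/

/-- The nonterminal that a vertex label is, if any. -/
def VLabel.nonterminal? {N W X : Type*} : VLabel N W X → Option X
  | .nonterminal Y => some Y
  | _ => none

namespace LGraph

variable {N W X E F : Type*}

/-- The labels of the nonterminal vertices. -/
def nts (G : LGraph N W X E F) : List X := G.verts.filterMap fun q => q.2.nonterminal?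

theorem mem_nts {G : LGraph N W X E F} {Y : X} :
    Y ∈ G.nts ↔ ∃ v, (v, VLabel.nonterminal Y) ∈ G.verts := by
  simp only [nts, List.mem_filterMap, Prod.exists]
  constructor
  · rintro ⟨v, σ, h, hσ⟩
    cases σ with
    | nonterminal Z =>
      obtain rfl : Z = Y := by simpa [VLabel.nonterminal?] using hσ
      exact ⟨v, h⟩
    | _ => simp [VLabel.nonterminal?] at hσ
  · rintro ⟨v, h⟩
    exact ⟨v, _, h, rfl⟩

theorem perm_cons_filter {G : LGraph N W X E F} (hG : (G.verts.map Prod.fst).Nodup) {v : ℕ}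
    {σ : VLabel N W X} (hv : (v, σ) ∈ G.verts) :
    G.verts.Perm ((v, σ) :: G.verts.filter fun q => q.1 ≠ v) := by
  obtain ⟨l₁, l₂, h⟩ := List.append_of_mem hv
  rw [h] at hG ⊢
  rw [List.map_append, List.map_cons, List.nodup_append, List.nodup_cons] at hG
  have h1 : l₁.filter (fun q => q.1 ≠ v) = l₁ := by
    refine List.filter_eq_self.2 fun q hq => ?_
    simpa using hG.2.2 q.1 (List.mem_map_of_mem hq) v (by simp)
  have h2 : l₂.filter (fun q => q.1 ≠ v) = l₂ := by
    refine List.filter_eq_self.2 fun q hq => ?_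
    have := hG.2.1.1
    simp only [decide_eq_true_eq]
    rintro rfl
    exact this (List.mem_map.2 ⟨q, hq, rfl⟩)
  rw [List.filter_append, List.filter_cons, h1, h2]
  simp

variable [DecidableEq N] [DecidableEq W] [DecidableEq X] [DecidableEq E] [DecidableEq F]

theorem nts_subst {H : LGraph N W X E F} (hH : (H.verts.map Prod.fst).Nodup) {v : ℕ}
    {p : Production N W X E F} (hv : (v, VLabel.nonterminal p.lhs) ∈ H.verts) :
    ∃ l, H.nts.Perm (p.lhs :: l) ∧ (H.subst v p).nts = l ++ p.body.nts := by
  refine ⟨(H.verts.filter fun q => q.1 ≠ v).filterMap fun q => q.2.nonterminal?, ?_, ?_⟩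
  · exact ((perm_cons_filter hH hv).filterMap _).trans (by simp [VLabel.nonterminal?])
  · simp only [nts, subst, List.filterMap_append, List.filterMap_map]
    rfl

end LGraph

namespace Grammar

open LGraph

variable {N W X E F : Type*} {B : Grammar N W X E F} {i : ℕ}

/-- The context-free abstraction of derivations: `B.Forest i l c n` says that there is a leftmost
derivation, in which nonterminals may be left unreplaced, from the word `l` of nonterminals, with
`n` steps of which `c` use the production with index `i`. -/
inductive Forest (B : Grammar N W X E F) (i : ℕ) : List X → ℕ → ℕ → Prop
  | nil : Forest B i [] 0 0
  | skip {Y : X} {l : List X} {c n : ℕ} : Forest B i l c n → Forest B i (Y :: l) c n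
  | step {j : ℕ} {p : Production N W X E F} {l : List X} {c n : ℕ} :
      B.productions[j]? = some p → Forest B i (p.body.nts ++ l) c n →
      Forest B i (p.lhs :: l) (c + if j = i then 1 else 0) (n + 1)

theorem Forest.zero (l : List X) : B.Forest i l 0 0 := by
  induction l with
  | nil => exact .nil
  | cons Y l ih => exact ih.skip

/-- The parts of a leftmost derivation below the two parts of a word are separated. -/
theorem Forest.split {l₁ l₂ : List X} {c n : ℕ} (h : B.Forest i (l₁ ++ l₂) c n) :
    ∃ c₁ c₂ n₁ n₂, B.Forest i l₁ c₁ n₁ ∧ B.Forest i l₂ c₂ n₂ ∧ c = c₁ + c₂ ∧ n = n₁ + n₂ := by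
  generalize hl : l₁ ++ l₂ = l at h
  induction h generalizing l₁ with
  | nil =>
    obtain ⟨rfl, rfl⟩ := List.append_eq_nil_iff.1 hl
    exact ⟨0, 0, 0, 0, .nil, .nil, rfl, rfl⟩
  | @skip Y l c n h ih =>
    rcases l₁ with - | ⟨Z, l₁⟩
    · obtain rfl : l₂ = Y :: l := by simpa using hl
      exact ⟨0, c, 0, n, .nil, h.skip, by simp, by simp⟩
    · obtain ⟨rfl, rfl⟩ : Z = Y ∧ l₁ ++ l₂ = l := by simpa using hl
      obtain ⟨c₁, c₂, n₁, n₂, h1, h2, h3, h4⟩ := ih rfl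
      exact ⟨c₁, c₂, n₁, n₂, h1.skip, h2, h3, h4⟩
  | @step j p l c n hj h ih =>
    rcases l₁ with - | ⟨Z, l₁⟩
    · obtain rfl : l₂ = p.lhs :: l := by simpa using hl
      exact ⟨0, _, 0, _, .nil, h.step hj, by simp, by simp⟩
    · obtain ⟨rfl, rfl⟩ : Z = p.lhs ∧ l₁ ++ l₂ = l := by simpa using hl
      obtain ⟨c₁, c₂, n₁, n₂, h1, h2, rfl, rfl⟩ := ih (l₁ := p.body.nts ++ l₁) (by simp)
      exact ⟨_, c₂, _, n₂, h1.step hj, h2, by omega, by omega⟩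

theorem Forest.append {l₁ l₂ : List X} {c₁ c₂ n₁ n₂ : ℕ} (h₁ : B.Forest i l₁ c₁ n₁)
    (h₂ : B.Forest i l₂ c₂ n₂) : B.Forest i (l₁ ++ l₂) (c₁ + c₂) (n₁ + n₂) := by
  induction h₁ with
  | nil => simpa using h₂
  | skip h ih => exact ih.skip
  | @step j p l c n hj h ih =>
    have := Forest.step (l := l ++ l₂) hj (by simpa using ih)
    convert! this using 1 <;> omega

theorem Forest.perm {l l' : List X} (hl : l.Perm l') : ∀ {c n : ℕ}, B.Forest i l c n →
    B.Forest i l' c n := by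
  induction hl with
  | nil => exact fun h => h
  | @cons Y l l' _ ih =>
    intro c n h
    obtain ⟨c₁, c₂, n₁, n₂, h1, h2, rfl, rfl⟩ := Forest.split (l₁ := [Y]) h
    exact h1.append (ih h2)
  | swap Y Z l =>
    intro c n h
    obtain ⟨c₁, c₂, n₁, n₂, h1, h2, rfl, rfl⟩ := Forest.split (l₁ := [Z]) h
    obtain ⟨c₂, c₃, n₂, n₃, h3, h4, rfl, rfl⟩ := Forest.split (l₁ := [Y]) h2
    have := h3.append (h1.append h4)
    rwa [Nat.add_left_comm c₂, Nat.add_left_comm n₂] at this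
  | trans _ _ ih₁ ih₂ => exact fun h => ih₂ (ih₁ h)

section Derives

variable [DecidableEq N] [DecidableEq W] [DecidableEq X] [DecidableEq E] [DecidableEq F]

theorem Derives.forest (hB : B.IsBESG) {H H' : LGraph N W X E F} {s : List (ℕ × ℕ)}
    (h : B.Derives H s H') (i : ℕ) : (H.verts.map Prod.fst).Nodup →
      ∃ n, B.Forest i H.nts ((s.map Prod.snd).count i) n := by
  induction h with
  | nil H => exact fun _ => ⟨0, by simpa using Forest.zero _⟩
  | @cons H H' v j p s hj hv h ih =>
    intro hH
    obtain ⟨n, hn⟩ :=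
      ih (nodup_subst hH (hB.isBedNCE.wellFormed p (List.mem_of_getElem? hj)).1)
    obtain ⟨l, hl, hl'⟩ := nts_subst hH hv
    rw [hl'] at hn
    refine ⟨n + 1, Forest.perm hl.symm ?_⟩
    have := (Forest.perm List.perm_append_comm hn).step hj
    simpa [List.count_cons] using this

/-- A derivation of the context-free grammar lifts to graphs, as a production can be applied to every
vertex labelled with its left-hand side, regardless of the edges. -/
theorem Forest.derives (hB : B.IsBESG) {l : List X} {c n : ℕ} (h : B.Forest i l c n) :
    ∀ H : LGraph N W X E F, (H.verts.map Prod.fst).Nodup → l.Subperm H.nts →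
      ∃ s H', B.Derives H s H' ∧ (s.map Prod.snd).count i = c := by
  induction h with
  | nil => exact fun H _ _ => ⟨[], H, .nil H, by simp⟩
  | skip _ ih => exact fun H hH hl => ih H hH ((List.sublist_cons_self _ _).subperm.trans hl)
  | @step j p l c n hj _ ih =>
    intro H hH hl
    obtain ⟨v, hv⟩ := mem_nts.1 (hl.subset List.mem_cons_self)
    obtain ⟨l', h1, h2⟩ := nts_subst hH hv
    have hll' : l.Subperm l' := (List.subperm_cons _).1 (hl.trans h1.subperm)
    obtain ⟨s, H', hs, hc⟩ := ih (H.subst v p)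
      (nodup_subst hH (hB.isBedNCE.wellFormed p (List.mem_of_getElem? hj)).1) (by
        rw [h2]
        exact ((List.subperm_append_left _).2 hll').trans List.perm_append_comm.subperm)
    exact ⟨(v, j) :: s, H', .cons hj hv hs, by simp [List.count_cons, hc]⟩

end Derives

/-- The numbers of uses of the production with index `i` in derivations from `Y`. -/
def useCounts (B : Grammar N W X E F) (i : ℕ) (Y : X) : Set ℕ := {c | ∃ n, B.Forest i [Y] c n}

theorem Forest.le_sSup {Y : X} (hY : BddAbove (B.useCounts i Y)) {c n : ℕ}
    (h : B.Forest i [Y] c n) : c ≤ sSup (B.useCounts i Y) :=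
  le_csSup hY ⟨n, h⟩

theorem sSup_useCounts_mem {Y : X} (hY : BddAbove (B.useCounts i Y)) :
    sSup (B.useCounts i Y) ∈ B.useCounts i Y :=
  Nat.sSup_mem ⟨0, 0, .zero _⟩ hY

theorem Forest.step_mem {j : ℕ} {p : Production N W X E F} (hj : B.productions[j]? = some p)
    {Z : X} (hZ : Z ∈ p.body.nts) {c n : ℕ} (h : B.Forest i [Z] c n) :
    ∃ n, B.Forest i [p.lhs] (c + if j = i then 1 else 0) n := by
  obtain ⟨l₁, l₂, hl⟩ := List.append_of_mem hZ
  refine ⟨_, Forest.step hj (n := n) ?_⟩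
  have := ((Forest.zero (B := B) (i := i) l₁).append h).append (.zero l₂)
  simpa [hl] using this

theorem Forest.le_mul {l : List X} {c n b : ℕ} (h : B.Forest i l c n)
    (hl : ∀ Y ∈ l, ∀ c n, B.Forest i [Y] c n → c ≤ b) : c ≤ l.length * b := by
  induction l generalizing c n with
  | nil => cases h; simp
  | cons Y l ih =>
    obtain ⟨c₁, c₂, n₁, n₂, h1, h2, rfl, rfl⟩ := Forest.split (l₁ := [Y]) h
    have := hl Y (by simp) _ _ h1
    have := ih h2 fun Z hZ => hl Z (by simp [hZ])
    rw [List.length_cons, add_mul]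
    omega

/-- If the largest number of uses of a production from `Y` is `v`, then it is bounded in terms of
the next smaller such number: in a shortest derivation that attains `v`, the body of the first
production has only nonterminals with smaller numbers. -/
theorem Forest.gap {m v b : ℕ} (hm : ∀ p ∈ B.productions, p.body.nts.length ≤ m)
    (hb : ∀ Z, BddAbove (B.useCounts i Z) → sSup (B.useCounts i Z) < v →
      sSup (B.useCounts i Z) ≤ b) (n : ℕ) : ∀ Y, BddAbove (B.useCounts i Y) →
      sSup (B.useCounts i Y) = v → B.Forest i [Y] v n → v ≤ m * b + 1 := by
  induction n using Nat.strong_induction_on with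
  | _ n ih =>
    intro Y hY hv h
    cases h with
    | skip h => cases h; simp
    | @step j p l c n hj h =>
      rw [List.append_nil] at h
      have hbdd : ∀ Z ∈ p.body.nts, BddAbove (B.useCounts i Z) := by
        rintro Z hZ
        obtain ⟨M, hM⟩ := hY
        refine ⟨M, ?_⟩
        rintro c ⟨n, hc⟩
        obtain ⟨n', h'⟩ := hc.step_mem hj hZ
        exact (Nat.le_add_right _ _).trans (hM ⟨n', h'⟩)
      by_cases hlt : ∀ Z ∈ p.body.nts, sSup (B.useCounts i Z) < c + if j = i then 1 else 0
      · have h1 : c ≤ p.body.nts.length * b := h.le_mul fun Z hZ c n hc =>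
          (hc.le_sSup (hbdd Z hZ)).trans (hb Z (hbdd Z hZ) (hlt Z hZ))
        have h2 : p.body.nts.length * b ≤ m * b :=
          Nat.mul_le_mul_right _ (hm p (List.mem_of_getElem? hj))
        split_ifs <;> omega
      · push Not at hlt
        obtain ⟨Z, hZ, hle⟩ := hlt
        obtain ⟨n', hn'⟩ := sSup_useCounts_mem (hbdd Z hZ)
        obtain ⟨l₁, l₂, hl⟩ := List.append_of_mem hZ
        rw [hl] at h
        obtain ⟨c₁, c', n₁, n₃, h1, h', rfl, rfl⟩ := h.split
        obtain ⟨c₂, c₃, n₂, n₃, h2, h3, rfl, rfl⟩ := Forest.split (l₁ := [Z]) h'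
        -- Replacing the part below `Z` by an optimal one shows that all uses come from `Z`.
        have h4 := Forest.step (l := []) hj
          (by rw [List.append_nil, hl]; exact h1.append (hn'.append h3))
        have h5 := h4.le_sSup hY
        rw [hv] at h5
        have h6 := h2.le_sSup (hbdd Z hZ)
        have h7 : c₂ = c₁ + (c₂ + c₃) + if j = i then 1 else 0 := by omega
        rw [← h7] at ih hle ⊢
        exact ih n₂ (by omega) Z (hbdd Z hZ) (by omega) h2

/-- By induction on the number `k` of nonterminals with a smaller maximal number of uses. -/
theorem sSup_useCounts_le [Finite X] {m : ℕ} (hm : ∀ p ∈ B.productions, p.body.nts.length ≤ m)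
    (k : ℕ) : ∀ Y, BddAbove (B.useCounts i Y) →
      {Z | BddAbove (B.useCounts i Z) ∧ sSup (B.useCounts i Z) < sSup (B.useCounts i Y)}.ncard ≤ k →
      sSup (B.useCounts i Y) ≤ (m + 1) ^ k := by
  induction k with
  | zero =>
    intro Y hY hk
    obtain ⟨n, hn⟩ := sSup_useCounts_mem hY
    have hempty := (Set.ncard_eq_zero (Set.toFinite _)).1 (Nat.le_zero.1 hk)
    have := Forest.gap hm (b := 0) (fun Z hZ hlt => by
      have : Z ∈ (∅ : Set X) := hempty ▸ ⟨hZ, hlt⟩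
      simp at this) n Y hY rfl hn
    simpa using this
  | succ k ih =>
    intro Y hY hk
    obtain ⟨n, hn⟩ := sSup_useCounts_mem hY
    have := Forest.gap hm (b := (m + 1) ^ k) (fun Z hZ hlt => by
      refine ih Z hZ (Nat.lt_succ_iff.1 (lt_of_lt_of_le ?_ hk))
      refine Set.ncard_lt_ncard ⟨fun V hV => ⟨hV.1, hV.2.trans hlt⟩, fun hsub => ?_⟩ (Set.toFinite _)
      exact lt_irrefl _ (hsub ⟨hZ, hlt⟩).2) n Y hY rfl hn
    refine this.trans ?_
    rw [pow_succ, mul_add, mul_one, mul_comm]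
    exact Nat.add_le_add_left (Nat.one_le_pow _ _ (Nat.succ_pos _)) _

/-- The number of vertices of all production bodies together. -/
def bodySize (B : Grammar N W X E F) : ℕ :=
  (B.productions.map fun p => p.body.verts.length).sum

theorem nts_length_le {p : Production N W X E F} (hp : p ∈ B.productions) :
    p.body.nts.length ≤ B.bodySize :=
  (List.length_filterMap_le _ _).trans
    (List.single_le_sum (fun _ _ => Nat.zero_le _) _ (List.mem_map_of_mem hp))

variable [DecidableEq N] [DecidableEq W] [DecidableEq X] [DecidableEq E] [DecidableEq F]

/-- A production that is used a bounded number of times is used at most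
`(B.bodySize + 1) ^ Nat.card X` times. -/
theorem Derives.count_le [Finite X] (hB : B.IsBESG)
    (hi : ∃ n : ℕ, ∀ s H, B.Derives B.startGraph s H → (s.map Prod.snd).count i ≤ n)
    {s : List (ℕ × ℕ)} {H : LGraph N W X E F} (hs : B.Derives B.startGraph s H) :
    (s.map Prod.snd).count i ≤ (B.bodySize + 1) ^ Nat.card X := by
  have hnd : (B.startGraph.verts.map Prod.fst).Nodup := by simp [startGraph]
  have hnts : B.startGraph.nts = [B.start] := by simp [startGraph, nts, VLabel.nonterminal?]
  have hbdd : BddAbove (B.useCounts i B.start) := by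
    obtain ⟨M, hM⟩ := hi
    refine ⟨M, ?_⟩
    rintro c ⟨n, hc⟩
    obtain ⟨s, H', hs, rfl⟩ := hc.derives hB B.startGraph hnd (by rw [hnts])
    exact hM s H' hs
  obtain ⟨n, hn⟩ := hs.forest hB i hnd
  rw [hnts] at hn
  refine (hn.le_sSup hbdd).trans (sSup_useCounts_le (fun p hp => nts_length_le hp) _ _ hbdd ?_)
  exact Set.ncard_le_card _

/-- A computable bound for the number of steps that use a production whose body has a bare wire. -/
theorem Derives.bareSteps_le [Finite X] (hB : B.IsBESG) (hM : B.IsMatchExhaustive)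
    {s : List (ℕ × ℕ)} {H : LGraph N W X E F} (hs : B.Derives B.startGraph s H) :
    B.bareSteps s ≤ B.productions.length * (B.bodySize + 1) ^ Nat.card X := by
  classical
  have key : ∀ s : List (ℕ × ℕ), B.bareSteps s ≤ ∑ i ∈ Finset.range B.productions.length,
      if ∃ p, B.productions[i]? = some p ∧ p.body.HasBareWire then (s.map Prod.snd).count i
        else 0 := by
    intro s
    induction s with
    | nil => simp [bareSteps]
    | cons q s ih =>
      by_cases hq : ∃ p, B.productions[q.2]? = some p ∧ p.body.HasBareWire
      · have hlt : q.2 < B.productions.length := by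
          obtain ⟨p, hp, -⟩ := hq
          exact (List.getElem?_eq_some_iff.1 hp).1
        have h1 : B.bareSteps (q :: s) = B.bareSteps s + 1 := by
          simp only [bareSteps, List.countP_cons, hq, decide_true, if_true]
        have h2 : ∑ i ∈ Finset.range B.productions.length, (if i = q.2 then 1 else 0) = 1 := by
          simp [hlt]
        rw [h1]
        refine (Nat.add_le_add_right ih 1).trans ?_
        nth_rw 1 [← h2]
        rw [← Finset.sum_add_distrib]
        refine Finset.sum_le_sum fun i _ => ?_
        by_cases hiq : i = q.2
        · subst hiq
          simp [hq]
        · simp only [hiq, if_false, add_zero, List.map_cons]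
          split_ifs
          · exact List.count_le_count_cons
          · exact le_rfl
      · have h1 : B.bareSteps (q :: s) = B.bareSteps s := by
          simp only [bareSteps, List.countP_cons, hq, decide_false]
          simp
        rw [h1]
        refine ih.trans (Finset.sum_le_sum fun i _ => ?_)
        split_ifs
        · exact List.count_le_count_cons
        · exact le_rfl
  refine (key s).trans ((Finset.sum_le_card_nsmul _ _ ((B.bodySize + 1) ^ Nat.card X) ?_).trans
    (by simp))
  intro i _
  split_ifs with h
  · obtain ⟨p, hp, hbare⟩ := h
    exact hs.count_le hB (hM.bare_bounded i p hp hbare)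
  · exact Nat.zero_le _

end Grammar

namespace LGraph

variable {N W X E F : Type*}

/-! ### Invariants of wire-homeomorphism -/

/-- There is an edge from `x` to `y`, and both are wire-vertices with the same label. -/
def Mono (G : LGraph N W X E F) (x y : ℕ) : Prop :=
  ∃ w γ, (x, VLabel.wire w) ∈ G.verts ∧ (y, VLabel.wire w) ∈ G.verts ∧ (x, γ, y) ∈ G.edges

/-- `x` and `y` lie on the same segment: they are connected by edges between equally labelled
wire-vertices. Merging contracts segments, up to the limit that a circle keeps two vertices. -/
def Segment (G : LGraph N W X E F) : ℕ → ℕ → Prop := Relation.EqvGen G.Mono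

/-- The segment of `x` has a last vertex; otherwise it is a circle. -/
def HasEnd (G : LGraph N W X E F) (x : ℕ) : Prop := ∃ z, G.Segment z x ∧ ∀ t, ¬ G.Mono z t

theorem Segment.refl (G : LGraph N W X E F) (x : ℕ) : G.Segment x x :=
  Relation.EqvGen.refl x

theorem Segment.symm {G : LGraph N W X E F} {x y : ℕ} (h : G.Segment x y) : G.Segment y x :=
  Relation.EqvGen.symm _ _ h

theorem Segment.trans {G : LGraph N W X E F} {x y z : ℕ} (h : G.Segment x y)
    (h' : G.Segment y z) : G.Segment x z :=
  Relation.EqvGen.trans _ _ _ h h'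

theorem Mono.segment {G : LGraph N W X E F} {x y : ℕ} (h : G.Mono x y) : G.Segment x y :=
  .rel _ _ h

theorem Segment.mem_verts {G : LGraph N W X E F} (hG : (G.verts.map Prod.fst).Nodup) {x y : ℕ}
    (h : G.Segment x y) (σ : VLabel N W X) : (x, σ) ∈ G.verts ↔ (y, σ) ∈ G.verts := by
  induction h with
  | rel x y h =>
    obtain ⟨w, γ, hx, hy, -⟩ := h
    exact ⟨fun h => label_unique hG hx h ▸ hy, fun h => label_unique hG hy h ▸ hx⟩
  | refl => rfl
  | symm _ _ _ ih => exact ih.symm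
  | trans _ _ _ _ _ ih₁ ih₂ => exact ih₁.trans ih₂

theorem Segment.eq_or_isVertex {G : LGraph N W X E F} {x y : ℕ} (h : G.Segment x y) :
    x = y ∨ G.IsVertex x ∧ G.IsVertex y := by
  induction h with
  | rel x y h =>
    obtain ⟨w, γ, hx, hy, -⟩ := h
    exact .inr ⟨⟨_, hx⟩, ⟨_, hy⟩⟩
  | refl => exact .inl rfl
  | symm _ _ _ ih => exact ih.imp Eq.symm And.symm
  | trans x y z _ _ ih₁ ih₂ =>
    rcases ih₁ with rfl | h1
    · exact ih₂
    · rcases ih₂ with rfl | h2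
      · exact .inr h1
      · exact .inr ⟨h1.1, h2.2⟩

theorem Mono.ne {G : LGraph N W X E F} (hG : G.IsStringGraph) {x y : ℕ} (h : G.Mono x y) :
    x ≠ y := by
  obtain ⟨w, γ, -, -, he⟩ := h
  exact (hG.wellFormed.2 _ _ _ he).2.2

theorem Mono.right_unique {G : LGraph N W X E F} (hG : G.IsStringGraph) {x y : ℕ}
    (h : G.Mono x y) {γ : ELabel E F} {z : ℕ} (hz : (x, γ, z) ∈ G.edges) : z = y := by
  obtain ⟨w, δ, hx, -, he⟩ := h
  exact ((hG.wire_degrees x ⟨w, hx⟩).2 _ _ _ _ hz he).1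

theorem Mono.left_unique {G : LGraph N W X E F} (hG : G.IsStringGraph) {x y : ℕ}
    (h : G.Mono x y) {γ : ELabel E F} {z : ℕ} (hz : (z, γ, y) ∈ G.edges) : z = x := by
  obtain ⟨w, δ, -, hy, he⟩ := h
  exact ((hG.wire_degrees y ⟨w, hy⟩).1 _ _ _ _ hz he).1

/-- `ρ` induces a bijection between the segments of `G` and those of `G'` that preserves labels,
the edges between different segments, and the distinction between paths and circles. -/
structure IsSim (G G' : LGraph N W X E F) (ρ : ℕ → ℕ → Prop) : Prop where
  label : ∀ x y, ρ x y → ∃ σ, (x, σ) ∈ G.verts ∧ (y, σ) ∈ G'.verts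
  total : ∀ x, G.IsVertex x → ∃ y, ρ x y
  surj : ∀ y, G'.IsVertex y → ∃ x, ρ x y
  segment : ∀ x y x' y', ρ x y → ρ x' y' → (G.Segment x x' ↔ G'.Segment y y')
  edge : ∀ x γ x', (x, γ, x') ∈ G.edges → ¬ G.Mono x x' →
    ∃ y y', ρ x y ∧ ρ x' y' ∧ (y, γ, y') ∈ G'.edges ∧ ¬ G'.Mono y y'
  edge' : ∀ y γ y', (y, γ, y') ∈ G'.edges → ¬ G'.Mono y y' →
    ∃ x x', ρ x y ∧ ρ x' y' ∧ (x, γ, x') ∈ G.edges ∧ ¬ G.Mono x x'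
  hasEnd : ∀ x y, ρ x y → (G.HasEnd x ↔ G'.HasEnd y)

theorem IsSim.flip {G G' : LGraph N W X E F} {ρ : ℕ → ℕ → Prop} (h : IsSim G G' ρ) :
    IsSim G' G (flip ρ) where
  label x y hxy := let ⟨σ, h1, h2⟩ := h.label y x hxy; ⟨σ, h2, h1⟩
  total := h.surj
  surj := h.total
  segment _ _ _ _ h1 h2 := (h.segment _ _ _ _ h1 h2).symm
  edge := h.edge'
  edge' := h.edge
  hasEnd x y hxy := (h.hasEnd y x hxy).symm

/-- Simulations compose, since every vertex of the middle graph has only one label. -/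
theorem IsSim.comp {G G' G'' : LGraph N W X E F} {ρ ρ' : ℕ → ℕ → Prop} (h : IsSim G G' ρ)
    (h' : IsSim G' G'' ρ') (hG' : (G'.verts.map Prod.fst).Nodup) :
    IsSim G G'' (Relation.Comp ρ ρ') where
  label := by
    rintro x z ⟨y, h1, h2⟩
    obtain ⟨σ, hx, hy⟩ := h.label x y h1
    obtain ⟨τ, hy', hz⟩ := h'.label y z h2
    exact ⟨σ, hx, label_unique hG' hy hy' ▸ hz⟩
  total x hx := by
    obtain ⟨y, hy⟩ := h.total x hx
    obtain ⟨σ, -, hσ⟩ := h.label x y hy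
    obtain ⟨z, hz⟩ := h'.total y ⟨σ, hσ⟩
    exact ⟨z, y, hy, hz⟩
  surj z hz := by
    obtain ⟨y, hy⟩ := h'.surj z hz
    obtain ⟨σ, hσ, -⟩ := h'.label y z hy
    obtain ⟨x, hx⟩ := h.surj y ⟨σ, hσ⟩
    exact ⟨x, y, hx, hy⟩
  segment := by
    rintro x z x' z' ⟨y, h1, h2⟩ ⟨y', h3, h4⟩
    exact (h.segment _ _ _ _ h1 h3).trans (h'.segment _ _ _ _ h2 h4)
  edge x γ x' he hm := by
    obtain ⟨y, y', h1, h2, h3, h4⟩ := h.edge x γ x' he hm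
    obtain ⟨z, z', h5, h6, h7, h8⟩ := h'.edge y γ y' h3 h4
    exact ⟨z, z', ⟨y, h1, h5⟩, ⟨y', h2, h6⟩, h7, h8⟩
  edge' z γ z' he hm := by
    obtain ⟨y, y', h1, h2, h3, h4⟩ := h'.edge' z γ z' he hm
    obtain ⟨x, x', h5, h6, h7, h8⟩ := h.edge' y γ y' h3 h4
    exact ⟨x, x', ⟨y, h5, h1⟩, ⟨y', h6, h2⟩, h7, h8⟩
  hasEnd := by
    rintro x z ⟨y, h1, h2⟩
    exact (h.hasEnd x y h1).trans (h'.hasEnd y z h2)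

theorem Iso.mono_iff {G G' : LGraph N W X E F} {φ : ℕ ≃ ℕ}
    (hv : ∀ x σ, (x, σ) ∈ G.verts ↔ (φ x, σ) ∈ G'.verts)
    (he : ∀ x γ y, (x, γ, y) ∈ G.edges ↔ (φ x, γ, φ y) ∈ G'.edges) (x y : ℕ) :
    G.Mono x y ↔ G'.Mono (φ x) (φ y) := by
  simp only [Mono, hv, he]

theorem Iso.segment_iff {G G' : LGraph N W X E F} {φ : ℕ ≃ ℕ}
    (hm : ∀ x y, G.Mono x y ↔ G'.Mono (φ x) (φ y)) (x y : ℕ) :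
    G.Segment x y ↔ G'.Segment (φ x) (φ y) := by
  constructor
  · intro h
    induction h with
    | rel x y h => exact Mono.segment ((hm x y).1 h)
    | refl => exact .refl _ _
    | symm _ _ _ ih => exact ih.symm
    | trans _ _ _ _ _ ih₁ ih₂ => exact ih₁.trans ih₂
  · suffices ∀ x' y', G'.Segment x' y' → G.Segment (φ.symm x') (φ.symm y') by
      simpa using this (φ x) (φ y)
    intro x' y' h
    induction h with
    | rel x y h => exact Mono.segment ((hm _ _).2 (by simpa using h))
    | refl => exact .refl _ _
    | symm _ _ _ ih => exact ih.symm
    | trans _ _ _ _ _ ih₁ ih₂ => exact ih₁.trans ih₂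

theorem Iso.exists_isSim {G G' : LGraph N W X E F} (h : G.Iso G') (hG : G.IsStringGraph) :
    ∃ ρ, IsSim G G' ρ := by
  obtain ⟨φ, hv, he⟩ := h
  have hm := Iso.mono_iff hv he
  have hs := Iso.segment_iff hm
  refine ⟨fun x y => G.IsVertex x ∧ φ x = y, ?_, fun x hx => ⟨_, hx, rfl⟩, ?_, ?_, ?_, ?_, ?_⟩
  · rintro x _ ⟨⟨σ, hσ⟩, rfl⟩
    exact ⟨σ, hσ, (hv x σ).1 hσ⟩
  · rintro y ⟨σ, hσ⟩
    exact ⟨φ.symm y, ⟨σ, (hv _ _).2 (by simpa using hσ)⟩, by simp⟩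
  · rintro x _ x' _ ⟨-, rfl⟩ ⟨-, rfl⟩
    exact hs x x'
  · intro x γ x' h hx
    obtain ⟨h1, h2, -⟩ := hG.wellFormed.2 _ _ _ h
    exact ⟨φ x, φ x', ⟨h1, rfl⟩, ⟨h2, rfl⟩, (he _ _ _).1 h, fun h => hx ((hm _ _).2 h)⟩
  · intro y γ y' h hy
    have h' : (φ.symm y, γ, φ.symm y') ∈ G.edges := (he _ _ _).2 (by simpa using h)
    obtain ⟨h1, h2, -⟩ := hG.wellFormed.2 _ _ _ h'
    exact ⟨φ.symm y, φ.symm y', ⟨h1, by simp⟩, ⟨h2, by simp⟩, h', fun h => hy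
      (by simpa using (hm _ _).1 h)⟩
  · rintro x _ ⟨-, rfl⟩
    constructor
    · rintro ⟨z, h1, h2⟩
      refine ⟨φ z, (hs _ _).1 h1, fun t ht => h2 (φ.symm t) ((hm _ _).2 (by simpa using ht))⟩
    · rintro ⟨z, h1, h2⟩
      refine ⟨φ.symm z, (hs _ _).2 (by simpa using h1), fun t ht => h2 (φ t) ?_⟩
      simpa using (hm _ _).1 ht

/-- A contraction induces a bijection of segments, as the two contracted vertices belong to the same
segment. -/
theorem Contracts.isSim {G G' : LGraph N W X E F} {c d : ℕ} {q : ℕ → ℕ}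
    (h : Contracts G G' c d q) (hG : G.IsStringGraph) (hG' : G'.IsStringGraph) :
    IsSim G G' fun x y => G.IsVertex x ∧ q x = y := by
  obtain ⟨w, hcw, hdw⟩ := h.wire
  obtain ⟨γ₀, hcd⟩ := h.edge
  have hcdm : G.Mono c d := ⟨w, γ₀, hcw, hdw, hcd⟩
  have hlab : ∀ x σ, G.IsVertex x → (q x, σ) ∈ G'.verts → (x, σ) ∈ G.verts := by
    rintro x σ ⟨τ, h1⟩ h2
    rwa [← label_unique hG'.wellFormed.1 (h.map_vert _ _ h1) h2]
  have hmono : ∀ x y, G.Mono x y → ¬ (x = c ∧ y = d) → G'.Mono (q x) (q y) := by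
    rintro x y ⟨v, γ, hx, hy, he⟩ hne
    exact ⟨v, γ, h.map_vert _ _ hx, h.map_vert _ _ hy,
      (h.mem_edges _ _ _).2 ⟨x, y, he, hne, rfl, rfl⟩⟩
  have hmono' : ∀ y y', G'.Mono y y' →
      ∃ x x', G.Mono x x' ∧ ¬ (x = c ∧ x' = d) ∧ q x = y ∧ q x' = y' := by
    rintro y y' ⟨v, γ, hy, hy', he⟩
    obtain ⟨x, x', h1, h2, rfl, rfl⟩ := (h.mem_edges _ _ _).1 he
    obtain ⟨hx, hx', -⟩ := hG.wellFormed.2 _ _ _ h1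
    exact ⟨x, x', ⟨v, γ, hlab x _ hx hy, hlab x' _ hx' hy', h1⟩, h2, rfl, rfl⟩
  have hq : ∀ x y, q x = q y → G.IsVertex x → G.IsVertex y → G.Segment x y := by
    intro x y hxy hx hy
    rcases h.inj x y hxy hx hy with rfl | ⟨rfl, rfl⟩ | ⟨rfl, rfl⟩
    · exact .refl _ _
    · exact hcdm.segment
    · exact hcdm.segment.symm
  have hmv : ∀ x y, G.Mono x y → G.IsVertex x ∧ G.IsVertex y := fun x y ⟨v, γ, hx, hy, he⟩ =>
    ⟨⟨_, hx⟩, ⟨_, hy⟩⟩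
  have hseg : ∀ x x', G.Segment x x' → G'.Segment (q x) (q x') := by
    intro x x' hxx
    induction hxx with
    | rel x y hxy =>
      by_cases hcd : x = c ∧ y = d
      · obtain ⟨rfl, rfl⟩ := hcd
        rw [h.eq]
        exact .refl _ _
      · exact (hmono x y hxy hcd).segment
    | refl => exact .refl _ _
    | symm _ _ _ ih => exact ih.symm
    | trans _ _ _ _ _ ih₁ ih₂ => exact ih₁.trans ih₂
  have hseg' : ∀ y y', G'.Segment y y' → ∀ x x', G.IsVertex x → G.IsVertex x' → q x = y →
      q x' = y' → G.Segment x x' := by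
    intro y y' hyy
    induction hyy with
    | rel y y' hy =>
      rintro x x' hx hx' rfl rfl
      obtain ⟨z, z', hz, -, h1, h2⟩ := hmono' _ _ hy
      exact (hq x z h1.symm hx (hmv _ _ hz).1).trans
        (hz.segment.trans (hq z' x' h2 (hmv _ _ hz).2 hx'))
    | refl y =>
      rintro x x' hx hx' rfl hxx
      exact hq x x' hxx.symm hx hx'
    | symm y y' _ ih => exact fun x x' hx hx' h1 h2 => (ih x' x hx' hx h2 h1).symm
    | trans y y' y'' h1 _ ih₁ ih₂ =>
      intro x x' hx hx' hxy hxy'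
      rcases Segment.eq_or_isVertex h1 with rfl | ⟨-, σ, hσ⟩
      · exact ih₂ x x' hx hx' hxy hxy'
      · obtain ⟨z, hz, hzy⟩ := h.exists_vert _ _ hσ
        exact (ih₁ x z hx ⟨_, hz⟩ hxy hzy).trans (ih₂ z x' ⟨_, hz⟩ hx' hzy hxy')
  refine ⟨?_, fun x hx => ⟨_, hx, rfl⟩, ?_, ?_, ?_, ?_, ?_⟩
  · rintro x _ ⟨⟨σ, hσ⟩, rfl⟩
    exact ⟨σ, hσ, h.map_vert _ _ hσ⟩
  · rintro y ⟨σ, hσ⟩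
    obtain ⟨x, hx, rfl⟩ := h.exists_vert y σ hσ
    exact ⟨x, ⟨_, hx⟩, rfl⟩
  · rintro x _ x' _ ⟨hx, rfl⟩ ⟨hx', rfl⟩
    exact ⟨hseg x x', fun h => hseg' _ _ h x x' hx hx' rfl rfl⟩
  · intro x γ x' he hm
    obtain ⟨hx, hx', -⟩ := hG.wellFormed.2 _ _ _ he
    refine ⟨q x, q x', ⟨hx, rfl⟩, ⟨hx', rfl⟩, (h.mem_edges _ _ _).2 ⟨x, x', he, ?_, rfl, rfl⟩, ?_⟩
    · rintro ⟨rfl, rfl⟩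
      exact hm hcdm
    · rintro ⟨v, δ, h1, h2, -⟩
      exact hm ⟨v, γ, hlab x _ hx h1, hlab x' _ hx' h2, he⟩
  · intro y γ y' he hm
    obtain ⟨x, x', h1, h2, rfl, rfl⟩ := (h.mem_edges _ _ _).1 he
    obtain ⟨hx, hx', -⟩ := hG.wellFormed.2 _ _ _ h1
    exact ⟨x, x', ⟨hx, rfl⟩, ⟨hx', rfl⟩, h1, fun hxx => hm (hmono _ _ hxx h2)⟩
  · rintro x _ ⟨hx, rfl⟩
    constructor
    · rintro ⟨z, hz, hend⟩
      refine ⟨q z, hseg _ _ hz, fun t ht => ?_⟩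
      have hzv : G.IsVertex z := by
        rcases hz.eq_or_isVertex with rfl | hz
        · exact hx
        · exact hz.1
      obtain ⟨x₀, x₁, hm, hne, h1, -⟩ := hmono' _ _ ht
      rcases h.inj x₀ z h1 (hmv _ _ hm).1 hzv with rfl | ⟨rfl, rfl⟩ | ⟨rfl, rfl⟩
      · exact hend _ hm
      · obtain ⟨v, γ, -, -, he⟩ := hm
        exact hne ⟨rfl, hcdm.right_unique hG he⟩
      · exact hend _ hcdm
    · rintro ⟨z', hz, hend⟩
      have hzv : G'.IsVertex z' := by
        rcases hz.eq_or_isVertex with rfl | hz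
        · exact ⟨_, h.map_vert _ _ hx.choose_spec⟩
        · exact hz.1
      obtain ⟨σ, hσ⟩ := hzv
      obtain ⟨z, hzc, hzv, rfl⟩ : ∃ z, z ≠ c ∧ G.IsVertex z ∧ q z = z' := by
        obtain ⟨z, hz₁, rfl⟩ := h.exists_vert _ _ hσ
        by_cases hzc : z = c
        · exact ⟨d, h.ne.symm, ⟨_, hdw⟩, by rw [hzc, h.eq]⟩
        · exact ⟨z, hzc, ⟨_, hz₁⟩, rfl⟩
      exact ⟨z, hseg' _ _ hz z x hzv hx rfl rfl, fun t ht =>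
        hend _ (hmono _ _ ht fun h => hzc h.1)⟩

theorem WireHomeomorphic.isStringGraph_iff {G G' : LGraph N W X E F}
    (h : G.WireHomeomorphic G') : G.IsStringGraph ↔ G'.IsStringGraph := by
  induction h with
  | rel _ _ h => exact ⟨fun _ => h.2.1, fun _ => h.1⟩
  | refl => rfl
  | symm _ _ _ ih => exact ih.symm
  | trans _ _ _ _ _ ih₁ ih₂ => exact ih₁.trans ih₂

theorem WireHomeomorphic.exists_isSim {G G' : LGraph N W X E F} (h : G.WireHomeomorphic G') :
    G.IsStringGraph → ∃ ρ, IsSim G G' ρ := by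
  induction h with
  | rel G G' h =>
    obtain ⟨hG, hG', h | h⟩ := h
    · exact h.exists_isSim
    · obtain ⟨a, b, h⟩ := h.contracts hG
      exact fun _ => ⟨_, h.isSim hG hG'⟩
  | refl G => exact Iso.exists_isSim ⟨Equiv.refl ℕ, by simp, by simp⟩
  | symm G G' h ih =>
    intro hG'
    obtain ⟨ρ, hρ⟩ := ih ((WireHomeomorphic.isStringGraph_iff h).2 hG')
    exact ⟨_, hρ.flip⟩
  | trans G G' G'' h₁ _ ih₁ ih₂ =>
    intro hG
    have hG' := (WireHomeomorphic.isStringGraph_iff h₁).1 hG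
    obtain ⟨ρ, hρ⟩ := ih₁ hG
    obtain ⟨ρ', hρ'⟩ := ih₂ hG'
    exact ⟨_, hρ.comp hρ' hG'.wellFormed.1⟩

/-! ### Normal forms -/

/-- The graph in which the edges from `a` to `b` are contracted to the vertex `a`. -/
def mergeGraph (G : LGraph N W X E F) (a b : ℕ) : LGraph N W X E F where
  verts := G.verts.filter fun q => q.1 ≠ b
  edges := (G.edges.filter fun e => ¬ (e.1 = a ∧ e.2.2 = b)).map fun e =>
    (if e.1 = b then a else e.1, e.2.1, if e.2.2 = b then a else e.2.2)

theorem mem_mergeGraph_verts {G : LGraph N W X E F} {a b x : ℕ} {σ : VLabel N W X} :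
    (x, σ) ∈ (G.mergeGraph a b).verts ↔ (x, σ) ∈ G.verts ∧ x ≠ b := by
  simp [mergeGraph]

theorem mem_mergeGraph_edges {G : LGraph N W X E F} {a b x y : ℕ} {γ : ELabel E F} :
    (x, γ, y) ∈ (G.mergeGraph a b).edges ↔
      ∃ x' y', (x', γ, y') ∈ G.edges ∧ ¬ (x' = a ∧ y' = b) ∧
        x = (if x' = b then a else x') ∧ y = (if y' = b then a else y') := by
  simp only [mergeGraph, List.mem_map, List.mem_filter, Prod.exists, Prod.mk.injEq,
    decide_eq_true_eq]
  constructor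
  · rintro ⟨x', δ, y', ⟨h1, h2⟩, rfl, rfl, rfl⟩
    exact ⟨x', y', h1, h2, rfl, rfl⟩
  · rintro ⟨x', y', h1, h2, rfl, rfl⟩
    exact ⟨x', γ, y', ⟨h1, h2⟩, rfl, rfl, rfl⟩

theorem merge_mergeGraph {G : LGraph N W X E F} (hG : G.IsStringGraph) {a b : ℕ}
    (h : G.Mono a b) : G.Merge (G.mergeGraph a b) := by
  have hne := h.ne hG
  obtain ⟨w, γ, ha, hb, he⟩ := h
  exact ⟨a, b, γ, w, ha, hb, hne, he, fun x σ => mem_mergeGraph_verts,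
    fun x γ y => mem_mergeGraph_edges⟩

/-- Two adjacent equally labelled wire-vertices can be merged unless they form a circle. -/
theorem isStringGraph_mergeGraph {G : LGraph N W X E F} (hG : G.IsStringGraph) {a b : ℕ}
    (h : G.Mono a b) (h' : ¬ G.Mono b a) : (G.mergeGraph a b).IsStringGraph := by
  have hne := h.ne hG
  have hout : ∀ γ z, (a, γ, z) ∈ G.edges → z = b := fun γ z hz => h.right_unique hG hz
  have hin : ∀ γ z, (z, γ, b) ∈ G.edges → z = a := fun γ z hz => h.left_unique hG hz
  obtain ⟨w, γ₀, ha, hb, he⟩ := h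
  have hba : ∀ γ, (b, γ, a) ∉ G.edges := fun γ hγ => h' ⟨w, γ, hb, ha, hγ⟩
  have hvert : ∀ x, G.IsVertex x → (G.mergeGraph a b).IsVertex (if x = b then a else x) := by
    rintro x ⟨σ, hσ⟩
    by_cases hx : x = b
    · exact ⟨.wire w, by simpa [hx] using mem_mergeGraph_verts.2 ⟨ha, hne⟩⟩
    · exact ⟨σ, by simpa [hx] using mem_mergeGraph_verts.2 ⟨hσ, hx⟩⟩
  -- A vertex of the merged graph has the same label as all vertices from which it comes.
  have hlab : ∀ x σ, G.IsVertex x → ((if x = b then a else x), σ) ∈ (G.mergeGraph a b).verts →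
      (x, σ) ∈ G.verts := by
    intro x σ hx hσ
    by_cases hxb : x = b
    · subst hxb
      have := (mem_mergeGraph_verts.1 hσ).1
      rw [if_pos rfl] at this
      rwa [label_unique hG.wellFormed.1 this ha]
    · rw [if_neg hxb] at hσ
      exact (mem_mergeGraph_verts.1 hσ).1
  refine ⟨⟨hG.wellFormed.1.sublist (List.filter_sublist.map _), ?_⟩, ?_, ?_, ?_, ?_⟩
  · intro x γ y hxy
    obtain ⟨x', y', h1, h2, rfl, rfl⟩ := mem_mergeGraph_edges.1 hxy
    obtain ⟨hx, hy, hxy⟩ := hG.wellFormed.2 _ _ _ h1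
    refine ⟨hvert x' hx, hvert y' hy, ?_⟩
    have := hba γ
    grind
  · rintro x ⟨Y, hY⟩
    exact hG.no_nonterminal x ⟨Y, (mem_mergeGraph_verts.1 hY).1⟩
  · intro x α y hxy
    obtain ⟨x', y', h1, -⟩ := mem_mergeGraph_edges.1 hxy
    exact hG.no_enc _ _ _ h1
  · rintro x γ y hxy ⟨⟨n, hn⟩, m, hm⟩
    obtain ⟨x', y', h1, h2, rfl, rfl⟩ := mem_mergeGraph_edges.1 hxy
    obtain ⟨hx, hy, -⟩ := hG.wellFormed.2 _ _ _ h1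
    exact hG.no_node_node _ _ _ h1 ⟨⟨n, hlab _ _ hx hn⟩, m, hlab _ _ hy hm⟩
  · rintro z ⟨v, hz⟩
    constructor
    · intro x γ x' γ' h1 h2
      obtain ⟨x₁, y₁, h6, h3, rfl, rfl⟩ := mem_mergeGraph_edges.1 h1
      obtain ⟨x₂, y₂, h7, h4, rfl, h5⟩ := mem_mergeGraph_edges.1 h2
      have hw : G.IsWire y₁ := ⟨v, hlab _ _ (hG.wellFormed.2 _ _ _ h6).2.1 hz⟩
      have : y₁ = y₂ := by
        have := hin γ x₁
        have := hin γ' x₂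
        grind
      subst this
      obtain ⟨rfl, rfl⟩ := (hG.wire_degrees _ hw).1 _ _ _ _ h6 h7
      exact ⟨rfl, rfl⟩
    · intro y γ y' γ' h1 h2
      obtain ⟨x₁, y₁, h6, h3, rfl, rfl⟩ := mem_mergeGraph_edges.1 h1
      obtain ⟨x₂, y₂, h7, h4, h5, rfl⟩ := mem_mergeGraph_edges.1 h2
      have hw : G.IsWire x₁ := ⟨v, hlab _ _ (hG.wellFormed.2 _ _ _ h6).1 hz⟩
      have : x₁ = x₂ := by
        have := hout γ y₁
        have := hout γ' y₂
        grind
      subst this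
      obtain ⟨rfl, rfl⟩ := (hG.wire_degrees _ hw).2 _ _ _ _ h6 h7
      exact ⟨rfl, rfl⟩

theorem wireHomeomorphic_mergeGraph {G : LGraph N W X E F} (hG : G.IsStringGraph) {a b : ℕ}
    (h : G.Mono a b) (h' : ¬ G.Mono b a) : G.WireHomeomorphic (G.mergeGraph a b) :=
  .rel _ _ ⟨hG, isStringGraph_mergeGraph hG h h', .inr (merge_mergeGraph hG h)⟩

theorem length_mergeGraph_lt {G : LGraph N W X E F} {a b : ℕ} (h : G.Mono a b) :
    (G.mergeGraph a b).verts.length < G.verts.length := by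
  obtain ⟨w, γ, -, hb, -⟩ := h
  exact List.length_filter_lt_length_iff_exists.2 ⟨_, hb, by simp⟩

/-- All edges inside of segments have one and the same label, chosen once and for all. -/
def Standard (G : LGraph N W X E F) : Prop :=
  ∀ a γ b, G.Mono a b → (a, γ, b) ∈ G.edges →
    ∃ h : Nonempty F, γ = ELabel.plain (Classical.choice h)

/-- Every segment is a single vertex or a circle of two vertices. -/
def Reduced (G : LGraph N W X E F) : Prop := ∀ a b, G.Mono a b → G.Mono b a

theorem Standard.mergeGraph {G : LGraph N W X E F} (hG : G.IsStringGraph) (hs : G.Standard)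
    {a b : ℕ} (h : G.Mono a b) (h' : ¬ G.Mono b a) : (G.mergeGraph a b).Standard := by
  intro x γ y hxy he
  obtain ⟨x', y', h1, h2, rfl, rfl⟩ := mem_mergeGraph_edges.1 he
  refine hs x' γ y' ?_ h1
  obtain ⟨w, δ, hx, hy, -⟩ := hxy
  obtain ⟨v, -, ha, hb, -⟩ := h
  obtain ⟨⟨σ, hσ⟩, ⟨τ, hτ⟩, -⟩ := hG.wellFormed.2 _ _ _ h1
  have hlab : ∀ x σ, (x, σ) ∈ G.verts →
      ((if x = b then a else x), VLabel.wire w) ∈ (G.mergeGraph a b).verts →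
      (x, VLabel.wire w) ∈ G.verts := by
    intro x σ hx hσ
    by_cases hxb : x = b
    · subst hxb
      have := (mem_mergeGraph_verts.1 hσ).1
      rw [if_pos rfl] at this
      rwa [label_unique hG.wellFormed.1 this ha]
    · rw [if_neg hxb] at hσ
      exact (mem_mergeGraph_verts.1 hσ).1
  exact ⟨w, γ, hlab _ _ hσ hx, hlab _ _ hτ hy, h1⟩

/-- Merging as long as possible makes a standard graph reduced; `n` is the number of its vertices. -/
theorem Standard.exists_reduced (n : ℕ) : ∀ G : LGraph N W X E F, G.verts.length = n →
    G.IsStringGraph → G.Standard →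
    ∃ G', G'.IsStringGraph ∧ G.WireHomeomorphic G' ∧ G'.Standard ∧ G'.Reduced := by
  induction n using Nat.strong_induction_on with
  | _ n ih =>
    rintro G rfl hG hs
    by_cases hr : G.Reduced
    · exact ⟨G, hG, .refl _, hs, hr⟩
    · simp only [Reduced, not_forall] at hr
      obtain ⟨a, b, h, h'⟩ := hr
      obtain ⟨G', h1, h2, h3⟩ := ih _ (length_mergeGraph_lt h) _ rfl
        (isStringGraph_mergeGraph hG h h') (hs.mergeGraph hG h h')
      exact ⟨G', h1, .trans _ _ _ (wireHomeomorphic_mergeGraph hG h h') h2, h3⟩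

section Subdivide

open scoped Classical in
/-- The edge labelled `γ` from `x` to `y` is subdivided by the vertex `c` with label `w`, where
the first half of it gets the label `δ`. -/
noncomputable def subdivide (G : LGraph N W X E F) (x : ℕ) (γ : ELabel E F) (y c : ℕ) (w : W)
    (δ : ELabel E F) : LGraph N W X E F where
  verts := G.verts ++ [(c, .wire w)]
  edges := G.edges.filter (fun e => e ≠ (x, γ, y)) ++ [(x, δ, c), (c, γ, y)]

variable {G : LGraph N W X E F} {x y c : ℕ} {γ : ELabel E F} {w : W} {f : F}

theorem isStringGraph_subdivide (hG : G.IsStringGraph) (hx : (x, VLabel.wire w) ∈ G.verts)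
    (hy : (y, VLabel.wire w) ∈ G.verts) (he : (x, γ, y) ∈ G.edges) (hc : ¬ G.IsVertex c) :
    (G.subdivide x γ y c w (.plain f)).IsStringGraph := by
  have hxc : x ≠ c := by rintro rfl; exact hc ⟨_, hx⟩
  have hyc : y ≠ c := by rintro rfl; exact hc ⟨_, hy⟩
  have hcv : ∀ σ, (c, σ) ∉ G.verts := fun σ h => hc ⟨σ, h⟩
  have hdx : ∀ γ' z, (x, γ', z) ∈ G.edges → z = y ∧ γ' = γ := fun γ' z hz =>
    (hG.wire_degrees x ⟨w, hx⟩).2 _ _ _ _ hz he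
  have hdy : ∀ γ' z, (z, γ', y) ∈ G.edges → z = x ∧ γ' = γ := fun γ' z hz =>
    (hG.wire_degrees y ⟨w, hy⟩).1 _ _ _ _ hz he
  have hev : ∀ a γ' b, (a, γ', b) ∈ G.edges → a ≠ c ∧ b ≠ c := fun a γ' b h => by
    obtain ⟨h1, h2, -⟩ := hG.wellFormed.2 _ _ _ h
    exact ⟨fun h => hc (h ▸ h1), fun h => hc (h ▸ h2)⟩
  have hedge : ∀ a γ' b, (a, γ', b) ∈ (G.subdivide x γ y c w (.plain f)).edges ↔
      ((a, γ', b) ∈ G.edges ∧ ¬ (a = x ∧ γ' = γ ∧ b = y)) ∨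
        (a = x ∧ γ' = .plain f ∧ b = c) ∨ (a = c ∧ γ' = γ ∧ b = y) := by
    intro a γ' b
    simp [subdivide]
  have hvert : ∀ a σ, (a, σ) ∈ (G.subdivide x γ y c w (.plain f)).verts ↔
      (a, σ) ∈ G.verts ∨ (a = c ∧ σ = .wire w) := by
    intro a σ
    simp [subdivide]
  have hnode : ∀ a, (G.subdivide x γ y c w (.plain f)).IsNode a → G.IsNode a := by
    rintro a ⟨n, hn⟩
    rcases (hvert _ _).1 hn with h | ⟨-, h⟩
    · exact ⟨n, h⟩
    · simp at h
  have hnx : ¬ G.IsNode x := fun ⟨n, hn⟩ => by simpa using label_unique hG.wellFormed.1 hn hx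
  have hny : ¬ G.IsNode y := fun ⟨n, hn⟩ => by simpa using label_unique hG.wellFormed.1 hn hy
  refine ⟨⟨?_, ?_⟩, ?_, ?_, ?_, ?_⟩
  · simp only [subdivide, List.map_append, List.map_cons, List.map_nil]
    refine List.nodup_append.2 ⟨hG.wellFormed.1, by simp, ?_⟩
    rintro a ha b hb rfl
    rw [List.mem_singleton] at hb
    subst hb
    obtain ⟨⟨a, σ⟩, ha', rfl⟩ := List.mem_map.1 ha
    exact hcv σ ha'
  · intro a γ' b hab
    have hV : ∀ a, G.IsVertex a → (G.subdivide x γ y c w (.plain f)).IsVertex a :=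
      fun a ⟨σ, h⟩ => ⟨σ, (hvert _ _).2 (.inl h)⟩
    have hC : (G.subdivide x γ y c w (.plain f)).IsVertex c := ⟨_, (hvert _ _).2 (.inr ⟨rfl, rfl⟩)⟩
    rcases (hedge _ _ _).1 hab with ⟨h, -⟩ | ⟨rfl, -, rfl⟩ | ⟨rfl, -, rfl⟩
    · obtain ⟨h1, h2, h3⟩ := hG.wellFormed.2 _ _ _ h
      exact ⟨hV _ h1, hV _ h2, h3⟩
    · exact ⟨hV _ ⟨_, hx⟩, hC, hxc⟩
    · exact ⟨hC, hV _ ⟨_, hy⟩, hyc.symm⟩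
  · rintro a ⟨Y, hY⟩
    rcases (hvert _ _).1 hY with h | ⟨-, h⟩
    · exact hG.no_nonterminal a ⟨Y, h⟩
    · simp at h
  · intro a α b hab
    rcases (hedge _ _ _).1 hab with ⟨h, -⟩ | ⟨-, h, -⟩ | ⟨-, h, -⟩
    · exact hG.no_enc _ _ _ h
    · simp at h
    · exact hG.no_enc _ _ _ (h ▸ he)
  · rintro a γ' b hab ⟨ha, hb⟩
    rcases (hedge _ _ _).1 hab with ⟨h, -⟩ | ⟨rfl, -, -⟩ | ⟨-, -, rfl⟩
    · exact hG.no_node_node _ _ _ h ⟨hnode a ha, hnode b hb⟩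
    · exact hnx (hnode _ ha)
    · exact hny (hnode _ hb)
  · rintro v ⟨u, hv⟩
    rw [hvert] at hv
    constructor
    · intro a γ₁ a' γ₂ h1 h2
      rw [hedge] at h1 h2
      rcases hv with hv | ⟨hv, -⟩
      · have := (hG.wire_degrees v ⟨u, hv⟩).1 a γ₁ a' γ₂
        have := hdy γ₁ a
        have := hdy γ₂ a'
        have := hcv (.wire u)
        grind
      · have := hev a γ₁ v
        have := hev a' γ₂ v
        grind
    · intro a γ₁ a' γ₂ h1 h2
      rw [hedge] at h1 h2
      rcases hv with hv | ⟨hv, -⟩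
      · have := (hG.wire_degrees v ⟨u, hv⟩).2 a γ₁ a' γ₂
        have := hdx γ₁ a
        have := hdx γ₂ a'
        have := hcv (.wire u)
        grind
      · have := hev v γ₁ a
        have := hev v γ₂ a'
        grind

theorem merge_subdivide (hG : G.IsStringGraph) (hx : (x, VLabel.wire w) ∈ G.verts)
    (he : (x, γ, y) ∈ G.edges) (hc : ¬ G.IsVertex c) (δ : ELabel E F) :
    (G.subdivide x γ y c w δ).Merge G := by
  have hxc : x ≠ c := by rintro rfl; exact hc ⟨_, hx⟩
  have hev : ∀ a γ' b, (a, γ', b) ∈ G.edges → a ≠ c ∧ b ≠ c := fun a γ' b h => by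
    obtain ⟨h1, h2, -⟩ := hG.wellFormed.2 _ _ _ h
    exact ⟨fun h => hc (h ▸ h1), fun h => hc (h ▸ h2)⟩
  refine ⟨x, c, δ, w, by simp [subdivide, hx], by simp [subdivide], hxc, by simp [subdivide],
    ?_, ?_⟩
  · intro a σ
    have : (a, σ) ∈ G.verts → a ≠ c := fun h hac => hc ⟨σ, hac ▸ h⟩
    simp only [subdivide, List.mem_append, List.mem_singleton, Prod.mk.injEq]
    grind
  · intro a γ' b
    have hyc := (hev _ _ _ he).2
    simp only [subdivide, List.mem_append, List.mem_filter, decide_eq_true_eq, ne_eq,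
      List.mem_cons, Prod.mk.injEq, List.not_mem_nil, or_false]
    constructor
    · intro hab
      obtain ⟨h1, h2⟩ := hev _ _ _ hab
      by_cases heq : a = x ∧ γ' = γ ∧ b = y
      · obtain ⟨rfl, rfl, rfl⟩ := heq
        exact ⟨c, b, by simp, by simp [hxc.symm], by simp, by simp [hyc]⟩
      · exact ⟨a, b, .inl ⟨hab, heq⟩, fun h => h2 h.2, by simp [h1], by simp [h2]⟩
    · rintro ⟨a', b', h1, h2, rfl, rfl⟩
      rcases h1 with ⟨h1, -⟩ | ⟨rfl, -, rfl⟩ | ⟨rfl, rfl, rfl⟩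
      · obtain ⟨h3, h4⟩ := hev _ _ _ h1
        simpa [h3, h4] using h1
      · exact absurd ⟨rfl, rfl⟩ h2
      · simpa [hyc] using he

end Subdivide

theorem countP_lt_countP {α : Type*} {p q : α → Bool} {l : List α}
    (h : ∀ a ∈ l, q a → p a) {a : α} (ha : a ∈ l) (hp : p a) (hq : ¬ q a) :
    l.countP q < l.countP p := by
  induction l with
  | nil => simp at ha
  | cons b l ih =>
    simp only [List.countP_cons]
    have hle : l.countP q ≤ l.countP p := List.countP_mono_left fun x hx => h x (by simp [hx])
    have hb := h b (by simp)
    rcases List.mem_cons.1 ha with rfl | ha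
    · simp only [hp, hq, if_true]
      simp
      omega
    · have := ih (fun x hx => h x (by simp [hx])) ha
      split_ifs <;> simp_all

open scoped Classical in
/-- Splitting a wire-vertex and merging in another place changes the label of an edge inside of a
segment, so every string graph is wire-homeomorphic to a standard one. The number `n` bounds the
number of edges whose label is not the standard one. -/
theorem exists_standard (n : ℕ) : ∀ G : LGraph N W X E F,
    (∀ h : Nonempty F, G.edges.countP (fun e =>
      decide (e.2.1 ≠ ELabel.plain (Classical.choice h))) ≤ n) →
    G.IsStringGraph → ∃ G', G'.IsStringGraph ∧ G.WireHomeomorphic G' ∧ G'.Standard := by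
  induction n with
  | zero =>
    intro G hn hG
    refine ⟨G, hG, .refl _, fun a γ b _ he => ?_⟩
    cases γ with
    | enc α => exact absurd he (hG.no_enc _ _ _)
    | plain f =>
      refine ⟨⟨f⟩, ?_⟩
      have := List.countP_eq_zero.1 (Nat.le_zero.1 (hn ⟨f⟩)) _ he
      simpa using this
  | succ n ih =>
    intro G hn hG
    by_cases hs : G.Standard
    · exact ⟨G, hG, .refl _, hs⟩
    simp only [Standard, not_forall] at hs
    obtain ⟨x, γ, y, hxy, he, hγ⟩ := hs
    obtain ⟨w, -, hx, hy, -⟩ := hxy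
    have hF : Nonempty F := by
      cases γ with
      | enc α => exact absurd he (hG.no_enc _ _ _)
      | plain f => exact ⟨f⟩
    have hγ' : γ ≠ ELabel.plain (Classical.choice hF) := fun h => hγ ⟨hF, h⟩
    obtain ⟨c, hc⟩ : ∃ c, ¬ G.IsVertex c := ⟨G.fresh, fun ⟨σ, h⟩ => lt_irrefl _ (lt_fresh h)⟩
    have hyc : y ≠ c := by rintro rfl; exact hc ⟨_, hy⟩
    have hxy : x ≠ y := (hG.wellFormed.2 _ _ _ he).2.2
    set G₂ := G.subdivide x γ y c w (.plain (Classical.choice hF)) with hG₂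
    have hG₂s : G₂.IsStringGraph := isStringGraph_subdivide hG hx hy he hc
    have hcy : G₂.Mono c y := ⟨w, γ, by simp [G₂, subdivide], by simp [G₂, subdivide, hy],
      by simp [G₂, subdivide]⟩
    have hyc' : ¬ G₂.Mono y c := by
      rintro ⟨v, δ, -, -, h⟩
      simp only [G₂, subdivide, List.mem_append, List.mem_filter, List.mem_cons, Prod.mk.injEq,
        List.not_mem_nil, or_false] at h
      rcases h with ⟨h, -⟩ | ⟨h, -⟩ | ⟨h, -⟩
      · exact hc (hG.wellFormed.2 _ _ _ h).2.1
      · exact hxy h.symm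
      · exact hyc h
    obtain ⟨G', h1, h2, h3⟩ := ih (G₂.mergeGraph c y) (fun h => by
      refine Nat.lt_succ_iff.1 (lt_of_lt_of_le ?_ (hn h))
      set p : ℕ × ELabel E F × ℕ → Bool := fun e =>
        decide (e.2.1 ≠ ELabel.plain (Classical.choice h)) with hp
      have hmap : (G₂.mergeGraph c y).edges.countP p =
          (G₂.edges.filter fun e => ¬ (e.1 = c ∧ e.2.2 = y)).countP p := by
        simp only [mergeGraph, List.countP_map]
        rfl
      rw [hmap]
      have hE : G₂.edges.filter (fun e => ¬ (e.1 = c ∧ e.2.2 = y)) =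
          (G.edges.filter fun e => e ≠ (x, γ, y)).filter (fun e => ¬ (e.1 = c ∧ e.2.2 = y)) ++
            [(x, .plain (Classical.choice hF), c)] := by
        simp [G₂, subdivide, hyc.symm]
      rw [hE, List.countP_append]
      have h0 : List.countP p [(x, .plain (Classical.choice hF), c)] = 0 := by simp [p]
      rw [h0, add_zero, List.countP_filter, List.countP_filter]
      exact countP_lt_countP (fun e _ h => by simp at h ⊢; tauto) he
        (by simpa [p] using hγ') (by simp))
      (isStringGraph_mergeGraph hG₂s hcy hyc')
    refine ⟨G', h1, .trans _ _ _ ?_ (.trans _ _ _ (wireHomeomorphic_mergeGraph hG₂s hcy hyc') h2), h3⟩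
    exact .symm _ _ (.rel _ _ ⟨hG₂s, hG, .inr (merge_subdivide hG hx he hc _)⟩)

theorem exists_normal {G : LGraph N W X E F} (hG : G.IsStringGraph) :
    ∃ G', G'.IsStringGraph ∧ G.WireHomeomorphic G' ∧ G'.Standard ∧ G'.Reduced := by
  classical
  obtain ⟨G₁, h1, h2, h3⟩ := exists_standard G.edges.length G (fun _ => List.countP_le_length) hG
  obtain ⟨G₂, h4, h5, h6⟩ := h3.exists_reduced _ G₁ rfl h1
  exact ⟨G₂, h4, .trans _ _ _ h2 h5, h6⟩

/-! ### Completeness of the invariants -/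

/-- A bijection between the vertices of two graphs, given as a relation, is an isomorphism if it
preserves labels and edges. -/
theorem iso_of_relation {G G' : LGraph N W X E F} (ψ : ℕ → ℕ → Prop)
    (hE : ∀ x γ y, (x, γ, y) ∈ G.edges → G.IsVertex x ∧ G.IsVertex y)
    (hE' : ∀ x γ y, (x, γ, y) ∈ G'.edges → G'.IsVertex x ∧ G'.IsVertex y)
    (hlab : ∀ x y, ψ x y → ∀ σ, (x, σ) ∈ G.verts ↔ (y, σ) ∈ G'.verts)
    (htot : ∀ x, G.IsVertex x → ∃ y, ψ x y) (hsurj : ∀ y, G'.IsVertex y → ∃ x, ψ x y)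
    (hdom : ∀ x y, ψ x y → G.IsVertex x)
    (hfun : ∀ x y y', ψ x y → ψ x y' → y = y') (hinj : ∀ x x' y, ψ x y → ψ x' y → x = x')
    (hedge : ∀ x y x' y', ψ x y → ψ x' y' → ∀ γ,
      (x, γ, x') ∈ G.edges ↔ (y, γ, y') ∈ G'.edges) : G.Iso G' := by
  choose f hf using htot
  have hfin : {x | G.IsVertex x}.Finite := by
    refine (List.finite_toSet (G.verts.map Prod.fst)).subset ?_
    rintro x ⟨σ, hσ⟩
    exact List.mem_map.2 ⟨_, hσ, rfl⟩
  let e : {x | G.IsVertex x} ↪ ℕ := ⟨fun x => f x.1 x.2, fun x y hxy => by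
    apply Subtype.ext
    have h1 := hf x.1 x.2
    have h2 := hf y.1 y.2
    simp only at hxy
    rw [← hxy] at h2
    exact hinj _ _ _ h1 h2⟩
  obtain ⟨φ, hφ⟩ := Cardinal.extend_function_of_lt e
    (by rw [Cardinal.mk_nat]; exact Cardinal.lt_aleph0_iff_set_finite.2 hfin) ⟨Equiv.refl ℕ⟩
  have hψ : ∀ x, G.IsVertex x → ψ x (φ x) := fun x hx => by
    have h1 : φ x = f x hx := hφ ⟨x, hx⟩
    rw [h1]
    exact hf x hx
  have hψ' : ∀ x, G'.IsVertex (φ x) → ψ x (φ x) := fun x hx => by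
    obtain ⟨z, hz⟩ := hsurj _ hx
    have h2 := hψ z (hdom _ _ hz)
    have h3 := hfun _ _ _ hz h2
    rwa [φ.injective h3]
  refine ⟨φ, fun x σ => ⟨fun h => (hlab _ _ (hψ x ⟨σ, h⟩) σ).1 h, fun h =>
    (hlab _ _ (hψ' x ⟨σ, h⟩) σ).2 h⟩, fun x γ y => ⟨fun h => ?_, fun h => ?_⟩⟩
  · obtain ⟨h1, h2⟩ := hE _ _ _ h
    exact (hedge _ _ _ _ (hψ x h1) (hψ y h2) γ).1 h
  · obtain ⟨h1, h2⟩ := hE' _ _ _ h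
    exact (hedge _ _ _ _ (hψ' x h1) (hψ' y h2) γ).2 h

theorem Reduced.segment {G : LGraph N W X E F} (hG : G.IsStringGraph) (hr : G.Reduced)
    {x y : ℕ} (h : G.Segment x y) : x = y ∨ G.Mono x y := by
  induction h with
  | rel x y h => exact .inr h
  | refl => exact .inl rfl
  | symm x y _ ih => exact ih.imp Eq.symm (hr x y)
  | trans x y z _ _ ih₁ ih₂ =>
    rcases ih₁ with rfl | h1
    · exact ih₂
    · rcases ih₂ with rfl | h2
      · exact .inr h1
      · left
        obtain ⟨w, γ, -, -, he⟩ := hr x y h1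
        exact h2.right_unique hG he

theorem Reduced.hasEnd_iff {G : LGraph N W X E F} (hG : G.IsStringGraph) (hr : G.Reduced)
    {x : ℕ} : G.HasEnd x ↔ ∀ t, ¬ G.Mono x t := by
  refine ⟨?_, fun h => ⟨x, .refl _ _, h⟩⟩
  rintro ⟨z, hz, h⟩
  rcases hr.segment hG hz with rfl | hzx
  · exact h
  · exact absurd hzx (h x)

/-- In a circle of two vertices, `x` is the vertex with the smaller name. -/
def IsLower (G : LGraph N W X E F) (x : ℕ) : Prop := ∃ x', G.Mono x x' ∧ x < x'

theorem Reduced.eq_of_isLower_iff {G : LGraph N W X E F} (hG : G.IsStringGraph) (hr : G.Reduced)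
    {x y : ℕ} (h : G.Segment x y) (hl : G.IsLower x ↔ G.IsLower y) : x = y := by
  rcases hr.segment hG h with h | h
  · exact h
  exfalso
  have h' := hr x y h
  have hne := h.ne hG
  have hx : G.IsLower x ↔ x < y := by
    refine ⟨?_, fun h1 => ⟨y, h, h1⟩⟩
    rintro ⟨z, ⟨w, γ, -, -, he⟩, hz⟩
    rwa [← h.right_unique hG he]
  have hy : G.IsLower y ↔ y < x := by
    refine ⟨?_, fun h1 => ⟨x, h', h1⟩⟩
    rintro ⟨z, ⟨w, γ, -, -, he⟩, hz⟩
    rwa [← h'.right_unique hG he]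
  rw [hx, hy] at hl
  omega

/-- The relation that refines `ρ` to a bijection of vertices of reduced graphs: the vertices of a
circle are matched in the order of their names. -/
def Refine (G G' : LGraph N W X E F) (ρ : ℕ → ℕ → Prop) (x y : ℕ) : Prop :=
  (∃ x₀ y₀, G.Segment x x₀ ∧ ρ x₀ y₀ ∧ G'.Segment y y₀) ∧ (G.IsLower x ↔ G'.IsLower y)

theorem Refine.flip {G G' : LGraph N W X E F} {ρ : ℕ → ℕ → Prop} {x y : ℕ}
    (h : Refine G G' ρ x y) : Refine G' G (flip ρ) y x :=
  let ⟨⟨x₀, y₀, h1, h2, h3⟩, h4⟩ := h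
  ⟨⟨y₀, x₀, h3, h2, h1⟩, h4.symm⟩

section Refine

variable {G G' : LGraph N W X E F} {ρ : ℕ → ℕ → Prop}

theorem Refine.total (hG : G.IsStringGraph) (hG' : G'.IsStringGraph) (hr : G.Reduced)
    (hr' : G'.Reduced) (hρ : IsSim G G' ρ) {x : ℕ} (hx : G.IsVertex x) :
    ∃ y, Refine G G' ρ x y := by
  obtain ⟨y, hxy⟩ := hρ.total x hx
  have hend := hρ.hasEnd x y hxy
  rw [hr.hasEnd_iff hG, hr'.hasEnd_iff hG'] at hend
  by_cases hlow : G.IsLower x ↔ G'.IsLower y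
  · exact ⟨y, ⟨x, y, .refl _ _, hxy, .refl _ _⟩, hlow⟩
  -- Otherwise `y` lies on a circle, and its partner is the vertex to be taken.
  obtain ⟨y', hy⟩ : ∃ y', G'.Mono y y' := by
    by_contra! hcon
    refine hlow ⟨fun ⟨x', h, _⟩ => absurd h (hend.2 hcon x'), fun ⟨y', h, _⟩ => absurd h (hcon y')⟩
  refine ⟨y', ⟨x, y, .refl _ _, hxy, hy.segment.symm⟩, ?_⟩
  have : ¬ (G'.IsLower y ↔ G'.IsLower y') := fun h =>
    hy.ne hG' (hr'.eq_of_isLower_iff hG' hy.segment h)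
  tauto

theorem Refine.right_unique (hG' : G'.IsStringGraph) (hr' : G'.Reduced) (hρ : IsSim G G' ρ)
    {x y y' : ℕ} (h : Refine G G' ρ x y) (h' : Refine G G' ρ x y') : y = y' := by
  obtain ⟨⟨x₀, y₀, h1, h2, h3⟩, h4⟩ := h
  obtain ⟨⟨x₁, y₁, h5, h6, h7⟩, h8⟩ := h'
  have := (hρ.segment _ _ _ _ h2 h6).1 (h1.symm.trans h5)
  exact hr'.eq_of_isLower_iff hG' (h3.trans (this.trans h7.symm)) (h4.symm.trans h8)

theorem Refine.segment_iff (hρ : IsSim G G' ρ) {x y x' y' : ℕ} (h : Refine G G' ρ x y)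
    (h' : Refine G G' ρ x' y') : G.Segment x x' ↔ G'.Segment y y' := by
  obtain ⟨⟨x₀, y₀, h1, h2, h3⟩, -⟩ := h
  obtain ⟨⟨x₁, y₁, h5, h6, h7⟩, -⟩ := h'
  have := hρ.segment _ _ _ _ h2 h6
  exact ⟨fun h => h3.trans ((this.1 (h1.symm.trans (h.trans h5))).trans h7.symm),
    fun h => h1.trans ((this.2 (h3.symm.trans (h.trans h7))).trans h5.symm)⟩

theorem Refine.edge (hG : G.IsStringGraph) (hG' : G'.IsStringGraph)
    (hr' : G'.Reduced) (hs : G.Standard) (hs' : G'.Standard) (hρ : IsSim G G' ρ)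
    {x y x' y' : ℕ} (h : Refine G G' ρ x y) (h' : Refine G G' ρ x' y')
    (hinj : y = y' → x = x') {γ : ELabel E F}
    (he : (x, γ, x') ∈ G.edges) : (y, γ, y') ∈ G'.edges := by
  by_cases hm : G.Mono x x'
  · have hyy : G'.Mono y y' := by
      rcases hr'.segment hG' ((h.segment_iff hρ h').1 hm.segment) with hyy | hyy
      · exact absurd (hinj hyy) (hm.ne hG)
      · exact hyy
    obtain ⟨-, δ, -, -, hδ⟩ := id hyy
    obtain ⟨_, rfl⟩ := hs x γ x' hm he
    obtain ⟨_, rfl⟩ := hs' y δ y' hyy hδ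
    exact hδ
  · obtain ⟨y₁, y₂, h1, h2, h3, h4⟩ := hρ.edge x γ x' he hm
    obtain ⟨⟨x₀, y₀, h5, h6, h7⟩, -⟩ := h
    obtain ⟨⟨x₃, y₃, h8, h9, h10⟩, -⟩ := h'
    -- A vertex on a circle has no edges besides those of the circle.
    have hy₁ : y = y₁ := by
      rcases hr'.segment hG' (h7.trans ((hρ.segment _ _ _ _ h6 h1).1 h5.symm)) with h | h
      · exact h
      · have := (hr' _ _ h).right_unique hG' h3
        subst this
        exact absurd (hr' _ _ h) h4
    have hy₂ : y' = y₂ := by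
      rcases hr'.segment hG' (h10.trans ((hρ.segment _ _ _ _ h9 h2).1 h8.symm)) with h | h
      · exact h
      · have := h.left_unique hG' h3
        subst this
        exact absurd h h4
    rwa [hy₁, hy₂]

end Refine

/-- Reduced and standard graphs with the same segments are isomorphic. -/
theorem iso_of_isSim {G G' : LGraph N W X E F} {ρ : ℕ → ℕ → Prop}
    (hG : G.IsStringGraph) (hG' : G'.IsStringGraph) (hr : G.Reduced) (hr' : G'.Reduced)
    (hs : G.Standard) (hs' : G'.Standard) (hρ : IsSim G G' ρ) : G.Iso G' := by
  have hinj : ∀ x x' y, Refine G G' ρ x y → Refine G G' ρ x' y → x = x' :=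
    fun x x' y h h' => Refine.right_unique hG hr hρ.flip h.flip h'.flip
  have hfun : ∀ x y y', Refine G G' ρ x y → Refine G G' ρ x y' → y = y' :=
    fun x y y' h h' => Refine.right_unique hG' hr' hρ h h'
  have hlab : ∀ x y, Refine G G' ρ x y → ∀ σ, (x, σ) ∈ G.verts ↔ (y, σ) ∈ G'.verts := by
    rintro x y ⟨⟨x₀, y₀, h1, h2, h3⟩, -⟩ σ
    rw [h1.mem_verts hG.wellFormed.1, h3.mem_verts hG'.wellFormed.1]
    obtain ⟨τ, h4, h5⟩ := hρ.label _ _ h2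
    exact ⟨fun h => label_unique hG.wellFormed.1 h4 h ▸ h5,
      fun h => label_unique hG'.wellFormed.1 h5 h ▸ h4⟩
  refine iso_of_relation (Refine G G' ρ) (fun x γ y h => ?_) (fun x γ y h => ?_) hlab
    (fun x hx => Refine.total hG hG' hr hr' hρ hx) (fun y hy => ?_) ?_ hfun hinj ?_
  · obtain ⟨h1, h2, -⟩ := hG.wellFormed.2 _ _ _ h
    exact ⟨h1, h2⟩
  · obtain ⟨h1, h2, -⟩ := hG'.wellFormed.2 _ _ _ h
    exact ⟨h1, h2⟩
  · obtain ⟨x, hx⟩ := Refine.total hG' hG hr' hr hρ.flip hy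
    exact ⟨x, hx.flip⟩
  · rintro x y ⟨⟨x₀, y₀, h1, h2, h3⟩, -⟩
    obtain ⟨τ, h4, -⟩ := hρ.label _ _ h2
    exact ⟨τ, (h1.mem_verts hG.wellFormed.1 τ).2 h4⟩
  · intro x y x' y' h h' γ
    exact ⟨Refine.edge hG hG' hr' hs hs' hρ h h' (fun hy => hinj _ _ _ h (hy ▸ h')),
      Refine.edge hG' hG hr hs' hs hρ.flip h.flip h'.flip (fun hx => hfun _ _ _ h (hx ▸ h'))⟩

/-- The bijections between segments form a complete invariant of wire-homeomorphism. -/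
theorem wireHomeomorphic_iff {G G' : LGraph N W X E F} (hG : G.IsStringGraph)
    (hG' : G'.IsStringGraph) : G.WireHomeomorphic G' ↔ ∃ ρ, IsSim G G' ρ := by
  refine ⟨fun h => h.exists_isSim hG, ?_⟩
  rintro ⟨ρ, hρ⟩
  obtain ⟨G₁, h1, h2, hs, hr⟩ := exists_normal hG
  obtain ⟨G₁', h1', h2', hs', hr'⟩ := exists_normal hG'
  obtain ⟨ρ₁, h3⟩ := WireHomeomorphic.exists_isSim (.symm _ _ h2) h1
  obtain ⟨ρ₂, h4⟩ := h2'.exists_isSim hG'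
  have hiso := iso_of_isSim h1 h1' hr hr' hs hs'
    ((h3.comp hρ hG.wellFormed.1).comp h4 hG'.wellFormed.1)
  exact .trans _ _ _ h2 (.trans _ _ _ (.rel _ _ ⟨h1, h1', .inl hiso⟩) (.symm _ _ h2'))

/-! ### A bound for the target of a matching -/

/-- All names that occur in `G`, as vertices or as endpoints of edges. -/
def names (G : LGraph N W X E F) : List ℕ :=
  G.verts.map Prod.fst ++ (G.edges.map (fun e => e.1) ++ G.edges.map (fun e => e.2.2))

theorem IsVertex.mem_names {G : LGraph N W X E F} {x : ℕ} (h : G.IsVertex x) : x ∈ G.names := by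
  obtain ⟨σ, h⟩ := h
  exact List.mem_append_left _ (List.mem_map.2 ⟨_, h, rfl⟩)

theorem mem_names_of_mem_edges {G : LGraph N W X E F} {x y : ℕ} {γ : ELabel E F}
    (h : (x, γ, y) ∈ G.edges) : x ∈ G.names ∧ y ∈ G.names :=
  ⟨List.mem_append_right _ (List.mem_append_left _ (List.mem_map.2 ⟨_, h, rfl⟩)),
    List.mem_append_right _ (List.mem_append_right _ (List.mem_map.2 ⟨_, h, rfl⟩))⟩

/-- A vertex outside of the image of an embedding can be merged into its predecessor. -/
theorem IsEmbedding.mergeGraph {K H : LGraph N W X E F} {m : ℕ → ℕ} (h : K.IsEmbedding H m)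
    (hH : H.IsStringGraph) {a b : ℕ} (hab : H.Mono a b)
    (hbK : b ∉ m '' {x | x ∈ K.names}) : K.IsEmbedding (H.mergeGraph a b) m := by
  have hmb : ∀ x ∈ K.names, m x ≠ b := fun x hx hxb => hbK ⟨x, hx, hxb⟩
  have hb : b ∉ m '' {x | K.IsVertex x} := fun ⟨x, hx, hxb⟩ => hmb x (IsVertex.mem_names hx) hxb
  refine ⟨fun x σ hx => mem_mergeGraph_verts.2 ⟨h.map_vert _ _ hx,
    hmb x (IsVertex.mem_names ⟨σ, hx⟩)⟩, ?_, h.injOn,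
    ?_, ?_⟩
  · intro x γ y hxy
    obtain ⟨hx, hy⟩ := mem_names_of_mem_edges hxy
    exact mem_mergeGraph_edges.2 ⟨m x, m y, h.map_edge _ _ _ hxy, fun h => hmb y hy h.2,
      by rw [if_neg (hmb x hx)], by rw [if_neg (hmb y hy)]⟩
  · intro x γ z hx hz hzK
    obtain ⟨x', y', h1, h2, h3, rfl⟩ := mem_mergeGraph_edges.1 hz
    by_cases hxb : x' = b
    · rw [if_pos hxb] at h3
      obtain ⟨-, δ, -, -, hδ⟩ := hab
      exact h.dangling_out x δ b hx (h3 ▸ hδ) hb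
    · rw [if_neg hxb] at h3
      subst h3
      by_cases hyb : y' = b
      · exact h.dangling_out x γ y' hx h1 (hyb ▸ hb)
      · rw [if_neg hyb] at hzK
        exact h.dangling_out x γ y' hx h1 hzK
  · intro x γ z hx hz hzK
    obtain ⟨x', y', h1, h2, rfl, h3⟩ := mem_mergeGraph_edges.1 hz
    by_cases hyb : y' = b
    · subst hyb
      exact absurd ⟨hab.left_unique hH h1, rfl⟩ h2
    · rw [if_neg hyb] at h3
      subst h3
      by_cases hxb : x' = b
      · exact h.dangling_in x γ x' hx h1 (hxb ▸ hb)
      · rw [if_neg hxb] at hzK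
        exact h.dangling_in x γ x' hx h1 hzK

theorem segment_of_mono_mono {G : LGraph N W X E F} (hG : G.IsStringGraph) {a b : ℕ}
    (hab : G.Mono a b) (hba : G.Mono b a) {x y : ℕ} (h : G.Segment x y) :
    (x = a ∨ x = b) ↔ (y = a ∨ y = b) := by
  induction h with
  | rel x y h =>
    obtain ⟨-, γ, -, -, he⟩ := h
    constructor
    · rintro (rfl | rfl)
      · exact .inr (hab.right_unique hG he)
      · exact .inl (hba.right_unique hG he)
    · rintro (rfl | rfl)
      · exact .inr (hba.left_unique hG he)
      · exact .inl (hab.left_unique hG he)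
  | refl => rfl
  | symm _ _ _ ih => exact ih.symm
  | trans _ _ _ _ _ ih₁ ih₂ => exact ih₁.trans ih₂

/-- Two vertices of the same segment can be reached from a common vertex. -/
theorem Segment.exists_common {G : LGraph N W X E F} (hG : G.IsStringGraph) {x y : ℕ}
    (h : G.Segment x y) :
    ∃ z, Relation.ReflTransGen G.Mono z x ∧ Relation.ReflTransGen G.Mono z y := by
  induction h with
  | rel x y h => exact ⟨x, .refl, .single h⟩
  | refl x => exact ⟨x, .refl, .refl⟩
  | symm _ _ _ ih => exact let ⟨z, h1, h2⟩ := ih; ⟨z, h2, h1⟩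
  | trans x y z _ _ ih₁ ih₂ =>
    obtain ⟨u, h1, h2⟩ := ih₁
    obtain ⟨v, h3, h4⟩ := ih₂
    have huniq : Relator.RightUnique (Function.swap G.Mono) := fun b a a' h h' => by
      obtain ⟨-, γ, -, -, he⟩ := h'
      exact (Mono.left_unique hG h he).symm
    rcases Relation.ReflTransGen.total_of_right_unique huniq h2.swap h3.swap with h | h
    · exact ⟨v, h.swap.trans h1, h4⟩
    · exact ⟨u, h1, h.swap.trans h4⟩

/-- The target of a matching can be chosen such that its size is bounded in terms of `K` and `H`. In a
smallest target, a vertex outside of the image cannot be merged into its predecessor, so each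
segment has at most two vertices outside of the image. -/
theorem MatchesOnto.exists_small {K H : LGraph N W X E F} (hH : H.IsStringGraph)
    (h : K.MatchesOnto H) : ∃ H', H.WireHomeomorphic H' ∧ (∃ m, K.IsEmbedding H' m) ∧
      H'.verts.length ≤ K.names.length + 2 * H.verts.length := by
  classical
  let P : ℕ → Prop := fun n => ∃ H', H.WireHomeomorphic H' ∧ (∃ m, K.IsEmbedding H' m) ∧
    H'.verts.length = n
  have hP : ∃ n, P n := let ⟨H', h1, h2⟩ := h; ⟨_, H', h1, h2, rfl⟩
  obtain ⟨H', h1, ⟨m, hm⟩, h3⟩ := Nat.find_spec hP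
  refine ⟨H', h1, ⟨m, hm⟩, ?_⟩
  have hH' := h1.isStringGraph_iff.1 hH
  -- By minimality, nothing can be merged into a vertex outside of the image.
  have hmin : ∀ a b, H'.Mono a b → b ∉ m '' {x | x ∈ K.names} → H'.Mono b a := by
    intro a b hab hb
    by_contra hba
    have := Nat.find_min' hP (m := (H'.mergeGraph a b).verts.length)
      ⟨_, .trans _ _ _ h1 (wireHomeomorphic_mergeGraph hH' hab hba), ⟨m, hm.mergeGraph hH' hab hb⟩,
        rfl⟩
    have := length_mergeGraph_lt hab
    omega
  obtain ⟨ρ, hρ⟩ := h1.exists_isSim hH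
  choose! f hf using hρ.surj
  set vs : LGraph N W X E F → Finset ℕ := fun G => (G.verts.map Prod.fst).toFinset with hvs
  have hmem : ∀ (G : LGraph N W X E F) x, x ∈ vs G ↔ G.IsVertex x := by
    intro G x
    simp [vs, IsVertex]
  have hcard : (vs H').card = H'.verts.length := by
    rw [hvs, List.toFinset_card_of_nodup hH'.wellFormed.1, List.length_map]
  have hle : ∀ G : LGraph N W X E F, (vs G).card ≤ G.verts.length := fun G =>
    (List.toFinset_card_le _).trans (List.length_map ..).le
  set I := K.names.toFinset.image m with hI
  have hImem : ∀ b, b ∉ I → b ∉ m '' {x | x ∈ K.names} := by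
    rintro b hb ⟨x, hx, rfl⟩
    exact hb (Finset.mem_image_of_mem _ (List.mem_toFinset.2 hx))
  have hU : (vs H' \ I).card ≤ ((vs H) ×ˢ (Finset.univ : Finset Bool)).card := by
    refine Finset.card_le_card_of_injOn
      (fun b => (f b, decide (∃ a, H'.Mono a b ∧ a < b))) ?_ ?_
    · intro b hb
      have hb' := (hmem _ _).1 (Finset.mem_sdiff.1 hb).1
      obtain ⟨σ, hσ, -⟩ := hρ.label _ _ (hf b hb')
      exact Finset.mem_coe.2 (Finset.mem_product.2 ⟨(hmem _ _).2 ⟨σ, hσ⟩, Finset.mem_univ _⟩)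
    · intro b hb b' hb' heq
      obtain ⟨hbv, hbI⟩ := Finset.mem_sdiff.1 hb
      obtain ⟨hbv', hbI'⟩ := Finset.mem_sdiff.1 hb'
      rw [hmem] at hbv hbv'
      simp only [Prod.mk.injEq, decide_eq_decide] at heq
      have hseg : H'.Segment b b' := by
        have h5 := hf b hbv
        have h6 := hf b' hbv'
        rw [heq.1] at h5
        exact (hρ.segment _ _ _ _ h5 h6).1 (.refl _ _)
      have key : ∀ b b' a, b ∉ I → H'.Mono a b → H'.Segment b b' →
          ((∃ a, H'.Mono a b ∧ a < b) ↔ ∃ a, H'.Mono a b' ∧ a < b') → b = b' := by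
        intro b b' a hbI hab hseg hiff
        have hba := hmin a b hab (hImem b hbI)
        rcases (segment_of_mono_mono hH' hab hba hseg).1 (.inr rfl) with rfl | rfl
        · exfalso
          have hne := hab.ne hH'
          have e1 : (∃ a, H'.Mono a b ∧ a < b) ↔ b' < b := by
            refine ⟨?_, fun h => ⟨b', hab, h⟩⟩
            rintro ⟨z, ⟨-, γ, -, -, he⟩, hz⟩
            rwa [← hab.left_unique hH' he]
          have e2 : (∃ a, H'.Mono a b' ∧ a < b') ↔ b < b' := by
            refine ⟨?_, fun h => ⟨b, hba, h⟩⟩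
            rintro ⟨z, ⟨-, γ, -, -, he⟩, hz⟩
            rwa [← hba.left_unique hH' he]
          rw [e1, e2] at hiff
          rcases hne.lt_or_gt with h | h
          · exact lt_asymm h (hiff.1 h)
          · exact lt_asymm h (hiff.2 h)
        · rfl
      by_cases hpb : ∃ a, H'.Mono a b
      · obtain ⟨a, ha⟩ := hpb
        exact key b b' a hbI ha hseg heq.2
      by_cases hpb' : ∃ a, H'.Mono a b'
      · obtain ⟨a, ha⟩ := hpb'
        exact (key b' b a hbI' ha hseg.symm heq.2.symm).symm
      obtain ⟨z, hz, hz'⟩ := hseg.exists_common hH'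
      rcases hz.cases_tail with rfl | ⟨u, -, hu⟩
      · rcases hz'.cases_tail with rfl | ⟨u, -, hu⟩
        · rfl
        · exact absurd ⟨u, hu⟩ hpb'
      · exact absurd ⟨u, hu⟩ hpb
  rw [Finset.card_product, Finset.card_univ, Fintype.card_bool] at hU
  have hIc : I.card ≤ K.names.length := Finset.card_image_le.trans (List.toFinset_card_le _)
  have h7 : (vs H').card ≤ (vs H' \ I).card + I.card := by
    rw [← Finset.card_union_of_disjoint Finset.sdiff_disjoint]
    exact Finset.card_le_card (by rw [Finset.sdiff_union_self_eq_union]; exact Finset.subset_union_left)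
  have := hle H
  omega

end LGraph

/-! ### Primitive recursive functions and predicates -/

/-! The tactic `fun_prop` is set up to prove that functions and predicates are primitive recursive.
Bounded universal quantifiers and implications are not tagged, as they are confused with function
types. -/

attribute [fun_prop] Primrec
attribute [fun_prop] PrimrecPred

namespace Prim

variable {α β γ δ : Type*} [Primcodable α] [Primcodable β] [Primcodable γ] [Primcodable δ]

@[fun_prop] theorem id' : Primrec fun a : α => a := Primrec.id

@[fun_prop] theorem const' (b : β) : Primrec fun _ : α => b := Primrec.const b

@[fun_prop] theorem comp' {f : β → γ} {g : α → β} (hf : Primrec f) (hg : Primrec g) :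
    Primrec fun a => f (g a) := hf.comp hg

@[fun_prop] theorem fst' {f : α → β × γ} (hf : Primrec f) : Primrec fun a => (f a).1 :=
  Primrec.fst.comp hf

@[fun_prop] theorem snd' {f : α → β × γ} (hf : Primrec f) : Primrec fun a => (f a).2 :=
  Primrec.snd.comp hf

@[fun_prop] theorem mk' {f : α → β} {g : α → γ} (hf : Primrec f) (hg : Primrec g) :
    Primrec fun a => (f a, g a) := hf.pair hg

@[fun_prop] theorem add' {f g : α → ℕ} (hf : Primrec f) (hg : Primrec g) :
    Primrec fun a => f a + g a := Primrec.nat_add.comp hf hg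

@[fun_prop] theorem mul' {f g : α → ℕ} (hf : Primrec f) (hg : Primrec g) :
    Primrec fun a => f a * g a := Primrec.nat_mul.comp hf hg

@[fun_prop] theorem max' {f g : α → ℕ} (hf : Primrec f) (hg : Primrec g) :
    Primrec fun a => max (f a) (g a) := Primrec.nat_max.comp hf hg

@[fun_prop] theorem append' {f g : α → List β} (hf : Primrec f) (hg : Primrec g) :
    Primrec fun a => f a ++ g a := Primrec.list_append.comp hf hg

@[fun_prop] theorem cons' {f : α → β} {g : α → List β} (hf : Primrec f) (hg : Primrec g) :
    Primrec fun a => f a :: g a := Primrec.list_cons.comp hf hg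

@[fun_prop] theorem map' {f : α → List β} {g : α → β → γ} (hf : Primrec f)
    (hg : Primrec fun p : α × β => g p.1 p.2) : Primrec fun a => (f a).map fun b => g a b :=
  Primrec.list_map hf hg.to₂

@[fun_prop] theorem flatMap' {f : α → List β} {g : α → β → List γ} (hf : Primrec f)
    (hg : Primrec fun p : α × β => g p.1 p.2) : Primrec fun a => (f a).flatMap fun b => g a b :=
  Primrec.list_flatMap hf hg.to₂

@[fun_prop] theorem range' {f : α → ℕ} (hf : Primrec f) : Primrec fun a => List.range (f a) :=
  Primrec.list_range.comp hf

@[fun_prop] theorem length' {f : α → List β} (hf : Primrec f) : Primrec fun a => (f a).length :=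
  Primrec.list_length.comp hf

@[fun_prop] theorem getElem?' {f : α → List β} {g : α → ℕ} (hf : Primrec f) (hg : Primrec g) :
    Primrec fun a => (f a)[g a]? := Primrec.list_getElem?.comp hf hg

@[fun_prop] theorem toList' {f : α → Option β} (hf : Primrec f) :
    Primrec fun a => (f a).toList := Primrec.optionToList.comp hf

@[fun_prop] theorem ite' {p : α → Prop} [DecidablePred p] {f g : α → β} (hp : PrimrecPred p)
    (hf : Primrec f) (hg : Primrec g) : Primrec fun a => if p a then f a else g a :=
  Primrec.ite hp hf hg

@[fun_prop] theorem filter' {f : α → List β} {R : α → β → Prop} [∀ a b, Decidable (R a b)]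
    (hf : Primrec f) (hR : PrimrecPred fun p : α × β => R p.1 p.2) :
    Primrec fun a => (f a).filter fun b => decide (R a b) := by
  have : Primrec fun a => (f a).flatMap fun b => if R a b then [b] else [] := by
    refine flatMap' hf (ite' (p := fun p : α × β => R p.1 p.2) hR ?_ ?_) <;> fun_prop
  refine this.of_eq fun a => ?_
  induction f a with
  | nil => rfl
  | cons b l ih => by_cases h : R a b <;> simp [h, ih]

theorem foldr' {f : α → List β} {g : α → γ} {h : α → β → γ → γ} (hf : Primrec f)
    (hg : Primrec g) (hh : Primrec fun p : α × β × γ => h p.1 p.2.1 p.2.2) :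
    Primrec fun a => (f a).foldr (h a) (g a) :=
  Primrec.list_foldr (h := fun a p => h a p.1 p.2) hf hg hh.to₂

@[fun_prop] theorem eq' {f g : α → β} (hf : Primrec f) (hg : Primrec g) :
    PrimrecPred fun a => f a = g a := Primrec.eq.comp hf hg

@[fun_prop] theorem lt' {f g : α → ℕ} (hf : Primrec f) (hg : Primrec g) :
    PrimrecPred fun a => f a < g a := Primrec.nat_lt.comp hf hg

@[fun_prop] theorem not' {p : α → Prop} (hp : PrimrecPred p) : PrimrecPred fun a => ¬ p a :=
  hp.not

@[fun_prop] theorem ne' {f g : α → β} (hf : Primrec f) (hg : Primrec g) :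
    PrimrecPred fun a => f a ≠ g a := (eq' hf hg).not

@[fun_prop] theorem and' {p q : α → Prop} (hp : PrimrecPred p) (hq : PrimrecPred q) :
    PrimrecPred fun a => p a ∧ q a := hp.and hq

@[fun_prop] theorem or' {p q : α → Prop} (hp : PrimrecPred p) (hq : PrimrecPred q) :
    PrimrecPred fun a => p a ∨ q a := hp.or hq

theorem imp' {p q : α → Prop} (hp : PrimrecPred p) (hq : PrimrecPred q) :
    PrimrecPred fun a => p a → q a :=
  (hp.not.or hq).of_eq fun _ => imp_iff_not_or.symm

@[fun_prop] theorem iff' {p q : α → Prop} (hp : PrimrecPred p) (hq : PrimrecPred q) :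
    PrimrecPred fun a => (p a ↔ q a) :=
  ((imp' hp hq).and (imp' hq hp)).of_eq fun _ => iff_def.symm

@[fun_prop] theorem exists_mem' {f : α → List β} {R : α → β → Prop} (hf : Primrec f)
    (hR : PrimrecPred fun p : α × β => R p.1 p.2) : PrimrecPred fun a => ∃ b ∈ f a, R a b :=
  (PrimrecRel.exists_mem_list (R := fun b a => R a b)
    (PrimrecPred.comp (p := fun p : α × β => R p.1 p.2) hR
      (Primrec.snd.pair Primrec.fst))).comp hf Primrec.id

theorem forall_mem' {f : α → List β} {R : α → β → Prop} (hf : Primrec f)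
    (hR : PrimrecPred fun p : α × β => R p.1 p.2) : PrimrecPred fun a => ∀ b ∈ f a, R a b :=
  (exists_mem' (R := fun a b => ¬ R a b) hf hR.not).not.of_eq fun a => by push Not; rfl

@[fun_prop] theorem mem' {f : α → β} {g : α → List β} (hf : Primrec f) (hg : Primrec g) :
    PrimrecPred fun a => f a ∈ g a :=
  (exists_mem' (R := fun a b => b = f a) hg (by fun_prop)).of_eq fun a => by simp

/-- Every predicate on a finite type is primitive recursive. -/
theorem of_finite [Finite β] (p : β → Prop) {f : α → β} (hf : Primrec f) :
    PrimrecPred fun a => p (f a) := by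
  classical
  exact PrimrecPred.comp (Primrec.primrecPred (Primrec.dom_finite fun b => decide (p b))) hf

@[fun_prop] theorem nodup' {f : α → List β} (hf : Primrec f) :
    PrimrecPred fun a => (f a).Nodup := by
  have : PrimrecPred fun a => ∀ i ∈ List.range (f a).length, ∀ j ∈ List.range (f a).length,
      i < j → (f a)[i]? ≠ (f a)[j]? := by
    refine forall_mem' (by fun_prop) (forall_mem' (by fun_prop) (imp' ?_ ?_)) <;> fun_prop
  refine this.of_eq fun a => ?_
  rw [List.nodup_iff_getElem?_ne_getElem?]
  simp only [List.mem_range]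
  exact ⟨fun h i j hij hj => h i (hij.trans hj) j hj hij, fun h i _ j hj hij => h i j hij hj⟩

end Prim

/-- The lists that arise from `l` by deleting entries. -/
def sublists {α : Type*} (l : List α) : List (List α) :=
  l.foldr (fun a acc => acc ++ acc.map fun u => a :: u) [[]]

theorem filter_mem_sublists {α : Type*} (p : α → Bool) (l : List α) :
    l.filter p ∈ sublists l := by
  induction l with
  | nil => simp [sublists]
  | cons a l ih =>
    change _ ∈ sublists l ++ (sublists l).map fun u => a :: u
    cases h : p a
    · simp [h, ih]
    · simp [h, ih]

/-- The list of all pairs of entries of two lists. -/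
def pairs {α β : Type*} (l : List α) (l' : List β) : List (α × β) :=
  l.flatMap fun a => l'.map fun b => (a, b)

@[simp] theorem mem_pairs {α β : Type*} {l : List α} {l' : List β} {p : α × β} :
    p ∈ pairs l l' ↔ p.1 ∈ l ∧ p.2 ∈ l' := by
  obtain ⟨a, b⟩ := p
  simp [pairs]

namespace Prim

variable {α β γ δ : Type*} [Primcodable α] [Primcodable β] [Primcodable γ] [Primcodable δ]

@[fun_prop] theorem sublists' {f : α → List β} (hf : Primrec f) :
    Primrec fun a => sublists (f a) := by
  unfold sublists
  exact foldr' hf (by fun_prop) (by fun_prop)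

@[fun_prop] theorem pairs' {f : α → List β} {g : α → List γ} (hf : Primrec f)
    (hg : Primrec g) : Primrec fun a => pairs (f a) (g a) := by
  unfold pairs
  fun_prop

end Prim

section Graphs

variable {N W X E F : Type*}

instance [Finite N] [Finite W] [Finite X] : Finite (VLabel N W X) := .of_equiv _ VLabel.equiv.symm

instance [Finite E] [Finite F] : Finite (ELabel E F) := .of_equiv _ ELabel.equiv.symm

variable [Primcodable N] [Primcodable W] [Primcodable X] [Primcodable E] [Primcodable F]
variable {α : Type*} [Primcodable α]

namespace LGraph

open Prim

@[fun_prop] theorem primrec_verts {f : α → LGraph N W X E F} (hf : Primrec f) :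
    Primrec fun a => (f a).verts :=
  Primrec.fst.comp ((Primrec.of_equiv (e := LGraph.equiv)).comp hf)

@[fun_prop] theorem primrec_edges {f : α → LGraph N W X E F} (hf : Primrec f) :
    Primrec fun a => (f a).edges :=
  Primrec.snd.comp ((Primrec.of_equiv (e := LGraph.equiv)).comp hf)

@[fun_prop] theorem primrec_mk {f : α → List (ℕ × VLabel N W X)}
    {g : α → List (ℕ × ELabel E F × ℕ)} (hf : Primrec f) (hg : Primrec g) :
    Primrec fun a => LGraph.mk (f a) (g a) :=
  (Primrec.of_equiv_symm (e := LGraph.equiv (N := N) (W := W) (X := X) (E := E) (F := F))).comp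
    (hf.pair hg)

variable {f g : α → LGraph N W X E F} {x y : α → ℕ}

@[fun_prop] theorem primrec_names (hf : Primrec f) : Primrec fun a => (f a).names := by
  unfold names
  fun_prop

@[fun_prop] theorem primrecPred_isVertex (hf : Primrec f) (hx : Primrec x) :
    PrimrecPred fun a => (f a).IsVertex (x a) := by
  have : PrimrecPred fun a => ∃ q ∈ (f a).verts, q.1 = x a := by fun_prop
  refine this.of_eq fun a => ?_
  constructor
  · rintro ⟨⟨_, σ⟩, h, rfl⟩
    exact ⟨σ, h⟩
  · rintro ⟨σ, h⟩
    exact ⟨_, h, rfl⟩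

theorem primrecPred_label [Finite N] [Finite W] [Finite X] (P : VLabel N W X → Prop)
    (hf : Primrec f) (hx : Primrec x) :
    PrimrecPred fun a => ∃ q ∈ (f a).verts, q.1 = x a ∧ P q.2 :=
  exists_mem' (by fun_prop) (and' (by fun_prop) (of_finite P (by fun_prop)))

variable [Finite N] [Finite W] [Finite X]

@[fun_prop] theorem primrecPred_isNode (hf : Primrec f) (hx : Primrec x) :
    PrimrecPred fun a => (f a).IsNode (x a) := by
  refine (primrecPred_label (fun σ => ∃ n, σ = VLabel.node n) hf hx).of_eq fun a => ?_
  constructor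
  · rintro ⟨⟨_, _⟩, h, rfl, n, rfl⟩
    exact ⟨n, h⟩
  · rintro ⟨n, h⟩
    exact ⟨_, h, rfl, n, rfl⟩

@[fun_prop] theorem primrecPred_isWire (hf : Primrec f) (hx : Primrec x) :
    PrimrecPred fun a => (f a).IsWire (x a) := by
  refine (primrecPred_label (fun σ => ∃ n, σ = VLabel.wire n) hf hx).of_eq fun a => ?_
  constructor
  · rintro ⟨⟨_, _⟩, h, rfl, n, rfl⟩
    exact ⟨n, h⟩
  · rintro ⟨n, h⟩
    exact ⟨_, h, rfl, n, rfl⟩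

theorem primrecPred_no_nonterminal (hf : Primrec f) :
    PrimrecPred fun a => ∀ x, ¬ (f a).IsNonterminal x := by
  have : PrimrecPred fun a => ∀ q ∈ (f a).verts, ¬ ∃ Y, q.2 = VLabel.nonterminal Y :=
    forall_mem' (by fun_prop) (of_finite (fun σ : VLabel N W X => ¬ ∃ Y, σ = VLabel.nonterminal Y)
      (by fun_prop))
  refine this.of_eq fun a => ?_
  constructor
  · rintro h x ⟨Y, hY⟩
    exact h _ hY ⟨Y, rfl⟩
  · rintro h ⟨x, σ⟩ hx ⟨Y, rfl⟩
    exact h x ⟨Y, hx⟩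

@[fun_prop] theorem primrecPred_isBoundary (hf : Primrec f) (hx : Primrec x) :
    PrimrecPred fun a => (f a).IsBoundary (x a) := by
  have : PrimrecPred fun a =>
      ((f a).IsWire (x a) ∧ ¬ ∃ e ∈ (f a).edges, e.2.2 = x a) ∨
      ((f a).IsWire (x a) ∧ ¬ ∃ e ∈ (f a).edges, e.1 = x a) := by fun_prop
  refine this.of_eq fun a => ?_
  simp only [IsBoundary, IsInput, IsOutput, Prod.exists, not_exists, not_and]
  grind

@[fun_prop] theorem primrecPred_mono (hf : Primrec f) (hx : Primrec x) (hy : Primrec y) :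
    PrimrecPred fun a => (f a).Mono (x a) (y a) := by
  have : PrimrecPred fun a => ∃ q ∈ (f a).verts, ∃ q' ∈ (f a).verts, ∃ e ∈ (f a).edges,
      (q.1 = x a ∧ q'.1 = y a ∧ q.2 = q'.2 ∧ e.1 = x a ∧ e.2.2 = y a) ∧
        ∃ w, q.2 = VLabel.wire w := by
    refine exists_mem' (by fun_prop) (exists_mem' (by fun_prop) (exists_mem' (by fun_prop)
      (and' (by fun_prop) ?_)))
    exact of_finite (fun σ : VLabel N W X => ∃ w, σ = VLabel.wire w) (by fun_prop)
  refine this.of_eq fun a => ?_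
  constructor
  · rintro ⟨⟨_, _⟩, h1, ⟨_, _⟩, h2, ⟨_, γ, _⟩, h3, ⟨rfl, rfl, h4, rfl, rfl⟩, w, rfl⟩
    simp only at h4 h1 h2 h3
    subst h4
    exact ⟨w, γ, h1, h2, h3⟩
  · rintro ⟨w, γ, h1, h2, h3⟩
    exact ⟨_, h1, _, h2, _, h3, ⟨rfl, rfl, rfl, rfl, rfl⟩, w, rfl⟩

omit [Primcodable N] [Primcodable W] [Primcodable X] [Primcodable E] [Primcodable F]
  [Finite N] [Finite W] [Finite X] in
theorem Mono.mem_names {G : LGraph N W X E F} {x y : ℕ} (h : G.Mono x y) :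
    x ∈ G.names ∧ y ∈ G.names :=
  let ⟨_, _, _, _, he⟩ := h
  mem_names_of_mem_edges he

omit [Primcodable N] [Primcodable W] [Primcodable X] [Primcodable E] [Primcodable F]
  [Finite N] [Finite W] [Finite X] in
/-- Segments are described by quantification over all sets of names. -/
theorem segment_iff_forall_sublists {G : LGraph N W X E F} {x y : ℕ} :
    G.Segment x y ↔ x = y ∨ (G.IsVertex x ∧ G.IsVertex y ∧ ∀ U ∈ sublists G.names,
      (∀ e ∈ G.edges, G.Mono e.1 e.2.2 → (e.1 ∈ U ↔ e.2.2 ∈ U)) → (x ∈ U ↔ y ∈ U)) := by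
  classical
  constructor
  · intro h
    rcases h.eq_or_isVertex with h1 | ⟨h1, h2⟩
    · exact .inl h1
    refine .inr ⟨h1, h2, fun U _ hU => ?_⟩
    clear h1 h2
    induction h with
    | rel x y h =>
      obtain ⟨-, γ, -, -, he⟩ := id h
      exact hU _ he h
    | refl => rfl
    | symm _ _ _ ih => exact ih.symm
    | trans _ _ _ _ _ ih₁ ih₂ => exact ih₁.trans ih₂
  · rintro (rfl | ⟨hx, hy, h⟩)
    · exact .refl _ _
    have := (h _ (filter_mem_sublists (fun z => decide (G.Segment x z)) G.names) ?_).1 ?_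
    · simpa using (List.mem_filter.1 this).2
    · intro e he hm
      obtain ⟨h1, h2⟩ := hm.mem_names
      simp only [List.mem_filter, h1, h2, true_and, decide_eq_true_eq]
      exact ⟨fun h => h.trans hm.segment, fun h => h.trans hm.segment.symm⟩
    · simpa using And.intro hx.mem_names (Segment.refl G x)

@[fun_prop] theorem primrecPred_segment (hf : Primrec f) (hx : Primrec x) (hy : Primrec y) :
    PrimrecPred fun a => (f a).Segment (x a) (y a) := by
  refine PrimrecPred.of_eq ?_ fun a => segment_iff_forall_sublists.symm
  refine or' (by fun_prop) (and' (by fun_prop) (and' (by fun_prop) (forall_mem' (by fun_prop)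
    (imp' (forall_mem' (by fun_prop) (imp' ?_ ?_)) ?_)))) <;> fun_prop

@[fun_prop] theorem primrecPred_hasEnd (hf : Primrec f) (hx : Primrec x) :
    PrimrecPred fun a => (f a).HasEnd (x a) := by
  have : PrimrecPred fun a => ∃ z ∈ x a :: (f a).names, (f a).Segment z (x a) ∧
      ¬ ∃ t ∈ (f a).names, (f a).Mono z t := by fun_prop
  refine this.of_eq fun a => ?_
  constructor
  · rintro ⟨z, -, h1, h2⟩
    exact ⟨z, h1, fun t ht => h2 ⟨t, ht.mem_names.2, ht⟩⟩
  · rintro ⟨z, h1, h2⟩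
    refine ⟨z, ?_, h1, fun ⟨t, _, ht⟩ => h2 t ht⟩
    rcases h1.eq_or_isVertex with rfl | ⟨h, -⟩
    · exact List.mem_cons_self
    · exact List.mem_cons_of_mem _ h.mem_names

omit [Finite N] [Finite W] [Finite X] in
theorem primrecPred_no_enc [Finite E] [Finite F] (hf : Primrec f) :
    PrimrecPred fun a => ∀ x α y, (x, ELabel.enc α, y) ∉ (f a).edges := by
  have : PrimrecPred fun a => ∀ e ∈ (f a).edges, ¬ ∃ α, e.2.1 = ELabel.enc α :=
    forall_mem' (by fun_prop) (of_finite (fun γ : ELabel E F => ¬ ∃ α, γ = ELabel.enc α)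
      (by fun_prop))
  refine this.of_eq fun a => ?_
  constructor
  · exact fun h x α y hx => h _ hx ⟨α, rfl⟩
  · rintro h ⟨x, _, y⟩ hx ⟨α, rfl⟩
    exact h x α y hx

@[fun_prop] theorem primrecPred_isStringGraph [Finite E] [Finite F] (hf : Primrec f) :
    PrimrecPred fun a => (f a).IsStringGraph := by
  have h1 : PrimrecPred fun a => ((f a).verts.map fun q => q.1).Nodup := by fun_prop
  have h2 : PrimrecPred fun a => ∀ e ∈ (f a).edges,
      ((f a).IsVertex e.1 ∧ (f a).IsVertex e.2.2 ∧ e.1 ≠ e.2.2) ∧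
        ¬ ((f a).IsNode e.1 ∧ (f a).IsNode e.2.2) := by
    refine forall_mem' (by fun_prop) ?_
    fun_prop
  have h3 : PrimrecPred fun a => ∀ e ∈ (f a).edges, ∀ e' ∈ (f a).edges,
      ((f a).IsWire e.2.2 → e.2.2 = e'.2.2 → e.1 = e'.1 ∧ e.2.1 = e'.2.1) ∧
        ((f a).IsWire e.1 → e.1 = e'.1 → e.2.2 = e'.2.2 ∧ e.2.1 = e'.2.1) := by
    refine forall_mem' (by fun_prop) (forall_mem' (by fun_prop) (and' (imp' ?_ (imp' ?_ ?_))
      (imp' ?_ (imp' ?_ ?_)))) <;> fun_prop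
  refine ((h1.and (primrecPred_no_nonterminal hf)).and
    ((primrecPred_no_enc hf).and (h2.and h3))).of_eq fun a => ?_
  constructor
  · rintro ⟨⟨h1, h2⟩, h3, h4, h5⟩
    refine ⟨⟨h1, fun x γ y h => (h4 _ h).1⟩, h2, h3, fun x γ y h => (h4 _ h).2, fun w hw => ⟨?_, ?_⟩⟩
    · intro x γ x' γ' h h'
      exact (h5 _ h _ h').1 hw rfl
    · intro y γ y' γ' h h'
      exact (h5 _ h _ h').2 hw rfl
  · intro h
    refine ⟨⟨h.wellFormed.1, h.no_nonterminal⟩, h.no_enc, fun e he =>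
      ⟨h.wellFormed.2 _ _ _ he, h.no_node_node _ _ _ he⟩, ?_⟩
    rintro ⟨x, γ, y⟩ he ⟨x', γ', y'⟩ he'
    constructor
    · rintro hw rfl
      exact (h.wire_degrees _ hw).1 _ _ _ _ he he'
    · rintro hw rfl
      exact (h.wire_degrees _ hw).2 _ _ _ _ he he'

omit [Primcodable N] [Primcodable W] [Primcodable X] [Primcodable E] [Primcodable F]
  [Finite N] [Finite W] [Finite X] in
theorem isSim_iff_forall_mem {G G' : LGraph N W X E F} {r : List (ℕ × ℕ)} :
    IsSim G G' (fun x y => (x, y) ∈ r) ↔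
      ((∀ p ∈ r, ∃ q ∈ G.verts, q.1 = p.1 ∧ (p.2, q.2) ∈ G'.verts) ∧
        (∀ q ∈ G.verts, ∃ p ∈ r, p.1 = q.1) ∧ (∀ q ∈ G'.verts, ∃ p ∈ r, p.2 = q.1)) ∧
      (∀ p ∈ r, ∀ p' ∈ r, (G.Segment p.1 p'.1 ↔ G'.Segment p.2 p'.2)) ∧
      ((∀ e ∈ G.edges, G.Mono e.1 e.2.2 ∨ ∃ p ∈ r, ∃ p' ∈ r, p.1 = e.1 ∧ p'.1 = e.2.2 ∧
        (p.2, e.2.1, p'.2) ∈ G'.edges ∧ ¬ G'.Mono p.2 p'.2) ∧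
       (∀ e ∈ G'.edges, G'.Mono e.1 e.2.2 ∨ ∃ p ∈ r, ∃ p' ∈ r, p.2 = e.1 ∧ p'.2 = e.2.2 ∧
        (p.1, e.2.1, p'.1) ∈ G.edges ∧ ¬ G.Mono p.1 p'.1)) ∧
      (∀ p ∈ r, (G.HasEnd p.1 ↔ G'.HasEnd p.2)) := by
  constructor
  · intro h
    refine ⟨⟨?_, ?_, ?_⟩, fun p hp p' hp' => h.segment _ _ _ _ hp hp', ⟨?_, ?_⟩,
      fun p hp => h.hasEnd _ _ hp⟩
    · intro p hp
      obtain ⟨σ, h1, h2⟩ := h.label _ _ hp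
      exact ⟨_, h1, rfl, h2⟩
    · intro q hq
      obtain ⟨y, hy⟩ := h.total q.1 ⟨_, hq⟩
      exact ⟨_, hy, rfl⟩
    · intro q hq
      obtain ⟨y, hy⟩ := h.surj q.1 ⟨_, hq⟩
      exact ⟨_, hy, rfl⟩
    · intro e he
      by_cases hm : G.Mono e.1 e.2.2
      · exact .inl hm
      · obtain ⟨y, y', h1, h2, h3⟩ := h.edge _ _ _ he hm
        exact .inr ⟨_, h1, _, h2, rfl, rfl, h3⟩
    · intro e he
      by_cases hm : G'.Mono e.1 e.2.2
      · exact .inl hm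
      · obtain ⟨y, y', h1, h2, h3⟩ := h.edge' _ _ _ he hm
        exact .inr ⟨_, h1, _, h2, rfl, rfl, h3⟩
  · rintro ⟨⟨h1, h2, h3⟩, h4, ⟨h5, h6⟩, h7⟩
    refine ⟨?_, ?_, ?_, fun x y x' y' h h' => h4 _ h _ h', ?_, ?_, fun x y h => h7 _ h⟩
    · intro x y h
      obtain ⟨⟨_, σ⟩, hq, rfl, h'⟩ := h1 _ h
      exact ⟨σ, hq, h'⟩
    · rintro x ⟨σ, hσ⟩
      obtain ⟨⟨_, y⟩, hp, rfl⟩ := h2 _ hσ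
      exact ⟨y, hp⟩
    · rintro x ⟨σ, hσ⟩
      obtain ⟨⟨y, _⟩, hp, rfl⟩ := h3 _ hσ
      exact ⟨y, hp⟩
    · intro x γ x' he hm
      obtain ⟨⟨_, y⟩, hp, ⟨_, y'⟩, hp', rfl, rfl, h⟩ := (h5 _ he).resolve_left hm
      exact ⟨y, y', hp, hp', h⟩
    · intro x γ x' he hm
      obtain ⟨⟨y, _⟩, hp, ⟨y', _⟩, hp', rfl, rfl, h⟩ := (h6 _ he).resolve_left hm
      exact ⟨y, y', hp, hp', h⟩

theorem primrecPred_isSim {r : α → List (ℕ × ℕ)} (hf : Primrec f) (hg : Primrec g)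
    (hr : Primrec r) : PrimrecPred fun a => IsSim (f a) (g a) (fun x y => (x, y) ∈ r a) := by
  refine PrimrecPred.of_eq ?_ fun a => isSim_iff_forall_mem.symm
  refine and' (and' ?_ (and' ?_ ?_)) (and' ?_ (and' (and' ?_ ?_) ?_))
  · exact forall_mem' (by fun_prop) (by fun_prop)
  · exact forall_mem' (by fun_prop) (by fun_prop)
  · exact forall_mem' (by fun_prop) (by fun_prop)
  · exact forall_mem' (by fun_prop) (forall_mem' (by fun_prop) (by fun_prop))
  · exact forall_mem' (by fun_prop) (by fun_prop)
  · exact forall_mem' (by fun_prop) (by fun_prop)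
  · exact forall_mem' (by fun_prop) (by fun_prop)

theorem primrecPred_exists_isSim (hf : Primrec f) (hg : Primrec g) :
    PrimrecPred fun a => ∃ ρ, IsSim (f a) (g a) ρ := by
  classical
  have : PrimrecPred fun a => ∃ r ∈ sublists (pairs (f a).names (g a).names),
      IsSim (f a) (g a) (fun x y => (x, y) ∈ r) :=
    exists_mem' (by fun_prop) (primrecPred_isSim (by fun_prop) (by fun_prop) (by fun_prop))
  refine this.of_eq fun a => ⟨fun ⟨r, _, h⟩ => ⟨_, h⟩, ?_⟩
  rintro ⟨ρ, hρ⟩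
  refine ⟨_, filter_mem_sublists (fun p => decide (ρ p.1 p.2)) _, ?_⟩
  convert! hρ with x y
  simp only [List.mem_filter, mem_pairs, decide_eq_true_eq]
  refine ⟨fun h => h.2, fun h => ⟨?_, h⟩⟩
  obtain ⟨σ, h1, h2⟩ := hρ.label x y h
  exact ⟨IsVertex.mem_names ⟨σ, h1⟩, IsVertex.mem_names ⟨σ, h2⟩⟩

omit [Primcodable N] [Primcodable W] [Primcodable X] [Primcodable E] [Primcodable F]
  [Finite N] [Finite W] [Finite X] in
/-- Embeddings are described by quantification over all relations between the names. -/
theorem exists_isEmbedding_iff {K H : LGraph N W X E F} : (∃ m, K.IsEmbedding H m) ↔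
    ∃ r ∈ sublists (pairs K.names H.names),
      ((∀ p ∈ r, ∀ p' ∈ r, p.1 = p'.1 → p.2 = p'.2) ∧
        (∀ p ∈ r, ∀ p' ∈ r, K.IsVertex p.1 → K.IsVertex p'.1 → p.2 = p'.2 → p.1 = p'.1)) ∧
      ((∀ q ∈ K.verts, ∃ p ∈ r, p.1 = q.1 ∧ (p.2, q.2) ∈ H.verts) ∧
        (∀ e ∈ K.edges, ∃ p ∈ r, ∃ p' ∈ r, p.1 = e.1 ∧ p'.1 = e.2.2 ∧
          (p.2, e.2.1, p'.2) ∈ H.edges)) ∧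
      (∀ p ∈ r, K.IsVertex p.1 → ∀ e ∈ H.edges,
        (e.1 = p.2 → (∃ p' ∈ r, p'.2 = e.2.2 ∧ K.IsVertex p'.1) ∨ K.IsBoundary p.1) ∧
        (e.2.2 = p.2 → (∃ p' ∈ r, p'.2 = e.1 ∧ K.IsVertex p'.1) ∨ K.IsBoundary p.1)) := by
  classical
  constructor
  · rintro ⟨m, hm⟩
    have hr : ∀ p : ℕ × ℕ, p ∈ (pairs K.names H.names).filter (fun p => decide (p.2 = m p.1)) ↔
        (p.1 ∈ K.names ∧ p.2 ∈ H.names) ∧ p.2 = m p.1 := by simp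
    have hv : ∀ x, K.IsVertex x →
        (x, m x) ∈ (pairs K.names H.names).filter (fun p => decide (p.2 = m p.1)) := by
      rintro x ⟨σ, hσ⟩
      exact (hr _).2 ⟨⟨IsVertex.mem_names ⟨σ, hσ⟩, IsVertex.mem_names ⟨σ, hm.map_vert _ _ hσ⟩⟩, rfl⟩
    refine ⟨_, filter_mem_sublists (fun p => decide (p.2 = m p.1)) _, ⟨?_, ?_⟩, ⟨?_, ?_⟩, ?_⟩
    · intro p hp p' hp' h
      rw [((hr _).1 hp).2, ((hr _).1 hp').2, h]
    · intro p hp p' hp' h1 h2 h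
      rw [((hr _).1 hp).2, ((hr _).1 hp').2] at h
      exact hm.injOn h1 h2 h
    · intro q hq
      exact ⟨_, hv q.1 ⟨_, hq⟩, rfl, hm.map_vert _ _ hq⟩
    · intro e he
      have h1 := hm.map_edge _ _ _ he
      obtain ⟨h2, h3⟩ := mem_names_of_mem_edges he
      obtain ⟨h4, h5⟩ := mem_names_of_mem_edges h1
      exact ⟨(e.1, m e.1), (hr _).2 ⟨⟨h2, h4⟩, rfl⟩, (e.2.2, m e.2.2),
        (hr _).2 ⟨⟨h3, h5⟩, rfl⟩, rfl, rfl, h1⟩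
    · rintro ⟨x, y⟩ hp hx ⟨z, γ, z'⟩ he
      obtain rfl : y = m x := ((hr _).1 hp).2
      constructor
      · rintro rfl
        by_cases hz : z' ∈ m '' {y | K.IsVertex y}
        · obtain ⟨u, hu, rfl⟩ := hz
          exact .inl ⟨_, hv u hu, rfl, hu⟩
        · exact .inr (hm.dangling_out _ _ _ hx he hz)
      · rintro rfl
        by_cases hz : z ∈ m '' {y | K.IsVertex y}
        · obtain ⟨u, hu, rfl⟩ := hz
          exact .inl ⟨_, hv u hu, rfl, hu⟩
        · exact .inr (hm.dangling_in _ _ _ hx he hz)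
  · rintro ⟨r, -, ⟨h1, h2⟩, ⟨h3, h4⟩, h5⟩
    let m : ℕ → ℕ := fun x => if h : ∃ y, (x, y) ∈ r then h.choose else 0
    have hm : ∀ x y, (x, y) ∈ r → m x = y := by
      intro x y hxy
      have h : ∃ y, (x, y) ∈ r := ⟨y, hxy⟩
      simp only [m, dif_pos h]
      exact h1 _ h.choose_spec _ hxy rfl
    have hv : ∀ x, K.IsVertex x → (x, m x) ∈ r := by
      rintro x ⟨σ, hσ⟩
      obtain ⟨⟨_, y⟩, hp, rfl, -⟩ := h3 _ hσ
      rwa [hm _ _ hp]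
    refine ⟨m, ?_, ?_, ?_, ?_, ?_⟩
    · intro x σ hx
      obtain ⟨⟨_, y⟩, hp, rfl, h⟩ := h3 _ hx
      rwa [hm _ _ hp]
    · intro x γ y hxy
      obtain ⟨⟨_, u⟩, hp, ⟨_, v⟩, hp', rfl, rfl, h⟩ := h4 _ hxy
      rwa [hm _ _ hp, hm _ _ hp']
    · intro x hx y hy hxy
      exact h2 _ (hv x hx) _ (hv y hy) hx hy hxy
    · intro x γ z hx he hz
      rcases (h5 _ (hv x hx) hx _ he).1 rfl with ⟨⟨u, v⟩, hp, h6, hu⟩ | h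
      · exact absurd ⟨u, hu, (hm _ _ hp).trans h6⟩ hz
      · exact h
    · intro x γ z hx he hz
      rcases (h5 _ (hv x hx) hx _ he).2 rfl with ⟨⟨u, v⟩, hp, h6, hu⟩ | h
      · exact absurd ⟨u, hu, (hm _ _ hp).trans h6⟩ hz
      · exact h

theorem primrecPred_exists_isEmbedding (hf : Primrec f) (hg : Primrec g) :
    PrimrecPred fun a => ∃ m, (f a).IsEmbedding (g a) m := by
  refine PrimrecPred.of_eq ?_ fun a => exists_isEmbedding_iff.symm
  refine exists_mem' (by fun_prop) (and' (and' ?_ ?_) (and' (and' ?_ ?_) ?_))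
  · refine forall_mem' (by fun_prop) (forall_mem' (by fun_prop) (imp' ?_ ?_)) <;> fun_prop
  · refine forall_mem' (by fun_prop) (forall_mem' (by fun_prop)
      (imp' ?_ (imp' ?_ (imp' ?_ ?_)))) <;> fun_prop
  · exact forall_mem' (by fun_prop) (by fun_prop)
  · exact forall_mem' (by fun_prop) (by fun_prop)
  · refine forall_mem' (by fun_prop) (imp' (by fun_prop) (forall_mem' (by fun_prop)
      (and' (imp' ?_ ?_) (imp' ?_ ?_)))) <;> fun_prop

end LGraph

end Graphs

/-! ### Decidability of matching -/

section Matching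

variable {N W X E F : Type*}

namespace LGraph

theorem Iso.isStringGraph {G G' : LGraph N W X E F} (h : G.Iso G') (hG : G.IsStringGraph)
    (hG' : (G'.verts.map Prod.fst).Nodup) : G'.IsStringGraph := by
  obtain ⟨φ, hv, he⟩ := h.symm
  refine ⟨⟨hG', fun x γ y h => ?_⟩, ?_, fun x α y h => hG.no_enc _ _ _ ((he _ _ _).1 h), ?_, ?_⟩
  · obtain ⟨⟨σ, h1⟩, ⟨τ, h2⟩, h3⟩ := hG.wellFormed.2 _ _ _ ((he _ _ _).1 h)
    exact ⟨⟨σ, (hv _ _).2 h1⟩, ⟨τ, (hv _ _).2 h2⟩, fun hxy => h3 (congrArg φ hxy)⟩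
  · rintro x ⟨Y, h⟩
    exact hG.no_nonterminal _ ⟨Y, (hv _ _).1 h⟩
  · rintro x γ y h ⟨⟨n, h1⟩, ⟨n', h2⟩⟩
    exact hG.no_node_node _ _ _ ((he _ _ _).1 h) ⟨⟨n, (hv _ _).1 h1⟩, ⟨n', (hv _ _).1 h2⟩⟩
  · rintro z ⟨w, hw⟩
    obtain ⟨h1, h2⟩ := hG.wire_degrees (φ z) ⟨w, (hv _ _).1 hw⟩
    refine ⟨fun x γ x' γ' h h' => ?_, fun y γ y' γ' h h' => ?_⟩
    · exact (h1 _ _ _ _ ((he _ _ _).1 h) ((he _ _ _).1 h')).imp_left fun h => φ.injective h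
    · exact (h2 _ _ _ _ ((he _ _ _).1 h) ((he _ _ _).1 h')).imp_left fun h => φ.injective h

theorem Iso.wireHomeomorphic {G G' : LGraph N W X E F} (h : G.Iso G') (hG : G.IsStringGraph)
    (hG' : G'.IsStringGraph) : G.WireHomeomorphic G' :=
  .rel _ _ ⟨hG, hG', .inl h⟩

theorem IsEmbedding.iso {K G G' : LGraph N W X E F} {m : ℕ → ℕ} (hm : K.IsEmbedding G m)
    (h : G.Iso G') : ∃ m', K.IsEmbedding G' m' := by
  obtain ⟨φ, hv, he⟩ := h
  have hmem : ∀ z : ℕ, φ z ∉ (fun x => φ (m x)) '' {y | K.IsVertex y} →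
      z ∉ m '' {y | K.IsVertex y} := by
    rintro z hz ⟨y, hy, rfl⟩
    exact hz ⟨y, hy, rfl⟩
  refine ⟨fun x => φ (m x), fun x σ h => (hv _ _).1 (hm.map_vert _ _ h),
    fun x γ y h => (he _ _ _).1 (hm.map_edge _ _ _ h),
    fun x hx y hy hxy => hm.injOn hx hy (φ.injective hxy), fun x γ z hx h hz => ?_,
    fun x γ z hx h hz => ?_⟩
  · obtain ⟨z, rfl⟩ := φ.surjective z
    exact hm.dangling_out x γ z hx ((he _ _ _).2 h) (hmem z hz)
  · obtain ⟨z, rfl⟩ := φ.surjective z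
    exact hm.dangling_in x γ z hx ((he _ _ _).2 h) (hmem z hz)

/-- The vertices of a graph can be renamed to be smaller than its number of vertices. -/
theorem exists_equiv_lt (G : LGraph N W X E F) :
    ∃ φ : ℕ ≃ ℕ, ∀ x, G.IsVertex x → φ x < G.verts.length := by
  have hmem : ∀ x, G.IsVertex x → x ∈ G.verts.map Prod.fst := by
    rintro x ⟨σ, hσ⟩
    exact List.mem_map.2 ⟨_, hσ, rfl⟩
  let e : {x | G.IsVertex x} ↪ ℕ := ⟨fun x => (G.verts.map Prod.fst).idxOf x.1, fun x y hxy =>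
    Subtype.ext ((List.idxOf_inj (hmem _ x.2)).1 hxy)⟩
  obtain ⟨φ, hφ⟩ := Cardinal.extend_function_of_lt e
    (by rw [Cardinal.mk_nat]; exact Cardinal.lt_aleph0_iff_set_finite.2
          ((List.finite_toSet (G.verts.map Prod.fst)).subset hmem)) ⟨Equiv.refl ℕ⟩
  refine ⟨φ, fun x hx => ?_⟩
  rw [show φ x = (G.verts.map Prod.fst).idxOf x from hφ ⟨x, hx⟩]
  simpa using List.idxOf_lt_length_of_mem (hmem x hx)

end LGraph

/-- A list of all elements of a finite type. -/
noncomputable def elems (α : Type*) [Finite α] : List α :=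
  (@Finset.univ α (Fintype.ofFinite α)).toList

theorem mem_elems {α : Type*} [Finite α] (a : α) : a ∈ elems α := by simp [elems]

theorem nodup_elems (α : Type*) [Finite α] : (elems α).Nodup := Finset.nodup_toList _

theorem nodup_pairs {α β : Type*} {l : List α} {l' : List β} (h : l.Nodup) (h' : l'.Nodup) :
    (pairs l l').Nodup := List.Nodup.product h h'

variable [Finite N] [Finite W] [Finite X] [Finite E] [Finite F]

namespace LGraph

variable (N W X E F) in
/-- A list of graphs with vertex names less than `n`, containing a copy of every string graph
with at most `n` vertices. -/
noncomputable def allGraphs (n : ℕ) : List (LGraph N W X E F) :=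
  (pairs (sublists (pairs (List.range n) (elems (VLabel N W X))))
    (sublists (pairs (List.range n) (pairs (elems (ELabel E F)) (List.range n))))).map
    fun t => ⟨t.1, t.2⟩

theorem IsStringGraph.exists_mem_allGraphs {G : LGraph N W X E F} (hG : G.IsStringGraph) {n : ℕ}
    (hn : G.verts.length ≤ n) :
    ∃ G' ∈ allGraphs N W X E F n, G'.IsStringGraph ∧ G.Iso G' := by
  classical
  obtain ⟨φ, hφ⟩ := G.exists_equiv_lt
  let V := (pairs (List.range n) (elems (VLabel N W X))).filter
    fun q => decide ((φ.symm q.1, q.2) ∈ G.verts)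
  let A := (pairs (List.range n) (pairs (elems (ELabel E F)) (List.range n))).filter
    fun e => decide ((φ.symm e.1, e.2.1, φ.symm e.2.2) ∈ G.edges)
  have hlt : ∀ x, G.IsVertex x → φ x < n := fun x hx => (hφ x hx).trans_le hn
  have hV : ∀ x σ, (x, σ) ∈ V ↔ (φ.symm x, σ) ∈ G.verts := by
    intro x σ
    simp only [V, List.mem_filter, mem_pairs, List.mem_range, mem_elems, and_true,
      decide_eq_true_eq, and_iff_right_iff_imp]
    intro h
    simpa using hlt _ ⟨σ, h⟩
  have hA : ∀ x γ y, (x, γ, y) ∈ A ↔ (φ.symm x, γ, φ.symm y) ∈ G.edges := by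
    intro x γ y
    simp only [A, List.mem_filter, mem_pairs, List.mem_range, mem_elems, true_and,
      decide_eq_true_eq, and_iff_right_iff_imp]
    intro h
    obtain ⟨h1, h2, -⟩ := hG.wellFormed.2 _ _ _ h
    exact ⟨by simpa using hlt _ h1, by simpa using hlt _ h2⟩
  have hiso : G.Iso ⟨V, A⟩ := ⟨φ, fun x σ => by simp [hV], fun x γ y => by simp [hA]⟩
  refine ⟨⟨V, A⟩, List.mem_map.2 ⟨(V, A), mem_pairs.2 ⟨filter_mem_sublists _ _,
    filter_mem_sublists _ _⟩, rfl⟩, hiso.isStringGraph hG ?_, hiso⟩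
  refine List.Nodup.map_on ?_ ((nodup_pairs List.nodup_range (nodup_elems _)).filter _)
  rintro ⟨x, σ⟩ h ⟨_, τ⟩ h' rfl
  rw [label_unique hG.wellFormed.1 ((hV _ _).1 h) ((hV _ _).1 h')]

/-- The search for a matching can be restricted to finitely many graphs. -/
theorem IsStringGraph.matchesOnto_iff {H : LGraph N W X E F} (hH : H.IsStringGraph)
    (K : LGraph N W X E F) : K.MatchesOnto H ↔
      ∃ H' ∈ allGraphs N W X E F (K.names.length + 2 * H.verts.length),
        (H'.IsStringGraph ∧ ∃ ρ, IsSim H H' ρ) ∧ ∃ m, K.IsEmbedding H' m := by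
  constructor
  · intro h
    obtain ⟨G, h1, ⟨m, hm⟩, h3⟩ := h.exists_small hH
    have hG := h1.isStringGraph_iff.1 hH
    obtain ⟨G', h4, h5, h6⟩ := hG.exists_mem_allGraphs h3
    exact ⟨G', h4, ⟨h5, (wireHomeomorphic_iff hH h5).1 (.trans _ _ _ h1
      (h6.wireHomeomorphic hG h5))⟩, hm.iso h6⟩
  · rintro ⟨H', -, ⟨h1, h2⟩, h3⟩
    exact ⟨H', (wireHomeomorphic_iff hH h1).2 h2, h3⟩

variable [Primcodable N] [Primcodable W] [Primcodable X] [Primcodable E] [Primcodable F]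
variable {α : Type*} [Primcodable α]

open Prim

@[fun_prop] theorem primrec_allGraphs {n : α → ℕ} (hn : Primrec n) :
    Primrec fun a => allGraphs N W X E F (n a) := by
  unfold allGraphs
  fun_prop

/-- Matching of `K` onto `H` is a primitive recursive predicate of `K` and the string
graph `H`. -/
theorem exists_primrecPred_matchesOnto :
    ∃ P : LGraph N W X E F × LGraph N W X E F → Prop, PrimrecPred P ∧
      ∀ K H, H.IsStringGraph → (P (K, H) ↔ K.MatchesOnto H) := by
  refine ⟨fun p => ∃ H' ∈ allGraphs N W X E F (p.1.names.length + 2 * p.2.verts.length),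
    (H'.IsStringGraph ∧ ∃ ρ, IsSim p.2 H' ρ) ∧ ∃ m, p.1.IsEmbedding H' m, ?_,
    fun K H hH => (hH.matchesOnto_iff K).symm⟩
  exact exists_mem' (by fun_prop) (and' (and' (by fun_prop)
    (primrecPred_exists_isSim (by fun_prop) (by fun_prop)))
    (primrecPred_exists_isEmbedding (by fun_prop) (by fun_prop)))

end LGraph

end Matching

/-! ### Enumeration of derivations -/

section Enumeration

/-- The lists of at most `n` steps that can be performed one after the other, beginning in the
state `x`, together with the state reached; `next` lists the steps possible in a state and
their results. -/
def search {σ γ : Type*} (next : γ → List (σ × γ)) (n : ℕ) (x : γ) : List (List σ × γ) :=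
  (List.range (n + 1)).flatMap fun k =>
    (fun l => l.flatMap fun d => (next d.2).map fun e => (d.1 ++ [e.1], e.2))^[k] [([], x)]

theorem mem_search {σ γ : Type*} {next : γ → List (σ × γ)} {R : γ → List σ → γ → Prop}
    (hnil : ∀ x y, R x [] y ↔ y = x)
    (hcons : ∀ x e s y, R x (e :: s) y ↔ ∃ z, (e, z) ∈ next x ∧ R z s y)
    {n : ℕ} {x : γ} {d : List σ × γ} :
    d ∈ search next n x ↔ d.1.length ≤ n ∧ R x d.1 d.2 := by
  have key : ∀ (k : ℕ) (l : List (List σ × γ)) (d : List σ × γ),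
      d ∈ (fun l => l.flatMap fun d : List σ × γ =>
        (next d.2).map fun e => (d.1 ++ [e.1], e.2))^[k] l ↔
      ∃ c ∈ l, ∃ s, s.length = k ∧ d.1 = c.1 ++ s ∧ R c.2 s d.2 := by
    intro k
    induction k with
    | zero =>
      rintro l ⟨d, y⟩
      simp only [Function.iterate_zero, id, List.length_eq_zero_iff, exists_eq_left,
        List.append_nil, hnil]
      constructor
      · exact fun h => ⟨_, h, rfl, rfl⟩
      · rintro ⟨c, h, rfl, rfl⟩
        exact h
    | succ k ih =>
      rintro l ⟨d, y⟩
      rw [Function.iterate_succ, Function.comp_apply, ih]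
      constructor
      · rintro ⟨c, hc, s, rfl, rfl, h⟩
        obtain ⟨c', hc', hc⟩ := List.mem_flatMap.1 hc
        obtain ⟨⟨e, z⟩, he, rfl⟩ := List.mem_map.1 hc
        exact ⟨c', hc', e :: s, rfl, by simp, (hcons _ _ _ _).2 ⟨z, he, h⟩⟩
      · rintro ⟨c, hc, s, hs, hd, h⟩
        obtain _ | ⟨e, s⟩ := s
        · simp at hs
        obtain ⟨z, he, h⟩ := (hcons _ _ _ _).1 h
        exact ⟨(c.1 ++ [e], z), List.mem_flatMap.2 ⟨c, hc, List.mem_map.2 ⟨_, he, rfl⟩⟩, s,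
          by simpa using hs, by simpa using hd, h⟩
  simp only [search, List.mem_flatMap, List.mem_range, key, List.mem_singleton, exists_eq_left,
    List.nil_append]
  constructor
  · rintro ⟨k, hk, s, rfl, rfl, h⟩
    exact ⟨by omega, h⟩
  · rintro ⟨h, h'⟩
    exact ⟨_, by omega, _, rfl, rfl, h'⟩

variable {N W X E F : Type*}

namespace Grammar

variable [DecidableEq N] [DecidableEq W] [DecidableEq X] [DecidableEq E] [DecidableEq F]

/-- The derivation steps possible in `H`, with their results. -/
def derivationSteps (B : Grammar N W X E F) (H : LGraph N W X E F) :
    List ((ℕ × ℕ) × LGraph N W X E F) :=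
  H.verts.flatMap fun q => (List.range B.productions.length).flatMap fun i =>
    (B.productions[i]?.toList.filter fun p => q.2 = VLabel.nonterminal p.lhs).map fun p =>
      ((q.1, i), H.subst q.1 p)

/-- The decoding steps possible in `H`, with their results. -/
def decodingSteps (B : Grammar N W X E F) (H : LGraph N W X E F) :
    List ((ℕ × E × ℕ) × LGraph N W X E F) :=
  H.edges.flatMap fun e => (B.decoding.filter fun r => e.2.1 = ELabel.enc r.symbol ∧
    (e.1, VLabel.node r.srcLabel) ∈ H.verts ∧ (e.2.2, VLabel.node r.tgtLabel) ∈ H.verts).map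
      fun r => ((e.1, r.symbol, e.2.2), H.decode e.1 e.2.2 r)

theorem mem_search_derivationSteps {B : Grammar N W X E F} {n : ℕ} {H : LGraph N W X E F}
    {d : List (ℕ × ℕ) × LGraph N W X E F} :
    d ∈ search B.derivationSteps n H ↔ d.1.length ≤ n ∧ B.Derives H d.1 d.2 := by
  refine mem_search (R := B.Derives) (fun H K => ⟨?_, ?_⟩) (fun H e s K => ⟨?_, ?_⟩)
  · rintro ⟨⟩
    rfl
  · rintro rfl
    exact .nil _
  · rintro (_ | ⟨h1, h2, h3⟩)
    refine ⟨_, ?_, h3⟩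
    refine List.mem_flatMap.2 ⟨_, h2, List.mem_flatMap.2 ⟨_, List.mem_range.2
      (List.getElem?_eq_some_iff.1 h1).1, List.mem_map.2 ⟨_, List.mem_filter.2
        ⟨Option.mem_toList.2 h1, by simp⟩, rfl⟩⟩⟩
  · rintro ⟨G, h, hG⟩
    simp only [derivationSteps, List.mem_flatMap, List.mem_map, List.mem_filter,
      Option.mem_toList, decide_eq_true_eq] at h
    obtain ⟨⟨v, σ⟩, hv, i, -, p, ⟨hp, rfl⟩, heq⟩ := h
    cases heq
    exact .cons hp hv hG

theorem mem_search_decodingSteps {B : Grammar N W X E F} {n : ℕ} {H : LGraph N W X E F}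
    {d : List (ℕ × E × ℕ) × LGraph N W X E F} :
    d ∈ search B.decodingSteps n H ↔ d.1.length ≤ n ∧ B.Decodes H d.1 d.2 := by
  refine mem_search (R := B.Decodes) (fun H K => ⟨?_, ?_⟩) (fun H e s K => ⟨?_, ?_⟩)
  · rintro ⟨⟩
    rfl
  · rintro rfl
    exact .nil _
  · rintro (_ | ⟨h1, h2, h3, h4, h5⟩)
    exact ⟨_, List.mem_flatMap.2 ⟨_, h2, List.mem_map.2 ⟨_, List.mem_filter.2
      ⟨h1, by simp [h3, h4]⟩, rfl⟩⟩, h5⟩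
  · rintro ⟨G, h, hG⟩
    simp only [decodingSteps, List.mem_flatMap, List.mem_map, List.mem_filter,
      decide_eq_true_eq] at h
    obtain ⟨⟨u, γ, v⟩, he, r, ⟨hr, rfl, h1, h2⟩, heq⟩ := h
    cases heq
    exact .cons hr he h1 h2 hG

end Grammar

variable [Primcodable N] [Primcodable W] [Primcodable X] [Primcodable E] [Primcodable F]
variable {α : Type*} [Primcodable α]

namespace Prim

@[fun_prop] theorem search' {σ γ : Type*} [Primcodable σ] [Primcodable γ]
    {next : α → γ → List (σ × γ)} {n : α → ℕ} {x : α → γ}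
    (hs : Primrec fun p : α × γ => next p.1 p.2) (hn : Primrec n) (hx : Primrec x) :
    Primrec fun a => search (next a) (n a) (x a) := by
  unfold search
  refine flatMap' (by fun_prop) ?_
  refine Primrec.nat_iterate (f := fun p : α × ℕ => p.2) (g := fun p => [([], x p.1)])
    (h := fun (p : α × ℕ) (l : List (List σ × γ)) => l.flatMap fun d =>
    (next p.1 d.2).map fun e => (d.1 ++ [e.1], e.2)) (by fun_prop) (by fun_prop) ?_
  exact flatMap' (by fun_prop) (map' (comp' (f := fun p : α × γ => next p.1 p.2)
    (g := fun p : ((α × ℕ) × List (List σ × γ)) × (List σ × γ) => (p.1.1.1, p.2.2)) hs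
      (by fun_prop)) (by fun_prop))

@[fun_prop] theorem pow' {f : α → ℕ} (hf : Primrec f) (k : ℕ) : Primrec fun a => f a ^ k := by
  induction k with
  | zero => simpa using Primrec.const 1
  | succ k ih =>
    simp only [pow_succ]
    fun_prop

end Prim

open Prim

@[fun_prop] theorem primrec_node {f : α → N} (hf : Primrec f) :
    Primrec fun a => (VLabel.node (f a) : VLabel N W X) :=
  (Primrec.of_equiv_symm (e := VLabel.equiv (N := N) (W := W) (X := X))).comp
    (Primrec.sumInl.comp hf)

@[fun_prop] theorem primrec_nonterminal {f : α → X} (hf : Primrec f) :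
    Primrec fun a => (VLabel.nonterminal (f a) : VLabel N W X) :=
  (Primrec.of_equiv_symm (e := VLabel.equiv (N := N) (W := W) (X := X))).comp
    (Primrec.sumInr.comp (Primrec.sumInr.comp hf))

@[fun_prop] theorem primrec_enc {f : α → E} (hf : Primrec f) :
    Primrec fun a => (ELabel.enc (f a) : ELabel E F) :=
  (Primrec.of_equiv_symm (e := ELabel.equiv (E := E) (F := F))).comp (Primrec.sumInl.comp hf)

namespace ConnInstr

variable {c : α → ConnInstr N W X E F}

theorem primrec_equiv (hc : Primrec c) : Primrec fun a => ConnInstr.equiv (c a) :=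
  (Primrec.of_equiv (e := ConnInstr.equiv)).comp hc

@[fun_prop] theorem primrec_label (hc : Primrec c) : Primrec fun a => (c a).label :=
  fst' (primrec_equiv hc)

@[fun_prop] theorem primrec_old (hc : Primrec c) : Primrec fun a => (c a).old :=
  fst' (snd' (primrec_equiv hc))

@[fun_prop] theorem primrec_new (hc : Primrec c) : Primrec fun a => (c a).new :=
  fst' (snd' (snd' (primrec_equiv hc)))

@[fun_prop] theorem primrec_vertex (hc : Primrec c) : Primrec fun a => (c a).vertex :=
  fst' (snd' (snd' (snd' (primrec_equiv hc))))

@[fun_prop] theorem primrec_dir (hc : Primrec c) : Primrec fun a => (c a).dir :=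
  snd' (snd' (snd' (snd' (primrec_equiv hc))))

end ConnInstr

namespace Production

variable {p : α → Production N W X E F}

theorem primrec_equiv (hp : Primrec p) : Primrec fun a => Production.equiv (p a) :=
  (Primrec.of_equiv (e := Production.equiv)).comp hp

@[fun_prop] theorem primrec_lhs (hp : Primrec p) : Primrec fun a => (p a).lhs :=
  fst' (primrec_equiv hp)

@[fun_prop] theorem primrec_body (hp : Primrec p) : Primrec fun a => (p a).body :=
  fst' (snd' (primrec_equiv hp))

@[fun_prop] theorem primrec_conn (hp : Primrec p) : Primrec fun a => (p a).conn :=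
  snd' (snd' (primrec_equiv hp))

end Production

namespace DecodingRule

variable {r : α → DecodingRule N W X E F}

theorem primrec_equiv (hr : Primrec r) : Primrec fun a => DecodingRule.equiv (r a) :=
  (Primrec.of_equiv (e := DecodingRule.equiv)).comp hr

@[fun_prop] theorem primrec_symbol (hr : Primrec r) : Primrec fun a => (r a).symbol :=
  fst' (primrec_equiv hr)

@[fun_prop] theorem primrec_srcLabel (hr : Primrec r) : Primrec fun a => (r a).srcLabel :=
  fst' (snd' (primrec_equiv hr))

@[fun_prop] theorem primrec_tgtLabel (hr : Primrec r) : Primrec fun a => (r a).tgtLabel :=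
  fst' (snd' (snd' (primrec_equiv hr)))

@[fun_prop] theorem primrec_rhs (hr : Primrec r) : Primrec fun a => (r a).rhs :=
  fst' (snd' (snd' (snd' (primrec_equiv hr))))

@[fun_prop] theorem primrec_src (hr : Primrec r) : Primrec fun a => (r a).src :=
  fst' (snd' (snd' (snd' (snd' (primrec_equiv hr)))))

@[fun_prop] theorem primrec_tgt (hr : Primrec r) : Primrec fun a => (r a).tgt :=
  snd' (snd' (snd' (snd' (snd' (primrec_equiv hr)))))

end DecodingRule

namespace Grammar

variable {B : α → Grammar N W X E F}

theorem primrec_equiv (hB : Primrec B) : Primrec fun a => Grammar.equiv (B a) :=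
  (Primrec.of_equiv (e := Grammar.equiv)).comp hB

@[fun_prop] theorem primrec_start (hB : Primrec B) : Primrec fun a => (B a).start :=
  fst' (primrec_equiv hB)

@[fun_prop] theorem primrec_productions (hB : Primrec B) : Primrec fun a => (B a).productions :=
  fst' (snd' (primrec_equiv hB))

@[fun_prop] theorem primrec_decoding (hB : Primrec B) : Primrec fun a => (B a).decoding :=
  snd' (snd' (primrec_equiv hB))

@[fun_prop] theorem primrec_startGraph (hB : Primrec B) : Primrec fun a => (B a).startGraph := by
  unfold startGraph
  fun_prop

@[fun_prop] theorem primrec_bodySize (hB : Primrec B) : Primrec fun a => (B a).bodySize := by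
  unfold bodySize List.sum
  exact foldr' (by fun_prop) (by fun_prop) (by fun_prop)

end Grammar

namespace LGraph

variable {f : α → LGraph N W X E F}

@[fun_prop] theorem primrec_fresh (hf : Primrec f) : Primrec fun a => (f a).fresh := by
  unfold fresh
  exact foldr' (by fun_prop) (by fun_prop) (by fun_prop)

variable [DecidableEq N] [DecidableEq W] [DecidableEq X] [DecidableEq E] [DecidableEq F]

@[fun_prop] theorem primrec_subst {v : α → ℕ} {p : α → Production N W X E F}
    (hf : Primrec f) (hv : Primrec v) (hp : Primrec p) :
    Primrec fun a => (f a).subst (v a) (p a) := by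
  unfold subst
  fun_prop

omit [DecidableEq N] [DecidableEq W] [DecidableEq X] in
@[fun_prop] theorem primrec_decode {u v : α → ℕ} {r : α → DecodingRule N W X E F}
    (hf : Primrec f) (hu : Primrec u) (hv : Primrec v) (hr : Primrec r) :
    Primrec fun a => (f a).decode (u a) (v a) (r a) := by
  simp only [decode]
  fun_prop

end LGraph

namespace Grammar

variable [DecidableEq N] [DecidableEq W] [DecidableEq X] [DecidableEq E] [DecidableEq F]
variable {B : α → Grammar N W X E F} {H : α → LGraph N W X E F}

@[fun_prop] theorem primrec_derivationSteps (hB : Primrec B) (hH : Primrec H) :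
    Primrec fun a => (B a).derivationSteps (H a) := by
  unfold derivationSteps
  fun_prop

@[fun_prop] theorem primrec_decodingSteps (hB : Primrec B) (hH : Primrec H) :
    Primrec fun a => (B a).decodingSteps (H a) := by
  unfold decodingSteps
  fun_prop

end Grammar

end Enumeration

end BESG

open BESG in
theorem mainTheorem3 (N W X E F : Type*)
    [Finite N] [Finite W] [Finite X] [Finite E] [Finite F]
    [DecidableEq N] [DecidableEq W] [DecidableEq X] [DecidableEq E] [DecidableEq F]
    [Primcodable N] [Primcodable W] [Primcodable X] [Primcodable E] [Primcodable F] :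
    ∃ enumerate : Grammar N W X E F × LGraph N W X E F →
        List ((List (ℕ × ℕ) × List (ℕ × E × ℕ)) × LGraph N W X E F),
      Computable enumerate ∧
      ∀ (B : Grammar N W X E F) (H : LGraph N W X E F),
        B.IsBESG → B.IsMatchExhaustive → H.IsStringGraph →
          {d : (List (ℕ × ℕ) × List (ℕ × E × ℕ)) × LGraph N W X E F |
            B.IsConcreteDerivation d.1.1 d.1.2 d.2 ∧ d.2.MatchesOnto H}.Finite ∧
          ∀ s t K, ((s, t), K) ∈ enumerate (B, H) ↔
            B.IsConcreteDerivation s t K ∧ K.MatchesOnto H := by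
  classical
  obtain ⟨P, hP, hPm⟩ := LGraph.exists_primrecPred_matchesOnto (N := N) (W := W) (X := X)
    (E := E) (F := F)
  -- The bound of `IsConcreteDerivation.length_le`, with `bareSteps` replaced by its own bound.
  let bound : Grammar N W X E F × LGraph N W X E F → ℕ := fun a => 4 * a.2.verts.length +
    2 * (a.1.productions.length * (a.1.bodySize + 1) ^ Nat.card X)
  let enumerate : Grammar N W X E F × LGraph N W X E F →
      List ((List (ℕ × ℕ) × List (ℕ × E × ℕ)) × LGraph N W X E F) := fun a =>
    ((search a.1.derivationSteps (bound a) a.1.startGraph).filter fun d =>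
      ∀ x, ¬ d.2.IsNonterminal x).flatMap fun d =>
        ((search a.1.decodingSteps a.2.verts.length d.2).filter fun e =>
          (∀ x α y, (x, ELabel.enc α, y) ∉ e.2.edges) ∧ P (e.2, a.2)).map fun e =>
            ((d.1, e.1), e.2)
  have hcomp : Primrec enumerate := by
    refine Prim.flatMap' (Prim.filter' (by fun_prop) (LGraph.primrecPred_no_nonterminal
      (by fun_prop))) (Prim.map' (Prim.filter' (by fun_prop) (Prim.and'
        (LGraph.primrecPred_no_enc (by fun_prop)) (hP.comp (by fun_prop)))) (by fun_prop))
  have hmem : ∀ (B : Grammar N W X E F) (H : LGraph N W X E F),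
      B.IsBESG → B.IsMatchExhaustive → H.IsStringGraph → ∀ s t K,
        ((s, t), K) ∈ enumerate (B, H) ↔ B.IsConcreteDerivation s t K ∧ K.MatchesOnto H := by
    intro B H hB hM hH s t K
    simp only [enumerate, List.mem_flatMap, List.mem_map, List.mem_filter, decide_eq_true_eq,
      Grammar.mem_search_derivationSteps, Grammar.mem_search_decodingSteps, hPm _ _ hH]
    constructor
    · rintro ⟨⟨s, H₁⟩, ⟨⟨-, h1⟩, h2⟩, ⟨t, K⟩, ⟨⟨-, h3⟩, h4, h5⟩, heq⟩
      cases heq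
      exact ⟨⟨H₁, h1, h2, h3, h4⟩, h5⟩
    · rintro ⟨h, hK⟩
      obtain ⟨hs, ht⟩ := h.length_le hB hM hK
      obtain ⟨H₁, h1, h2, h3, h4⟩ := h
      have := h1.bareSteps_le hB hM
      exact ⟨(s, H₁), ⟨⟨by simp only [bound]; omega, h1⟩, h2⟩, (t, K), ⟨⟨ht, h3⟩, h4, hK⟩, rfl⟩
  refine ⟨enumerate, hcomp.to_comp, fun B H hB hM hH => ⟨?_, hmem B H hB hM hH⟩⟩
  refine (List.finite_toSet (enumerate (B, H))).subset ?_
  rintro ⟨⟨s, t⟩, K⟩ h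
  exact (hmem B H hB hM hH s t K).2 h
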